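/- Let $B_l\subset\mathbb R^2$ be the open disk of radius $l>0$ centred at $0$, and let $S^1=\partial B_1$. We write $\gamma(\theta)$ for $\gamma(\cos\theta,\sin\theta)$. Strict convergence in $BV$ means convergence in $L^1$ together with convergence of the total variations of the distributional derivatives (on $B_l$, or on the circle $S^1$). Put $Jv=\det\nabla v$ and define the following. - For $u\in BV(B_l;\mathbb R^2)$, $$\overline{TVJ}_{BV}(u,B_l)=\inf\Big\{\liminf_{k\to\infty}\int_{B_l}|Jv_k|\,dx:\ v_k\in C^1(B_l;\mathbb R^2),\ v_k\to u\ \text{strictly in } BV(B_l;\mathbb R^2)\Big\}.$$ - For $\varphi\in \mathrm{Lip}(S^1;\mathbb R^2)$, $$P(\varphi)=\inf\Big\{\int_{B_1}|Jv|\,dx:\ v\in \mathrm{Lip}(\overline{B_1};\mathbb R^2),\ v|_{S^1}=\varphi\Big\}.$$ - For $\gamma\in BV(S^1;\mathbb R^2)$, $$\overline P(\gamma)=\inf\Big\{\liminf_{n\to\infty}P(\varphi_n):\ \varphi_n\in \mathrm{Lip}(S^1;\mathbb R^2),\ \varphi_n\to\gamma\ \text{strictly in } BV(S^1;\mathbb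 R^2)\Big\}.$$ - For $\gamma\in BV(S^1;\mathbb R^2)$ let $\gamma^-(t),\gamma^+(t)$ be the left and right traces of $\gamma$ at the point of angle $t$ and let $|\dot\gamma|$ be the variation measure of $\gamma$. For $t\in[0,2\pi]$ put $$s^-(t)=\frac{2\pi\,\big(t+|\dot\gamma|([0,t))\big)}{|\dot\gamma|(S^1)+2\pi},\qquad s^+(t)=s^-(t)+\frac{2\pi\,|\gamma^+(t)-\gamma^-(t)|}{|\dot\gamma|(S^1)+2\pi},$$ where at $t=2\pi$ we set $|\dot\gamma|([0,2\pi))=|\dot\gamma|(S^1)$. Every $s\in[0,2\pi)$ lies in $[s^-(t),s^+(t)]$ for exactly one $t\in[0,2\pi)$. The completed curve $\widetilde\gamma:S^1\to\mathbb R^2$ is the curve whose value at angle $s$ is $\gamma^-(t)=\gamma^+(t)$ if $t$ is not a jump point, and otherwise $$\gamma^-(t)+\frac{s-s^-(t)}{s^+(t)-s^-(t)}\big(\gamma^+(t)-\gamma^-(t)\big).$$ In other words, the jumps of $\gamma$ are filled with segments. **Theorem.** Let $l>0$, let $\gamma\in BV(S^1;\mathbb R^2)$, and let $u(x)=\gamma(x/|x|)$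 for a.e. $x\in B_l$ be its $0$-homogeneous extension. Then $\widetilde\gamma$ is Lipschitz and $$\overline{TVJ}_{BV}(u,B_l)=\overline P(\gamma)=P(\widetilde\gamma).$$ -/

import Mathlib

open MeasureTheory Filter Topology Set
open scoped ENNReal

noncomputable section

namespace PlateauBV

/-- The Euclidean plane. -/
abbrev R2 : Type := EuclideanSpace ℝ (Fin 2)

/-- The unit circle in the plane. -/
abbrev S1 : Type := Metric.sphere (0 : R2) 1

/-- The arc-length parametrization `θ ↦ (cos θ, sin θ)` of the unit circle. -/
def circ (θ : ℝ) : S1 :=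
  ⟨!₂[Real.cos θ, Real.sin θ], by simp [EuclideanSpace.norm_eq]⟩

/-- The angle in `[0, 2π)` of a point of the unit circle. -/
def angle (y : S1) : ℝ :=
  toIcoMod Real.two_pi_pos 0 (Complex.arg ⟨y.1 0, y.1 1⟩)

/-! ### Functions of bounded variation on a planar open set -/

/-- The divergence of a planar vector field. -/
def divergence (h : R2 → R2) (x : R2) : ℝ :=
  ∑ j : Fin 2, (fderiv ℝ h x (EuclideanSpace.single j 1)) j

/-- Admissible test fields for the total variation on `Ω`: the two rows `g 0`, `g 1` of a
matrix field of class `C¹` with compact support in `Ω` and Frobenius norm at most one. -/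
def IsTestField (Ω : Set R2) (g : Fin 2 → R2 → R2) : Prop :=
  (∀ i, ContDiff ℝ 1 (g i) ∧ HasCompactSupport (g i) ∧ tsupport (g i) ⊆ Ω) ∧
    ∀ x, ∑ i : Fin 2, ‖g i x‖ ^ 2 ≤ 1

/-- The total variation `|Du|(Ω)` of the distributional derivative of `u`. -/
def totalVariation (u : R2 → R2) (Ω : Set R2) : ℝ≥0∞ :=
  ⨆ (g : Fin 2 → R2 → R2) (_ : IsTestField Ω g),
    ENNReal.ofReal (∫ x in Ω, ∑ i : Fin 2, u x i * divergence (g i) x)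

/-- `u ∈ BV(Ω; ℝ²)`. -/
def MemBV (u : R2 → R2) (Ω : Set R2) : Prop :=
  IntegrableOn u Ω volume ∧ totalVariation u Ω < ∞

/-- Strict convergence `v k → u` in `BV(Ω; ℝ²)`. -/
def StrictBV (v : ℕ → R2 → R2) (u : R2 → R2) (Ω : Set R2) : Prop :=
  (∀ k, MemBV (v k) Ω) ∧ MemBV u Ω ∧
    Tendsto (fun k => ∫⁻ x in Ω, ‖v k x - u x‖ₑ) atTop (𝓝 0) ∧
    Tendsto (fun k => totalVariation (v k) Ω) atTop (𝓝 (totalVariation u Ω))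

/-- The total variation `∫_Ω |Jv| dx` of the Jacobian determinant of `v`. -/
def tvJ (v : R2 → R2) (Ω : Set R2) : ℝ≥0∞ :=
  ∫⁻ x in Ω, ENNReal.ofReal |(fderiv ℝ v x).det|

/-- The relaxation of `∫_Ω |Jv| dx` from `C¹(Ω; ℝ²)` with respect to strict convergence
in `BV(Ω; ℝ²)`. -/
def relaxedTVJ (u : R2 → R2) (Ω : Set R2) : ℝ≥0∞ :=
  ⨅ (v : ℕ → R2 → R2) (_ : (∀ k, ContDiffOn ℝ 1 (v k) Ω) ∧ StrictBV v u Ω),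
    liminf (fun k => tvJ (v k) Ω) atTop

/-! ### Functions of bounded variation on the circle -/

/-- The total variation on the circle: the supremum of `∫₀^{2π} γ(θ) · f'(θ) dθ` over the
`2π`-periodic `C¹` functions `f` with values in the closed unit disk. -/
def circleVariation (γ : S1 → R2) : ℝ≥0∞ :=
  ⨆ (f : ℝ → R2) (_ : ContDiff ℝ 1 f ∧ Function.Periodic f (2 * Real.pi) ∧ ∀ θ, ‖f θ‖ ≤ 1),
    ENNReal.ofReal (∫ θ in Ioc 0 (2 * Real.pi), inner ℝ (γ (circ θ)) (deriv f θ))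

/-- `γ ∈ BV(S¹; ℝ²)`. -/
def MemBVCircle (γ : S1 → R2) : Prop :=
  IntegrableOn (fun θ => γ (circ θ)) (Ioc 0 (2 * Real.pi)) volume ∧ circleVariation γ < ∞

/-- Strict convergence `φ n → γ` in `BV(S¹; ℝ²)`. -/
def StrictBVCircle (φ : ℕ → S1 → R2) (γ : S1 → R2) : Prop :=
  (∀ n, MemBVCircle (φ n)) ∧ MemBVCircle γ ∧
    Tendsto (fun n => ∫⁻ θ in Ioc 0 (2 * Real.pi), ‖φ n (circ θ) - γ (circ θ)‖ₑ) atTop (𝓝 0) ∧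
    Tendsto (fun n => circleVariation (φ n)) atTop (𝓝 (circleVariation γ))

/-- The `0`-homogeneous extension `x ↦ γ (x / |x|)` (the value at the origin is immaterial). -/
def homExt (γ : S1 → R2) (x : R2) : R2 :=
  if hx : x ≠ 0 then
    γ ⟨‖x‖⁻¹ • x, by simp [norm_smul, inv_mul_cancel₀ (norm_ne_zero_iff.mpr hx)]⟩
  else 0

/-! ### The planar Plateau problem and its relaxation -/

/-- The Plateau value `P(φ)`: the infimum of `∫_{B₁} |Jv| dx` among the Lipschitz maps `v` of
the closed unit disk that agree with `φ` on the unit circle. -/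
def plateau (φ : S1 → R2) : ℝ≥0∞ :=
  ⨅ (v : R2 → R2) (_ : (∃ K, LipschitzOnWith K v (Metric.closedBall 0 1)) ∧
      ∀ y : S1, v y = φ y),
    tvJ v (Metric.ball 0 1)

/-- The relaxation of `P` from Lipschitz curves with respect to strict convergence in
`BV(S¹; ℝ²)`. -/
def relaxedPlateau (γ : S1 → R2) : ℝ≥0∞ :=
  ⨅ (φ : ℕ → S1 → R2) (_ : (∀ n, ∃ K, LipschitzWith K (φ n)) ∧ StrictBVCircle φ γ),
    liminf (fun n => plateau (φ n)) atTop

/-! ### The completed curve -/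

/-- The left trace `γ⁻(t)` at the point of angle `t`, as the limit of one-sided averages. -/
def leftTrace (γ : S1 → R2) (t : ℝ) : R2 :=
  limUnder (𝓝[>] (0 : ℝ)) (fun ε => ε⁻¹ • ∫ θ in (t - ε)..t, γ (circ θ))

/-- The right trace `γ⁺(t)` at the point of angle `t`, as the limit of one-sided averages. -/
def rightTrace (γ : S1 → R2) (t : ℝ) : R2 :=
  limUnder (𝓝[>] (0 : ℝ)) (fun ε => ε⁻¹ • ∫ θ in t..(t + ε), γ (circ θ))

/-- The mass `|γ̇|([0, t))` for `0 ≤ t ≤ 2π`, as the pointwise variation on `[0, t]` of the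
left-continuous representative of `γ`. At `t = 2π` this is the full mass `|γ̇|(S¹)`. -/
def massBefore (γ : S1 → R2) (t : ℝ) : ℝ :=
  (eVariationOn (leftTrace γ) (Icc 0 t)).toReal

/-- The normalizing factor `2π / (|γ̇|(S¹) + 2π)`. -/
def speedFactor (γ : S1 → R2) : ℝ :=
  2 * Real.pi / (massBefore γ (2 * Real.pi) + 2 * Real.pi)

/-- The new parameter `s⁻(t) = 2π / (|γ̇|(S¹) + 2π) · (t + |γ̇|([0, t)))` at which the completed
curve reaches the left trace of `γ` at `t`. -/
def sMinus (γ : S1 → R2) (t : ℝ) : ℝ :=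
  speedFactor γ * (t + massBefore γ t)

/-- The new parameter `s⁺(t) = 2π / (|γ̇|(S¹) + 2π) · (t + |γ̇|([0, t]))` at which the completed
curve leaves the right trace of `γ` at `t`. -/
def sPlus (γ : S1 → R2) (t : ℝ) : ℝ :=
  speedFactor γ * (t + massBefore γ t + ‖rightTrace γ t - leftTrace γ t‖)

/-- The generalized inverse of the parameter change: the `t ∈ [0, 2π]` whose interval
`[s⁻(t), s⁺(t)]` contains `s`. -/
def oldParam (γ : S1 → R2) (s : ℝ) : ℝ :=
  sSup {t | t ∈ Icc 0 (2 * Real.pi) ∧ sMinus γ t ≤ s}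

/-- The completed curve in the parameter `s ∈ [0, 2π]`. Each interval `[s⁻(t), s⁺(t)]` is mapped
affinely onto the segment from `γ⁻(t)` to `γ⁺(t)`; if `t` is not a jump point then the interval
is a point, the quotient below is `0 / 0 = 0`, and the value is `γ⁻(t) = γ⁺(t)`. -/
def completedParam (γ : S1 → R2) (s : ℝ) : R2 :=
  let t := oldParam γ s
  AffineMap.lineMap (leftTrace γ t) (rightTrace γ t)
    ((s - sMinus γ t) / (sPlus γ t - sMinus γ t))

/-- The completed curve `γ̃ : S¹ → ℝ²`, obtained by filling the jumps of `γ` with segments. -/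
def completedCurve (γ : S1 → R2) (y : S1) : R2 :=
  completedParam γ (angle y)

end PlateauBV

end

/-!
The two equalities follow from a cycle of three inequalities,
`relaxedPlateau γ ≤ relaxedTVJ u ≤ plateau (completedCurve γ) ≤ relaxedPlateau γ`.
Functions on the circle are lifted to `2π`-periodic functions of the angle, and `γ` is replaced by
its left-continuous representative `leftTrace γ`, whose pointwise variation over a period is the
distributional variation (`exists_leftContinuous_representative`,
`circleVariation_eq_eVariationOn`).

* *Slicing* (`relaxedPlateau_le_relaxedTVJ`). Let `v k → u` strictly. The integral of the angular
  derivative of `v k` is at most `|D (v k)|` (`lintegral_angular_le_totalVariation`), and `|Du|` is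
  the radius of the disk times the variation of `γ` (`totalVariation_homExt`). Hence Fubini's
  theorem in polar coordinates and Fatou's lemma give a circle on which a subsequence of the
  `v k` converges strictly to `γ`. The restriction of `v k` to the disk bounded by this circle
  is a competitor for the Plateau problem.

* *Recovery* (`relaxedTVJ_le_plateau_completedCurve`). Composing the completed curve with Lipschitz
  approximations of the parameter change gives Lipschitz curves `φ k` converging strictly to `γ`,
  and their Plateau values are no larger than that of the completed curve (`plateau_comp_le`). An
  almost optimal competitor for `φ k`, shrunk to a small disk and extended by the `0`-homogeneous
  map `φ k (x / |x|)`, whose Jacobian vanishes, is mollified to a recovery sequence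
  (`exists_smooth_recovery`).

* *Compactness* (`plateau_completedCurve_le_relaxedPlateau`). If Lipschitz curves converge strictly
  to `γ`, then their reparametrizations proportional to elapsed angle plus elapsed variation are
  equi-Lipschitz. They converge to the completed curve: at the parameters `s⁻(t)` and `s⁺(t)`
  because the variations of initial arcs converge, and in between because a curve of this speed
  that joins the endpoints of a jump in the available time must run along the segment. The
  Plateau value does not increase under monotone reparametrization, and it is lower semicontinuous
  along equi-Lipschitz sequences (`plateau_le_liminf`), by interpolation on an annulus.

Both facts on the Plateau value use that the Jacobian of a map vanishes where the map takes the same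
value at points arbitrarily close by (`det_eq_zero_of_frequently_eq`), for instance along the level
curves of a map that factors through a real parameter.
-/

noncomputable section

namespace PlateauBV

/-! ### Polar coordinates in the plane -/

/-- The point of the plane with polar coordinates `(r, θ)`. -/
def polar (r θ : ℝ) : R2 := !₂[r * Real.cos θ, r * Real.sin θ]

/-- The argument in `(-π, π]` of a point of the plane. -/
def argR (x : R2) : ℝ := Complex.arg ⟨x 0, x 1⟩

/-- The direction `x / |x|` of a point of the plane, with the value `circ 0` at the origin. -/
def dirc (x : R2) : S1 := circ (argR x)

@[simp] lemma polar_zero (r θ : ℝ) : polar r θ 0 = r * Real.cos θ := rfl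

@[simp] lemma polar_one (r θ : ℝ) : polar r θ 1 = r * Real.sin θ := rfl

@[simp] lemma circ_zero (θ : ℝ) : (circ θ : R2) 0 = Real.cos θ := rfl

@[simp] lemma circ_one (θ : ℝ) : (circ θ : R2) 1 = Real.sin θ := rfl

lemma ext2 {x y : R2} (h0 : x 0 = y 0) (h1 : x 1 = y 1) : x = y := by
  ext i; fin_cases i
  · exact h0
  · exact h1

lemma norm_sq_R2 (x : R2) : ‖x‖ ^ 2 = x 0 ^ 2 + x 1 ^ 2 := by
  simp [EuclideanSpace.norm_sq_eq, Fin.sum_univ_two]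

lemma polar_eq_smul (r θ : ℝ) : polar r θ = r • (circ θ : R2) :=
  ext2 (by simp) (by simp)

lemma norm_polar (r θ : ℝ) : ‖polar r θ‖ = |r| := by
  have h := (circ θ).2
  rw [mem_sphere_zero_iff_norm] at h
  rw [polar_eq_smul, norm_smul, h, mul_one, Real.norm_eq_abs]

lemma circ_periodic : Function.Periodic circ (2 * Real.pi) := by
  intro θ
  apply Subtype.ext
  exact ext2 (by simp) (by simp)

lemma polar_periodic (r : ℝ) : Function.Periodic (polar r) (2 * Real.pi) := by
  intro θ
  exact ext2 (by simp) (by simp)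

lemma polar_norm_argR (x : R2) : polar ‖x‖ (argR x) = x := by
  have hn : ‖x‖ = ‖(⟨x 0, x 1⟩ : ℂ)‖ := by
    rw [← sq_eq_sq₀ (norm_nonneg _) (norm_nonneg _), norm_sq_R2, Complex.sq_norm,
      Complex.normSq_mk]
    ring
  rw [hn]
  refine ext2 ?_ ?_
  · simp [argR]
  · simp [argR]

lemma norm_smul_dirc (x : R2) : ‖x‖ • (dirc x : R2) = x := by
  rw [dirc, ← polar_eq_smul, polar_norm_argR]

lemma dirc_eq {x : R2} (hx : x ≠ 0) : (dirc x : R2) = ‖x‖⁻¹ • x := by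
  conv_rhs => rw [← norm_smul_dirc x]
  have : ‖x‖ ≠ 0 := norm_ne_zero_iff.mpr hx
  rw [norm_smul, norm_norm, mem_sphere_zero_iff_norm.mp (dirc x).2, mul_one, smul_smul,
    inv_mul_cancel₀ this, one_smul]

lemma dirc_polar {r : ℝ} (hr : 0 < r) (θ : ℝ) : dirc (polar r θ) = circ θ := by
  have hx : polar r θ ≠ 0 := by
    rw [← norm_pos_iff, norm_polar]; positivity
  apply Subtype.ext
  rw [dirc_eq hx, norm_polar, abs_of_pos hr, polar_eq_smul, smul_smul, inv_mul_cancel₀ hr.ne',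
    one_smul]

lemma dirc_coe (y : S1) : dirc (y : R2) = y := by
  have h := mem_sphere_zero_iff_norm.mp y.2
  have hx : (y : R2) ≠ 0 := by
    rw [← norm_pos_iff, h]; norm_num
  apply Subtype.ext
  rw [dirc_eq hx, h]; simp

lemma circ_surjective : Function.Surjective circ := fun y => ⟨argR y, dirc_coe y⟩

lemma homExt_of_ne {γ : S1 → R2} {x : R2} (hx : x ≠ 0) : homExt γ x = γ (dirc x) := by
  rw [homExt, dif_pos hx]
  congr 1
  apply Subtype.ext
  rw [dirc_eq hx]

lemma circ_angle (y : S1) : circ (angle y) = y := by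
  have h : circ (argR y) = y := dirc_coe y
  have : angle y = toIcoMod Real.two_pi_pos 0 (argR y) := rfl
  rw [this, toIcoMod, circ_periodic.sub_zsmul_eq, h]

lemma angle_mem (y : S1) : angle y ∈ Ico 0 (2 * Real.pi) := by
  have : angle y ∈ Ico 0 (0 + 2 * Real.pi) := toIcoMod_mem_Ico Real.two_pi_pos 0 (argR y)
  rwa [zero_add] at this

lemma angle_circ {θ : ℝ} (h : θ ∈ Ico 0 (2 * Real.pi)) : angle (circ θ) = θ := by
  have h1 := circ_angle (circ θ)
  have h2 := angle_mem (circ θ)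
  have hc : Real.cos (angle (circ θ)) = Real.cos θ := by
    simpa using congrArg (fun y : S1 => (y : R2) 0) h1
  have hs : Real.sin (angle (circ θ)) = Real.sin θ := by
    simpa using congrArg (fun y : S1 => (y : R2) 1) h1
  have h3 : ((angle (circ θ) : ℝ) : Real.Angle) = θ := Real.Angle.cos_sin_inj hc hs
  rw [Real.Angle.angle_eq_iff_two_pi_dvd_sub] at h3
  obtain ⟨k, hk⟩ := h3
  have hp := Real.pi_pos
  have hk1 : (k : ℝ) < 1 := by
    by_contra! hcon
    nlinarith [h.1, h.2, h2.1, h2.2]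
  have hk2 : (-1 : ℝ) < k := by
    by_contra! hcon
    nlinarith [h.1, h.2, h2.1, h2.2]
  have : k = 0 := by
    have a1 : k < 1 := by exact_mod_cast hk1
    have a2 : -1 < k := by exact_mod_cast hk2
    omega
  rw [this] at hk
  simp at hk
  linarith

/-- The chord is at most as long as the arc. -/
lemma lipschitz_circ : LipschitzWith 1 (fun θ => (circ θ : R2)) := by
  apply LipschitzWith.of_dist_le_mul
  intro a b
  rw [NNReal.coe_one, one_mul, dist_eq_norm, Real.dist_eq,
    ← sq_le_sq₀ (norm_nonneg _) (abs_nonneg _), norm_sq_R2, sq_abs]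
  simp only [PiLp.sub_apply, circ_zero, circ_one]
  have h1 : (Real.cos a - Real.cos b) ^ 2 + (Real.sin a - Real.sin b) ^ 2
      = 2 - 2 * Real.cos (a - b) := by
    rw [Real.cos_sub]
    nlinarith [Real.sin_sq_add_cos_sq a, Real.sin_sq_add_cos_sq b]
  rw [h1]
  nlinarith [Real.one_sub_sq_div_two_le_cos (x := a - b)]

lemma continuous_circ : Continuous circ :=
  lipschitz_circ.continuous.subtype_mk _

lemma continuous_polar : Continuous (fun p : ℝ × ℝ => polar p.1 p.2) := by
  simp_rw [polar_eq_smul]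
  exact continuous_fst.smul (continuous_subtype_val.comp (continuous_circ.comp continuous_snd))

@[fun_prop]
lemma measurable_argR : Measurable argR := by
  have h : Continuous (fun x : R2 => (x 0, x 1)) := by fun_prop
  exact Complex.measurable_arg.comp
    (Complex.measurableEquivRealProd.symm.measurable.comp h.measurable)

@[fun_prop]
lemma measurable_dirc : Measurable dirc := continuous_circ.measurable.comp measurable_argR

/-- The identification of `ℝ × ℝ` with the Euclidean plane. -/
def prodEquiv : ℝ × ℝ ≃ᵐ R2 :=
  (MeasurableEquiv.finTwoArrow (α := ℝ)).symm.trans (MeasurableEquiv.toLp 2 (Fin 2 → ℝ))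

lemma measurePreserving_prodEquiv : MeasurePreserving prodEquiv := by
  have h := (EuclideanSpace.volume_preserving_symm_measurableEquiv_toLp (Fin 2)).symm
  exact h.comp (volume_preserving_finTwoArrow ℝ).symm

lemma lintegral_polar (f : R2 → ℝ≥0∞) :
    ∫⁻ x, f x = ∫⁻ p in Ioi (0 : ℝ) ×ˢ Ioo (-Real.pi) Real.pi,
      ENNReal.ofReal p.1 * f (polar p.1 p.2) := by
  rw [← measurePreserving_prodEquiv.lintegral_comp_emb prodEquiv.measurableEmbedding,
    ← lintegral_comp_polarCoord_symm]
  rfl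

lemma integral_polar (f : R2 → ℝ) :
    ∫ x, f x = ∫ p in Ioi (0 : ℝ) ×ˢ Ioo (-Real.pi) Real.pi, p.1 * f (polar p.1 p.2) := by
  rw [← measurePreserving_prodEquiv.integral_comp prodEquiv.measurableEmbedding,
    ← integral_comp_polarCoord_symm]
  rfl

lemma setLIntegral_Ioc_periodic {f : ℝ → ℝ≥0∞} (hf : Function.Periodic f (2 * Real.pi))
    (a b : ℝ) : ∫⁻ θ in Ioc a (a + 2 * Real.pi), f θ = ∫⁻ θ in Ioc b (b + 2 * Real.pi), f θ := by
  have h2 := Real.two_pi_pos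
  refine (isAddFundamentalDomain_Ioc h2 a).setLIntegral_eq (isAddFundamentalDomain_Ioc h2 b) f ?_
  intro g x
  exact hf.map_vadd_zmultiples g x

lemma setLIntegral_Ioo_periodic {f : ℝ → ℝ≥0∞} (hf : Function.Periodic f (2 * Real.pi)) :
    ∫⁻ θ in Ioo (-Real.pi) Real.pi, f θ = ∫⁻ θ in Ioc 0 (2 * Real.pi), f θ := by
  have := setLIntegral_Ioc_periodic hf (-Real.pi) 0
  rw [zero_add, show -Real.pi + 2 * Real.pi = Real.pi by ring] at this
  rw [← this]
  exact setLIntegral_congr Ioo_ae_eq_Ioc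

/-- Integration in polar coordinates over a disk. -/
lemma lintegral_ball_polar {f : R2 → ℝ≥0∞} (hf : Measurable f) (R : ℝ) :
    ∫⁻ x in Metric.ball 0 R, f x =
      ∫⁻ r in Ioo 0 R, ENNReal.ofReal r * ∫⁻ θ in Ioc 0 (2 * Real.pi), f (polar r θ) := by
  rw [← lintegral_indicator Metric.isOpen_ball.measurableSet, lintegral_polar,
    Measure.volume_eq_prod, ← Measure.prod_restrict, lintegral_prod]
  · rw [← lintegral_indicator measurableSet_Ioi, ← lintegral_indicator measurableSet_Ioo]
    congr 1
    ext r
    by_cases hr : 0 < r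
    · rw [indicator_of_mem (show r ∈ Ioi 0 from hr)]
      by_cases hR : r < R
      · rw [indicator_of_mem (show r ∈ Ioo 0 R from ⟨hr, hR⟩)]
        have : ∀ θ, (Metric.ball (0 : R2) R).indicator f (polar r θ) = f (polar r θ) := by
          intro θ
          rw [indicator_of_mem]
          rw [mem_ball_zero_iff, norm_polar, abs_of_pos hr]; exact hR
        simp_rw [this]
        rw [lintegral_const_mul, setLIntegral_Ioo_periodic]
        · intro θ
          simp only [polar_periodic r θ]
        · exact hf.comp (continuous_polar.measurable.comp measurable_prodMk_left)
      · rw [indicator_of_notMem (fun h : r ∈ Ioo 0 R => hR h.2)]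
        have : ∀ θ, (Metric.ball (0 : R2) R).indicator f (polar r θ) = 0 := by
          intro θ
          rw [indicator_of_notMem]
          rw [mem_ball_zero_iff, norm_polar, abs_of_pos hr]; exact hR
        simp [this]
    · rw [indicator_of_notMem (fun h : r ∈ Ioi 0 => hr h),
        indicator_of_notMem (fun h : r ∈ Ioo 0 R => hr h.1)]
  · refine Measurable.aemeasurable ?_
    refine (ENNReal.measurable_ofReal.comp measurable_fst).mul ?_
    exact (hf.indicator Metric.isOpen_ball.measurableSet).comp continuous_polar.measurable

lemma argR_polar {r θ : ℝ} (hr : 0 < r) (hθ : θ ∈ Ioo (-Real.pi) Real.pi) :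
    argR (polar r θ) = θ := by
  have := Complex.arg_mul_cos_add_sin_mul_I hr ⟨hθ.1, hθ.2.le⟩
  refine Eq.trans ?_ this
  rw [argR]
  congr 1
  apply Complex.ext
  · simp [← Complex.ofReal_cos, ← Complex.ofReal_sin]
  · simp [← Complex.ofReal_cos, ← Complex.ofReal_sin]

/-- A property of almost every direction holds at almost every angle on the line. -/
lemma ae_circ {p : S1 → Prop}
    (h : ∀ᵐ θ ∂volume.restrict (Ioc 0 (2 * Real.pi)), p (circ θ)) : ∀ᵐ θ : ℝ, p (circ θ) := by
  refine (isAddFundamentalDomain_Ioc Real.two_pi_pos 0).measure_zero_of_invariant _ ?_ ?_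
  · intro g
    ext θ
    rw [Set.mem_vadd_set_iff_neg_vadd_mem]
    have : circ (-g +ᵥ θ) = circ θ := circ_periodic.map_vadd_zmultiples (-g) θ
    simp only [mem_compl_iff, mem_ofPred_eq, this]
  · rw [zero_add]
    rw [ae_restrict_iff' measurableSet_Ioc] at h
    refine measure_mono_null ?_ h
    intro θ hθ hcon
    exact hθ.1 (hcon hθ.2)

/-- A property of almost every direction holds at almost every point of the plane. -/
lemma ae_dirc {p : S1 → Prop}
    (h : ∀ᵐ θ ∂volume.restrict (Ioc 0 (2 * Real.pi)), p (circ θ)) : ∀ᵐ x : R2, p (dirc x) := by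
  obtain ⟨N, hsub, hN, hN0⟩ := exists_measurable_superset_of_null (ae_circ h)
  have hA : volume (argR ⁻¹' N) = 0 := by
    rw [← lintegral_indicator_one (measurable_argR hN), lintegral_polar,
      lintegral_eq_zero_of_ae_eq_zero]
    rw [EventuallyEq, ae_restrict_iff' (measurableSet_Ioi.prod measurableSet_Ioo)]
    have : ∀ᵐ q : ℝ × ℝ, q.2 ∉ N :=
      Measure.quasiMeasurePreserving_snd.ae (p := fun t => t ∉ N)
        (measure_eq_zero_iff_ae_notMem.mp hN0)
    filter_upwards [this] with q hq hq2
    rw [indicator_of_notMem]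
    · simp
    · rw [mem_preimage, argR_polar hq2.1 hq2.2]
      exact hq
  refine measure_mono_null ?_ hA
  intro x hx
  exact hsub hx

/-! ### Periodic functions of bounded variation on the line -/

section PeriodicBV

variable {T : ℝ}

/-- The total variation over a period of a `T`-periodic function, in the sense of distributions. -/
def perVar (T : ℝ) (g : ℝ → R2) : ℝ≥0∞ :=
  ⨆ (f : ℝ → R2) (_ : ContDiff ℝ 1 f ∧ Function.Periodic f T ∧ ∀ θ, ‖f θ‖ ≤ 1),
    ENNReal.ofReal (∫ θ in Ioc 0 T, inner ℝ (g θ) (deriv f θ))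

/-- The average of `g` over the interval of length `h` to the left of `t`. -/
def leftAvg (g : ℝ → R2) (h t : ℝ) : R2 := h⁻¹ • ∫ s in (t - h)..t, g s

lemma locallyIntegrable_of_periodic (hT : 0 < T) {g : ℝ → R2} (hg : Function.Periodic g T)
    (hi : IntegrableOn g (Ioc 0 T)) : LocallyIntegrable g := by
  have h : IntervalIntegrable g volume 0 (0 + T) := by
    rw [intervalIntegrable_iff_integrableOn_Ioc_of_le (by linarith), zero_add]
    exact hi
  rw [locallyIntegrable_iff]
  intro K hK
  obtain ⟨R, hR⟩ := hK.isBounded.subset_closedBall 0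
  have := hg.intervalIntegrable hT.ne' h (-|R|) |R|
  rw [intervalIntegrable_iff_integrableOn_Icc_of_le (by linarith [abs_nonneg R])] at this
  refine this.mono_set (hR.trans ?_)
  rw [Real.closedBall_eq_Icc]
  exact Icc_subset_Icc (by linarith [le_abs_self R]) (by linarith [le_abs_self R])

lemma LocallyIntegrable.intervalIntegrable' {g : ℝ → R2} (hg : LocallyIntegrable g) (a b : ℝ) :
    IntervalIntegrable g volume a b :=
  intervalIntegrable_iff.mpr
    ((hg.integrableOn_isCompact isCompact_uIcc).mono_set uIoc_subset_uIcc)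

lemma leftAvg_sub {g : ℝ → R2} (hg : LocallyIntegrable g) (h x y : ℝ) :
    leftAvg g h y - leftAvg g h x = h⁻¹ • ∫ t in x..y, (g t - g (t - h)) := by
  have hi := LocallyIntegrable.intervalIntegrable' hg
  have hi2 : IntervalIntegrable (fun t => g (t - h)) volume x y := by
    have := (hi (x - h) (y - h)).comp_sub_right h
    simpa using this
  rw [leftAvg, leftAvg, ← smul_sub, intervalIntegral.integral_sub (hi _ _) hi2,
    intervalIntegral.integral_comp_sub_right,
    intervalIntegral.integral_interval_sub_interval_comm (hi _ _) (hi _ _) (hi _ _)]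
  rw [intervalIntegral.integral_symm x y, intervalIntegral.integral_symm (x - h) (y - h)]
  congr 1
  abel

lemma continuous_leftAvg {g : ℝ → R2} (hg : LocallyIntegrable g) (h : ℝ) :
    Continuous (leftAvg g h) := by
  have hi := LocallyIntegrable.intervalIntegrable' hg
  have hF : Continuous (fun t => ∫ s in (0:ℝ)..t, g s) :=
    intervalIntegral.continuous_primitive hi 0
  have : leftAvg g h = fun t => h⁻¹ • ((∫ s in (0:ℝ)..t, g s) - ∫ s in (0:ℝ)..(t - h), g s) := by
    ext1 t
    rw [leftAvg, intervalIntegral.integral_interval_sub_left (hi _ _) (hi _ _)]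
  rw [this]
  exact (hF.sub (hF.comp (by fun_prop : Continuous fun t : ℝ => t - h))).const_smul h⁻¹

lemma leftAvg_periodic {g : ℝ → R2} (hg : Function.Periodic g T) (h : ℝ) :
    Function.Periodic (leftAvg g h) T := by
  intro t
  rw [leftAvg, leftAvg, show t + T - h = t - h + T by ring,
    ← intervalIntegral.integral_comp_add_right]
  congr 2
  ext1 s
  exact hg s

lemma tendsto_leftAvg_of_hasDerivAt {g : ℝ → R2} (hg : LocallyIntegrable g) {t : ℝ}
    (h : HasDerivAt (fun x => ∫ s in (0:ℝ)..x, g s) (g t) t) :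
    Tendsto (fun ε => leftAvg g ε t) (𝓝[>] 0) (𝓝 (g t)) := by
  have hi := LocallyIntegrable.intervalIntegrable' hg
  have h1 := h.tendsto_slope_zero_left
  have h2 : Tendsto (fun ε : ℝ => -ε) (𝓝[>] 0) (𝓝[<] 0) := by
    have := tendsto_neg_nhdsGT (a := (0 : ℝ))
    simpa using this
  refine (h1.comp h2).congr ?_
  intro ε
  simp only [Function.comp]
  rw [leftAvg, intervalIntegral.integral_interval_sub_left (hi _ _) (hi _ _),
    intervalIntegral.integral_symm, ← sub_eq_add_neg, inv_neg, neg_smul, smul_neg, neg_neg]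

/-- The integral over a period does not depend on the period. -/
lemma integral_shift_periodic {f : ℝ → ℝ} (hf : Function.Periodic f T) (hT : 0 < T) (h : ℝ) :
    ∫ t in Ioc 0 T, f (t + h) = ∫ t in Ioc 0 T, f t := by
  rw [← intervalIntegral.integral_of_le hT.le, ← intervalIntegral.integral_of_le hT.le,
    intervalIntegral.integral_comp_add_right, zero_add, add_comm T h]
  have := hf.intervalIntegral_add_eq h 0
  rwa [zero_add] at this

lemma integrableOn_inner_of_bounded {g ψ : ℝ → R2} (hg : LocallyIntegrable g)
    (hψ : Continuous ψ) (a b : ℝ) :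
    IntegrableOn (fun t => inner ℝ (g t) (ψ t)) (Ioc a b) := by
  have h1 := hg.integrableOn_isCompact (isCompact_Icc (a := a) (b := b))
  obtain ⟨C, hC⟩ := isCompact_Icc.exists_bound_of_continuousOn (s := Icc a b) hψ.continuousOn
  have : IntegrableOn (fun t => inner ℝ (g t) (ψ t)) (Icc a b) := by
    refine Integrable.mono' (h1.norm.mul_const C) ?_ ?_
    · exact h1.aestronglyMeasurable.inner hψ.aestronglyMeasurable
    · rw [ae_restrict_iff' measurableSet_Icc]
      filter_upwards with t ht
      refine (norm_inner_le_norm _ _).trans ?_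
      gcongr
      exact hC t ht
  exact this.mono_set Ioc_subset_Icc_self

lemma LocallyIntegrable.comp_sub' {g : ℝ → R2} (hg : LocallyIntegrable g) (h : ℝ) :
    LocallyIntegrable (fun t => g (t - h)) := by
  rw [locallyIntegrable_iff]
  intro K hK
  obtain ⟨R, hR⟩ := hK.isBounded.subset_closedBall 0
  have h1 := (LocallyIntegrable.intervalIntegrable' hg (-|R| - h) (|R| - h)).comp_sub_right h
  simp only [sub_add_cancel] at h1
  rw [intervalIntegrable_iff_integrableOn_Icc_of_le (by linarith [abs_nonneg R])] at h1
  refine h1.mono_set (hR.trans ?_)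
  rw [Real.closedBall_eq_Icc]
  exact Icc_subset_Icc (by linarith [le_abs_self R]) (by linarith [le_abs_self R])

lemma hasDerivAt_rightAvg {ψ : ℝ → R2} (hψ : Continuous ψ) (h t : ℝ) :
    HasDerivAt (fun t => h⁻¹ • ∫ s in t..(t + h), ψ s) (h⁻¹ • (ψ (t + h) - ψ t)) t := by
  have hi : ∀ a b, IntervalIntegrable ψ volume a b := fun a b => hψ.intervalIntegrable a b
  have hF : ∀ x, HasDerivAt (fun t => ∫ s in (0:ℝ)..t, ψ s) (ψ x) x := fun x =>
    intervalIntegral.integral_hasDerivAt_right (hi _ _) (hψ.stronglyMeasurableAtFilter _ _)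
      hψ.continuousAt
  have : (fun t => h⁻¹ • ∫ s in t..(t + h), ψ s)
      = fun t => h⁻¹ • ((∫ s in (0:ℝ)..(t + h), ψ s) - ∫ s in (0:ℝ)..t, ψ s) := by
    ext1 t
    rw [intervalIntegral.integral_interval_sub_left (hi _ _) (hi _ _)]
  rw [this]
  exact (((hF (t + h)).comp_add_const t h).sub (hF t)).const_smul h⁻¹

/-- Discrete integration by parts over a period. -/
lemma integral_inner_translate {g ψ : ℝ → R2} (hT : 0 < T) (hp : Function.Periodic g T)
    (hg : LocallyIntegrable g) (hψ : Continuous ψ) (hψp : Function.Periodic ψ T) (h : ℝ) :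
    ∫ t in Ioc 0 T, inner ℝ (g t - g (t - h)) (ψ t)
      = - ∫ t in Ioc 0 T, inner ℝ (g t) (ψ (t + h) - ψ t) := by
  have hψ' : Continuous (fun t => ψ (t + h)) := by fun_prop
  have i1 := integrableOn_inner_of_bounded hg hψ 0 T
  have i2 := integrableOn_inner_of_bounded (LocallyIntegrable.comp_sub' hg h) hψ 0 T
  have i3 := integrableOn_inner_of_bounded hg hψ' 0 T
  simp_rw [inner_sub_left, inner_sub_right]
  rw [integral_sub i1 i2, integral_sub i3 i1, neg_sub]
  congr 1
  have := integral_shift_periodic (f := fun t => inner ℝ (g (t - h)) (ψ t)) (T := T) ?_ hT h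
  · rw [← this]; simp
  · intro t
    simp only
    rw [show t + T - h = t - h + T by ring, hp, hψp]

lemma integral_inner_le_perVar {g ψ : ℝ → R2} (hT : 0 < T) (hp : Function.Periodic g T)
    (hg : LocallyIntegrable g) (hV : perVar T g ≠ ∞) (hψ : Continuous ψ)
    (hψp : Function.Periodic ψ T) (hψ1 : ∀ t, ‖ψ t‖ ≤ 1) {h : ℝ} (hh : 0 < h) :
    ∫ t in Ioc 0 T, inner ℝ (g t - g (t - h)) (ψ t) ≤ h * (perVar T g).toReal := by
  set F : ℝ → R2 := fun t => -(h⁻¹ • ∫ s in t..(t + h), ψ s) with hF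
  have hFd : ∀ t, HasDerivAt F (-(h⁻¹ • (ψ (t + h) - ψ t))) t := fun t =>
    (hasDerivAt_rightAvg hψ h t).neg
  have hFd' : deriv F = fun t => -(h⁻¹ • (ψ (t + h) - ψ t)) := funext fun t => (hFd t).deriv
  have hF1 : ContDiff ℝ 1 F := by
    rw [contDiff_one_iff_deriv, hFd']
    exact ⟨fun t => (hFd t).differentiableAt, by fun_prop⟩
  have hFp : Function.Periodic F T := by
    intro t
    simp only [hF]
    rw [show t + T + h = t + h + T by ring, ← intervalIntegral.integral_comp_add_right]
    simp_rw [hψp _]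
  have hFn : ∀ t, ‖F t‖ ≤ 1 := by
    intro t
    simp only [hF]
    rw [norm_neg, norm_smul, norm_inv, Real.norm_of_nonneg hh.le]
    have := intervalIntegral.norm_integral_le_of_norm_le_const (a := t) (b := t + h) (C := 1)
      (f := ψ) (fun x _ => hψ1 x)
    rw [add_sub_cancel_left, abs_of_pos hh, one_mul] at this
    rw [inv_mul_le_iff₀ hh, mul_one]; exact this
  have hle : ENNReal.ofReal (∫ θ in Ioc 0 T, inner ℝ (g θ) (deriv F θ)) ≤ perVar T g :=
    le_iSup₂_of_le F ⟨hF1, hFp, hFn⟩ le_rfl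
  have hle2 := (ENNReal.ofReal_le_iff_le_toReal hV).mp hle
  rw [integral_inner_translate hT hp hg hψ hψp]
  have : ∫ θ in Ioc 0 T, inner ℝ (g θ) (deriv F θ)
      = h⁻¹ * -∫ t in Ioc 0 T, inner ℝ (g t) (ψ (t + h) - ψ t) := by
    rw [hFd', ← integral_neg, ← integral_const_mul]
    congr 1
    ext1 t
    rw [inner_neg_right, inner_smul_right]; ring
  rw [this, inv_mul_le_iff₀ hh] at hle2
  exact hle2

/-- The `L¹` modulus of continuity of a periodic function is controlled by its variation. -/
lemma lintegral_translate_le_perVar {g : ℝ → R2} (hT : 0 < T) (hp : Function.Periodic g T)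
    (hg : LocallyIntegrable g) (hV : perVar T g ≠ ∞) {h : ℝ} (hh : 0 < h) :
    ∫⁻ t in Ioc 0 T, ‖g t - g (t - h)‖ₑ ≤ ENNReal.ofReal h * perVar T g := by
  set q : ℝ → R2 := fun t => g t - g (t - h) with hq
  have hql : LocallyIntegrable q := hg.sub (LocallyIntegrable.comp_sub' hg h)
  have hqp : Function.Periodic q T := by
    intro t
    simp only [hq]
    rw [show t + T - h = t - h + T by ring, hp, hp]
  set ε : ℕ → ℝ := fun n => 1 / ((n : ℝ) + 1) with hε
  have hεpos : ∀ n, 0 < ε n := fun n => Nat.one_div_pos_of_nat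
  have hε0 : Tendsto ε atTop (𝓝[>] 0) :=
    tendsto_nhdsWithin_iff.mpr ⟨tendsto_one_div_add_atTop_nhds_zero_nat,
      Eventually.of_forall hεpos⟩
  -- Continuous approximations of the direction of `q`, by normalizing its averages.
  set ψ : ℕ → ℝ → R2 := fun n t => (ε n + ‖leftAvg q (ε n) t‖)⁻¹ • leftAvg q (ε n) t with hψ
  have hden : ∀ n t, 0 < ε n + ‖leftAvg q (ε n) t‖ := fun n t => by
    have := hεpos n; positivity
  have hψc : ∀ n, Continuous (ψ n) := by
    intro n
    have := continuous_leftAvg hql (ε n)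
    exact ((continuous_const.add this.norm).inv₀ (fun t => (hden n t).ne')).smul this
  have hψp : ∀ n, Function.Periodic (ψ n) T := by
    intro n t
    simp only [hψ]
    rw [leftAvg_periodic hqp]
  have hψ1 : ∀ n t, ‖ψ n t‖ ≤ 1 := by
    intro n t
    simp only [hψ]
    rw [norm_smul, norm_inv, Real.norm_of_nonneg (hden n t).le, inv_mul_le_iff₀ (hden n t)]
    have := hεpos n; linarith
  have hb : ∀ n, ∫ t in Ioc 0 T, inner ℝ (q t) (ψ n t) ≤ h * (perVar T g).toReal := fun n =>
    integral_inner_le_perVar hT hp hg hV (hψc n) (hψp n) (hψ1 n) hh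
  have hqi : IntegrableOn q (Ioc 0 T) :=
    (hql.integrableOn_isCompact (isCompact_Icc (a := 0) (b := T))).mono_set Ioc_subset_Icc_self
  have hlim : Tendsto (fun n => ∫ t in Ioc 0 T, inner ℝ (q t) (ψ n t)) atTop
      (𝓝 (∫ t in Ioc 0 T, ‖q t‖)) := by
    refine tendsto_integral_of_dominated_convergence (fun t => ‖q t‖) ?_ hqi.norm ?_ ?_
    · intro n
      exact hqi.aestronglyMeasurable.inner (hψc n).aestronglyMeasurable
    · intro n
      filter_upwards with t
      refine (norm_inner_le_norm _ _).trans ?_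
      exact mul_le_of_le_one_right (norm_nonneg _) (hψ1 n t)
    · refine ae_restrict_of_ae ?_
      filter_upwards [LocallyIntegrable.ae_hasDerivAt_integral hql] with t ht
      have h1 : Tendsto (fun n => leftAvg q (ε n) t) atTop (𝓝 (q t)) :=
        (tendsto_leftAvg_of_hasDerivAt hql (ht 0)).comp hε0
      by_cases h0 : q t = 0
      · simp [h0]
      · have h2 : Tendsto (fun n => ψ n t) atTop (𝓝 ((0 + ‖q t‖)⁻¹ • q t)) := by
          refine Tendsto.smul (Tendsto.inv₀ ?_ ?_) h1
          · exact (tendsto_nhds_of_tendsto_nhdsWithin hε0).add h1.norm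
          · rw [zero_add]; exact norm_ne_zero_iff.mpr h0
        have h3 := (tendsto_const_nhds (x := q t)).inner (𝕜 := ℝ) h2
        convert h3 using 2
        rw [zero_add, inner_smul_right, real_inner_self_eq_norm_sq]
        field_simp
  have hfin := le_of_tendsto' hlim hb
  rw [← ofReal_integral_norm_eq_lintegral_enorm hqi]
  refine (ENNReal.ofReal_le_ofReal hfin).trans ?_
  rw [ENNReal.ofReal_mul hh.le, ENNReal.ofReal_toReal hV]

/-- Conversely, the `L¹` modulus of continuity controls the variation. -/
lemma perVar_le_of_lintegral_translate_le {g : ℝ → R2} (hT : 0 < T) (hp : Function.Periodic g T)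
    (hg : LocallyIntegrable g) {K : ℝ≥0∞}
    (hK : ∀ h : ℝ, 0 < h → ∫⁻ t in Ioc 0 T, ‖g t - g (t - h)‖ₑ ≤ ENNReal.ofReal h * K) :
    perVar T g ≤ K := by
  by_cases hKt : K = ∞
  · rw [hKt]; exact le_top
  refine iSup₂_le ?_
  rintro f ⟨hf, hfp, hf1⟩
  refine ENNReal.ofReal_le_of_le_toReal ?_
  set ε : ℕ → ℝ := fun n => 1 / ((n : ℝ) + 1) with hε
  have hεpos : ∀ n, 0 < ε n := fun n => Nat.one_div_pos_of_nat
  have hε0 : Tendsto ε atTop (𝓝[≠] 0) :=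
    tendsto_nhdsWithin_iff.mpr ⟨tendsto_one_div_add_atTop_nhds_zero_nat,
      Eventually.of_forall fun n => (hεpos n).ne'⟩
  have hfc : Continuous f := hf.continuous
  have hfdc : Continuous (deriv f) := hf.continuous_deriv le_rfl
  have hgi : IntegrableOn g (Ioc 0 T) :=
    (hg.integrableOn_isCompact (isCompact_Icc (a := 0) (b := T))).mono_set Ioc_subset_Icc_self
  have hperd : Function.Periodic (deriv f) T := by
    intro t
    rw [← deriv_comp_add_const]
    congr 1
    ext1 s
    exact hfp s
  obtain ⟨C, hC⟩ : ∃ C, ∀ t, ‖deriv f t‖ ≤ C := by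
    obtain ⟨C, hC⟩ := isCompact_Icc.exists_bound_of_continuousOn (s := Icc 0 T) hfdc.continuousOn
    refine ⟨C, fun t => ?_⟩
    obtain ⟨y, hy, hy2⟩ := hperd.exists_mem_Ico₀ hT t
    rw [hy2]
    exact hC y (Ico_subset_Icc_self hy)
  have hLip : ∀ x y, ‖f y - f x‖ ≤ C * ‖y - x‖ := fun x y =>
    convex_univ.norm_image_sub_le_of_norm_deriv_le
      (fun z _ => (hf.differentiable (by norm_num)).differentiableAt) (fun z _ => hC z)
      (mem_univ x) (mem_univ y)
  have hlim : Tendsto (fun n => ∫ t in Ioc 0 T, inner ℝ (g t) ((ε n)⁻¹ • (f (t + ε n) - f t)))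
      atTop (𝓝 (∫ t in Ioc 0 T, inner ℝ (g t) (deriv f t))) := by
    refine tendsto_integral_of_dominated_convergence (fun t => ‖g t‖ * C) ?_
      (hgi.norm.mul_const C) ?_ ?_
    · intro n
      refine hgi.aestronglyMeasurable.inner (Continuous.aestronglyMeasurable ?_)
      fun_prop
    · intro n
      filter_upwards with t
      refine (norm_inner_le_norm _ _).trans ?_
      gcongr
      rw [norm_smul, norm_inv, Real.norm_of_nonneg (hεpos n).le, inv_mul_le_iff₀ (hεpos n)]
      refine (hLip t (t + ε n)).trans ?_
      rw [add_sub_cancel_left, Real.norm_of_nonneg (hεpos n).le, mul_comm]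
    · filter_upwards with t
      refine tendsto_const_nhds.inner ?_
      have := ((hf.differentiable (by norm_num)).differentiableAt (x := t)).hasDerivAt
      exact (hasDerivAt_iff_tendsto_slope_zero.mp this).comp hε0
  refine le_of_tendsto' hlim ?_
  intro n
  have h1 : ∫ t in Ioc 0 T, inner ℝ (g t) ((ε n)⁻¹ • (f (t + ε n) - f t))
      = -((ε n)⁻¹ * ∫ t in Ioc 0 T, inner ℝ (g t - g (t - ε n)) (f t)) := by
    rw [integral_inner_translate hT hp hg hfc hfp, mul_neg, neg_neg, ← integral_const_mul]
    simp_rw [inner_smul_right]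
  rw [h1]
  have hqi : IntegrableOn (fun t => g t - g (t - ε n)) (Ioc 0 T) :=
    ((hg.sub (LocallyIntegrable.comp_sub' hg (ε n))).integrableOn_isCompact
      (isCompact_Icc (a := 0) (b := T))).mono_set Ioc_subset_Icc_self
  have h2 : ‖∫ t in Ioc 0 T, inner ℝ (g t - g (t - ε n)) (f t)‖
      ≤ ∫ t in Ioc 0 T, ‖g t - g (t - ε n)‖ := by
    refine norm_integral_le_of_norm_le hqi.norm ?_
    filter_upwards with t
    refine (norm_inner_le_norm _ _).trans ?_
    exact mul_le_of_le_one_right (norm_nonneg _) (hf1 t)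
  have h3 : ∫ t in Ioc 0 T, ‖g t - g (t - ε n)‖ ≤ ε n * K.toReal := by
    have := hK (ε n) (hεpos n)
    rw [← ofReal_integral_norm_eq_lintegral_enorm hqi,
      ENNReal.ofReal_le_iff_le_toReal (ENNReal.mul_ne_top ENNReal.ofReal_ne_top hKt),
      ENNReal.toReal_mul, ENNReal.toReal_ofReal (hεpos n).le] at this
    exact this
  calc -((ε n)⁻¹ * ∫ t in Ioc 0 T, inner ℝ (g t - g (t - ε n)) (f t))
      ≤ (ε n)⁻¹ * ‖∫ t in Ioc 0 T, inner ℝ (g t - g (t - ε n)) (f t)‖ := by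
        rw [← mul_neg]
        have := hεpos n
        gcongr
        rw [Real.norm_eq_abs]
        exact neg_le_abs _
    _ ≤ (ε n)⁻¹ * (ε n * K.toReal) := by
        have := hεpos n
        gcongr
        exact h2.trans h3
    _ = K.toReal := by
        rw [← mul_assoc, inv_mul_cancel₀ (hεpos n).ne', one_mul]

/-! ### Left-continuous representatives and pointwise variation -/

lemma eVariationOn_le_of_dist_le {F : ℝ → R2} {m : ℝ → ℝ} {a b : ℝ} (hab : a ≤ b)
    (h : ∀ x ∈ Icc a b, ∀ y ∈ Icc a b, x ≤ y → dist (F x) (F y) ≤ m y - m x) :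
    eVariationOn F (Icc a b) ≤ ENNReal.ofReal (m b - m a) := by
  have hm : MonotoneOn m (Icc a b) := fun x hx y hy hxy => by
    have := h x hx y hy hxy
    linarith [dist_nonneg (x := F x) (y := F y)]
  rw [← hm.eVariationOn_eq (left_mem_Icc.mpr hab) (right_mem_Icc.mpr hab), inter_self]
  refine iSup_le ?_
  rintro ⟨n, u, hu, hus⟩
  refine le_trans ?_ (eVariationOn.sum_le (n := n) hu hus)
  refine Finset.sum_le_sum fun i _ => ?_
  rw [edist_comm, edist_comm (m _), edist_dist, edist_dist]
  refine ENNReal.ofReal_le_ofReal ?_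
  refine (h _ (hus i) _ (hus (i + 1)) (hu (Nat.le_succ i))).trans ?_
  rw [dist_comm, Real.dist_eq]
  exact le_abs_self _

lemma eVariationOn_leftAvg_le {g : ℝ → R2} (hT : 0 < T) (hp : Function.Periodic g T)
    (hg : LocallyIntegrable g) (hV : perVar T g ≠ ∞) {h : ℝ} (hh : 0 < h) (a : ℝ) :
    eVariationOn (leftAvg g h) (Icc a (a + T)) ≤ perVar T g := by
  set q : ℝ → R2 := fun t => g t - g (t - h) with hq
  have hql : LocallyIntegrable q := hg.sub (LocallyIntegrable.comp_sub' hg h)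
  have hqp : Function.Periodic q T := by
    intro t
    simp only [hq]
    rw [show t + T - h = t - h + T by ring, hp, hp]
  have hqi : ∀ x y, IntervalIntegrable (fun t => ‖q t‖) volume x y := fun x y =>
    (LocallyIntegrable.intervalIntegrable' hql x y).norm
  have hmain := eVariationOn_le_of_dist_le (F := leftAvg g h)
    (m := fun x => h⁻¹ * ∫ t in a..x, ‖q t‖) (a := a) (b := a + T) (by linarith) (by
      intro x _ y _ hxy
      rw [dist_comm, dist_eq_norm, leftAvg_sub hg, norm_smul, norm_inv, Real.norm_of_nonneg hh.le,
        ← mul_sub, intervalIntegral.integral_interval_sub_left (hqi _ _) (hqi _ _)]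
      gcongr
      exact intervalIntegral.norm_integral_le_integral_norm hxy)
  refine hmain.trans ?_
  rw [intervalIntegral.integral_same, mul_zero, sub_zero]
  have hqp' : Function.Periodic (fun t => ‖q t‖) T := fun t => by simp only [hqp t]
  have h1 := hqp'.intervalIntegral_add_eq a 0
  rw [zero_add, intervalIntegral.integral_of_le hT.le] at h1
  have hqi0 : IntegrableOn q (Ioc 0 T) :=
    (hql.integrableOn_isCompact (isCompact_Icc (a := 0) (b := T))).mono_set Ioc_subset_Icc_self
  rw [h1, ENNReal.ofReal_mul (by positivity), ofReal_integral_norm_eq_lintegral_enorm hqi0]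
  refine (mul_le_mul_right (lintegral_translate_le_perVar hT hp hg hV hh) _).trans ?_
  rw [← mul_assoc, ← ENNReal.ofReal_mul (by positivity), inv_mul_cancel₀ hh.ne']
  simp

/-- An average over an interval stays in a closed ball containing almost all values. -/
lemma dist_average_le {g : ℝ → R2} (hg : LocallyIntegrable g) {x y δ : ℝ} (hxy : x < y) {L : R2}
    (h : ∀ᵐ s, s ∈ Ioo x y → dist (g s) L ≤ δ) :
    dist ((y - x)⁻¹ • ∫ s in x..y, g s) L ≤ δ := by
  have hd : 0 < y - x := sub_pos.mpr hxy
  have hi := LocallyIntegrable.intervalIntegrable' hg x y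
  have h1 : (y - x)⁻¹ • (∫ s in x..y, g s) - L = (y - x)⁻¹ • ∫ s in x..y, (g s - L) := by
    rw [intervalIntegral.integral_sub hi (by simp), intervalIntegral.integral_const, smul_sub,
      smul_smul, inv_mul_cancel₀ hd.ne', one_smul]
  have h2 : ‖∫ s in x..y, (g s - L)‖ ≤ δ * |y - x| := by
    refine intervalIntegral.norm_integral_le_of_norm_le_const_ae ?_
    have hne : ∀ᵐ s : ℝ, s ≠ y := by simp [ae_iff]
    filter_upwards [h, hne] with s hs hsy hs2
    rw [uIoc_of_le hxy.le] at hs2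
    rw [← dist_eq_norm]
    exact hs ⟨hs2.1, lt_of_le_of_ne hs2.2 hsy⟩
  rw [dist_eq_norm, h1, norm_smul, norm_inv, Real.norm_of_nonneg hd.le, inv_mul_le_iff₀ hd]
  rw [abs_of_pos hd] at h2
  linarith

/-- The left-continuous representative of a periodic function of bounded variation: its one-sided
averages converge everywhere, and its pointwise variation is at most the distributional one. -/
theorem exists_leftContinuous_representative {f : ℝ → R2} (hT : 0 < T)
    (hp : Function.Periodic f T) (hf : LocallyIntegrable f) (hV : perVar T f ≠ ∞) :
    ∃ g gp : ℝ → R2,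
      (∀ t, Tendsto (fun ε => ε⁻¹ • ∫ s in (t - ε)..t, f s) (𝓝[>] 0) (𝓝 (g t))) ∧
      (∀ t, Tendsto (fun ε => ε⁻¹ • ∫ s in t..(t + ε), f s) (𝓝[>] 0) (𝓝 (gp t))) ∧
      (∀ᵐ t, f t = g t) ∧
      (∀ a, eVariationOn g (Icc a (a + T)) ≤ perVar T f) ∧
      (∀ t, ContinuousWithinAt g (Iic t) t) ∧
      (∀ t, Tendsto g (𝓝[>] t) (𝓝 (gp t))) ∧
      Function.Periodic g T := by
  set E : Set ℝ := {t | HasDerivAt (fun x => ∫ s in (0:ℝ)..x, f s) (f t) t} with hE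
  have hEae : ∀ᵐ t, t ∈ E := by
    filter_upwards [LocallyIntegrable.ae_hasDerivAt_integral hf] with t ht using ht 0
  have hEl : ∀ t ∈ E, Tendsto (fun ε => leftAvg f ε t) (𝓝[>] 0) (𝓝 (f t)) := fun t ht =>
    tendsto_leftAvg_of_hasDerivAt hf ht
  have hpos : ∀ᶠ ε : ℝ in 𝓝[>] 0, 0 < ε := self_mem_nhdsWithin
  have hvarE : ∀ a, eVariationOn f (E ∩ Icc a (a + T)) ≤ perVar T f := by
    intro a
    by_contra! hcon
    have h1 := eVariationOn.lowerSemicontinuous_aux (F := fun ε => leftAvg f ε) (p := 𝓝[>] (0:ℝ))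
      (f := f) (s := E ∩ Icc a (a + T)) (fun x hx => hEl x hx.1) hcon
    obtain ⟨ε, h2, h3⟩ := (h1.and hpos).exists
    exact absurd (eVariationOn_leftAvg_le hT hp hf hV h3 a)
      (not_le.mpr (h2.trans_le (eVariationOn.mono _ inter_subset_right)))
  have hbv : ∀ t, BoundedVariationOn f (E ∩ Icc (t - T / 2) (t + T / 2)) := by
    intro t
    have := hvarE (t - T / 2)
    rw [show t - T / 2 + T = t + T / 2 by ring] at this
    exact (this.trans_lt hV.lt_top).ne
  have hleft : ∀ t, ∃ L, ∀ δ > 0, ∃ η > 0, ∀ s ∈ E, s ∈ Ioo (t - η) t → dist (f s) L ≤ δ := by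
    intro t
    obtain ⟨L, hL⟩ := (hbv t).exists_tendsto_left t
    refine ⟨L, fun δ hδ => ?_⟩
    have h1 := hL (Metric.closedBall_mem_nhds L hδ)
    rw [mem_map, mem_nhdsWithin_iff_exists_mem_nhds_inter] at h1
    obtain ⟨u, hu, hu2⟩ := h1
    obtain ⟨η, hη, hη2⟩ := Metric.mem_nhds_iff.mp hu
    refine ⟨min η (T / 2), by positivity, fun s hs hst => ?_⟩
    have a1 := min_le_left η (T / 2)
    have a2 := min_le_right η (T / 2)
    refine hu2 ⟨hη2 ?_, ⟨hs, ?_⟩, hst.2⟩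
    · rw [Metric.mem_ball, Real.dist_eq, abs_lt]
      constructor <;> linarith [hst.1, hst.2]
    · constructor <;> linarith [hst.1, hst.2]
  have hright : ∀ t, ∃ L, ∀ δ > 0, ∃ η > 0, ∀ s ∈ E, s ∈ Ioo t (t + η) → dist (f s) L ≤ δ := by
    intro t
    obtain ⟨L, hL⟩ := (hbv t).exists_tendsto_right t
    refine ⟨L, fun δ hδ => ?_⟩
    have h1 := hL (Metric.closedBall_mem_nhds L hδ)
    rw [mem_map, mem_nhdsWithin_iff_exists_mem_nhds_inter] at h1
    obtain ⟨u, hu, hu2⟩ := h1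
    obtain ⟨η, hη, hη2⟩ := Metric.mem_nhds_iff.mp hu
    refine ⟨min η (T / 2), by positivity, fun s hs hst => ?_⟩
    have a1 := min_le_left η (T / 2)
    have a2 := min_le_right η (T / 2)
    refine hu2 ⟨hη2 ?_, ⟨hs, ?_⟩, hst.1⟩
    · rw [Metric.mem_ball, Real.dist_eq, abs_lt]
      constructor <;> linarith [hst.1, hst.2]
    · constructor <;> linarith [hst.1, hst.2]
  choose g hg using hleft
  choose gp hgp using hright
  have hlim : ∀ t, Tendsto (fun ε => leftAvg f ε t) (𝓝[>] 0) (𝓝 (g t)) := by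
    intro t
    rw [Metric.nhds_basis_closedBall.tendsto_right_iff]
    intro δ hδ
    obtain ⟨η, hη, h⟩ := hg t δ hδ
    filter_upwards [Ioo_mem_nhdsGT hη] with ε hε
    have := dist_average_le (L := g t) (δ := δ) hf (show t - ε < t by linarith [hε.1]) (by
      filter_upwards [hEae] with s hs hs2
      exact h s hs ⟨by linarith [hs2.1, hε.2], hs2.2⟩)
    rwa [sub_sub_cancel] at this
  have hlimp : ∀ t, Tendsto (fun ε => ε⁻¹ • ∫ s in t..(t + ε), f s) (𝓝[>] 0) (𝓝 (gp t)) := by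
    intro t
    rw [Metric.nhds_basis_closedBall.tendsto_right_iff]
    intro δ hδ
    obtain ⟨η, hη, h⟩ := hgp t δ hδ
    filter_upwards [Ioo_mem_nhdsGT hη] with ε hε
    have := dist_average_le (L := gp t) (δ := δ) hf (show t < t + ε by linarith [hε.1]) (by
      filter_upwards [hEae] with s hs hs2
      exact h s hs ⟨hs2.1, by linarith [hs2.2, hε.2]⟩)
    rwa [add_sub_cancel_left] at this
  -- The bound on `f` to one side of `t` passes to `g`, a limit of averages of `f`.
  have hclose : ∀ {x y δ : ℝ} {L : R2}, (∀ s ∈ E, s ∈ Ioo x y → dist (f s) L ≤ δ) →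
      ∀ s ∈ Ioo x y, dist (g s) L ≤ δ := by
    intro x y δ L h s hs
    refine le_of_tendsto ((hlim s).dist tendsto_const_nhds) ?_
    filter_upwards [Ioo_mem_nhdsGT (show 0 < s - x by linarith [hs.1])] with ε hε
    have := dist_average_le (L := L) (δ := δ) hf (show s - ε < s by linarith [hε.1]) (by
      filter_upwards [hEae] with r hr hr2
      exact h r hr ⟨by linarith [hr2.1, hε.2], by linarith [hr2.2, hs.2]⟩)
    rwa [sub_sub_cancel] at this
  refine ⟨g, gp, hlim, hlimp, ?_, ?_, ?_, ?_, ?_⟩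
  · filter_upwards [hEae] with t ht
    exact tendsto_nhds_unique (hEl t ht) (hlim t)
  · intro a
    by_contra! hcon
    have h1 := eVariationOn.lowerSemicontinuous_aux (F := fun ε => leftAvg f ε) (p := 𝓝[>] (0:ℝ))
      (f := g) (s := Icc a (a + T)) (fun x _ => hlim x) hcon
    obtain ⟨ε, h2, h3⟩ := (h1.and hpos).exists
    exact absurd (eVariationOn_leftAvg_le hT hp hf hV h3 a) (not_le.mpr h2)
  · intro t
    rw [← continuousWithinAt_Iio_iff_Iic, ContinuousWithinAt,
      Metric.nhds_basis_closedBall.tendsto_right_iff]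
    intro δ hδ
    obtain ⟨η, hη, h⟩ := hg t δ hδ
    filter_upwards [Ioo_mem_nhdsLT (show t - η < t by linarith)] with s hs
    exact hclose h s hs
  · intro t
    rw [Metric.nhds_basis_closedBall.tendsto_right_iff]
    intro δ hδ
    obtain ⟨η, hη, h⟩ := hgp t δ hδ
    filter_upwards [Ioo_mem_nhdsGT (show t < t + η by linarith)] with s hs
    exact hclose h s hs
  · intro t
    refine tendsto_nhds_unique (hlim (t + T)) ((hlim t).congr fun ε => ?_)
    exact (leftAvg_periodic hp ε t).symm

/-- The variation function `t ↦ |Dg|([0, t))`, extended to the line with signs. -/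
def varFn (g : ℝ → R2) (t : ℝ) : ℝ := variationOnFromTo g univ 0 t

lemma locallyBoundedVariationOn_of_periodic {g : ℝ → R2} (hT : 0 < T)
    (hv : ∀ a, eVariationOn g (Icc a (a + T)) ≠ ∞) :
    LocallyBoundedVariationOn g univ := by
  intro a b _ _
  rw [univ_inter]
  have key : ∀ n : ℕ, eVariationOn g (Icc a (a + n * T)) ≠ ∞ := by
    intro n
    induction n with
    | zero =>
      rw [eVariationOn.subsingleton]
      · simp
      · simp
    | succ n ih =>
      have h0 : (0:ℝ) ≤ n * T := by positivity
      have := eVariationOn.Icc_add_Icc g (s := univ) (a := a) (b := a + n * T)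
        (c := a + (n + 1 : ℕ) * T) (by linarith) (by push_cast; linarith) (mem_univ _)
      simp only [univ_inter] at this
      rw [← this]
      refine ENNReal.add_ne_top.mpr ⟨ih, ?_⟩
      have h2 := hv (a + n * T)
      rwa [show a + n * T + T = a + (n + 1 : ℕ) * T by push_cast; ring] at h2
  obtain ⟨n, hn⟩ := exists_nat_gt ((b - a) / T)
  rw [div_lt_iff₀ hT] at hn
  exact ((eVariationOn.mono g (Icc_subset_Icc le_rfl (by linarith))).trans_lt
    (key n).lt_top).ne

lemma varFn_sub {g : ℝ → R2} (hg : LocallyBoundedVariationOn g univ) {x y : ℝ} (h : x ≤ y) :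
    varFn g y - varFn g x = (eVariationOn g (Icc x y)).toReal := by
  have := variationOnFromTo.add hg (mem_univ 0) (mem_univ x) (mem_univ y)
  rw [variationOnFromTo.eq_of_le _ _ h, univ_inter] at this
  rw [varFn, varFn]; linarith

lemma dist_le_varFn_sub {g : ℝ → R2} (hg : LocallyBoundedVariationOn g univ) {x y : ℝ}
    (h : x ≤ y) : dist (g x) (g y) ≤ varFn g y - varFn g x := by
  rw [varFn_sub hg h, dist_edist]
  have hfin := hg x y (mem_univ _) (mem_univ _)
  rw [univ_inter] at hfin
  exact ENNReal.toReal_mono hfin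
    (eVariationOn.edist_le g (left_mem_Icc.mpr h) (right_mem_Icc.mpr h))

lemma varFn_monotone {g : ℝ → R2} (hg : LocallyBoundedVariationOn g univ) :
    Monotone (varFn g) := fun x y h => by
  have := varFn_sub hg h
  linarith [ENNReal.toReal_nonneg (a := eVariationOn g (Icc x y))]

lemma eVariationOn_shift_period {g : ℝ → R2} (hp : Function.Periodic g T) (a b : ℝ) :
    eVariationOn g (Icc (a + T) (b + T)) = eVariationOn g (Icc a b) := by
  have h := eVariationOn.comp_eq_of_monotoneOn g (t := Icc a b) (fun t => t + T)
    (fun x _ y _ hxy => by simpa using hxy)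
  rw [image_add_const_Icc] at h
  rw [← h]
  congr 1
  ext1 t
  exact hp t

lemma varFn_add_period {g : ℝ → R2} (hT : 0 < T) (hp : Function.Periodic g T)
    (hg : LocallyBoundedVariationOn g univ) (t : ℝ) :
    varFn g (t + T) = varFn g t + (eVariationOn g (Icc 0 T)).toReal := by
  have h1 : varFn g (t + T) - varFn g T = varFn g t - varFn g 0 := by
    rcases le_total 0 t with h | h
    · rw [varFn_sub hg h, varFn_sub hg (by linarith : T ≤ t + T)]
      have := eVariationOn_shift_period hp 0 t
      rw [zero_add] at this
      rw [this]
    · have e1 := varFn_sub hg h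
      have e2 := varFn_sub hg (by linarith : t + T ≤ T)
      have := eVariationOn_shift_period hp t 0
      rw [zero_add] at this
      rw [this] at e2
      linarith
  have h2 := varFn_sub hg hT.le
  linarith

/-- The variation of a periodic function does not depend on the period. -/
lemma eVariationOn_period_eq {g : ℝ → R2} (hT : 0 < T) (hp : Function.Periodic g T)
    (hg : LocallyBoundedVariationOn g univ) (a : ℝ) :
    eVariationOn g (Icc a (a + T)) = eVariationOn g (Icc 0 T) := by
  have h1 := varFn_add_period hT hp hg a
  have h2 := varFn_sub hg (by linarith : a ≤ a + T)
  have f1 := hg a (a + T) (mem_univ _) (mem_univ _)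
  have f2 := hg 0 T (mem_univ _) (mem_univ _)
  rw [univ_inter] at f1 f2
  rw [← ENNReal.toReal_eq_toReal_iff' f1 f2]
  linarith

lemma lintegral_translate_le_eVariationOn {g : ℝ → R2} (hT : 0 < T) (hp : Function.Periodic g T)
    (hg : LocallyBoundedVariationOn g univ) {h : ℝ} (hh : 0 < h) :
    ∫⁻ t in Ioc 0 T, ‖g t - g (t - h)‖ₑ ≤ ENNReal.ofReal h * eVariationOn g (Icc 0 T) := by
  have hm := varFn_monotone hg
  have hi : ∀ a b, IntervalIntegrable (varFn g) volume a b := fun a b =>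
    hm.intervalIntegrable
  have hi2 : IntervalIntegrable (fun t => varFn g (t - h)) volume 0 T := by
    have := (hi (0 - h) (T - h)).comp_sub_right h
    simpa using this
  have h1 : ∫⁻ t in Ioc 0 T, ‖g t - g (t - h)‖ₑ
      ≤ ∫⁻ t in Ioc 0 T, ENNReal.ofReal (varFn g t - varFn g (t - h)) := by
    refine lintegral_mono fun t => ?_
    rw [← ofReal_norm, ← dist_eq_norm, dist_comm]
    exact ENNReal.ofReal_le_ofReal (dist_le_varFn_sub hg (by linarith))
  refine h1.trans ?_
  have hi3 := (hi 0 T).sub hi2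
  rw [intervalIntegrable_iff_integrableOn_Ioc_of_le hT.le] at hi3
  rw [← ofReal_integral_eq_lintegral_ofReal hi3 (ae_of_all _ fun t => by
    simpa using hm (by linarith : t - h ≤ t))]
  have h2 : ∫ t in Ioc 0 T, (varFn g t - varFn g (t - h))
      = h * (eVariationOn g (Icc 0 T)).toReal := by
    rw [← intervalIntegral.integral_of_le hT.le, intervalIntegral.integral_sub (hi _ _) hi2,
      intervalIntegral.integral_comp_sub_right,
      intervalIntegral.integral_interval_sub_interval_comm' (hi _ _) (hi _ _) (hi _ _)]
    have h3 : ∫ t in (T - h)..T, varFn g t = ∫ t in (0 - h)..0, varFn g (t + T) := by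
      rw [intervalIntegral.integral_comp_add_right, zero_add, sub_add_eq_add_sub, zero_add]
    rw [h3]
    simp_rw [varFn_add_period hT hp hg]
    rw [intervalIntegral.integral_add (hi _ _) (by simp), intervalIntegral.integral_const]
    simp
  have f2 := hg 0 T (mem_univ _) (mem_univ _)
  rw [univ_inter] at f2
  rw [h2, ENNReal.ofReal_mul hh.le, ENNReal.ofReal_toReal f2]

/-- The distributional variation is at most the pointwise variation. -/
lemma perVar_le_eVariationOn {f g : ℝ → R2} (hT : 0 < T) (hp : Function.Periodic f T)
    (hf : LocallyIntegrable f) (hfg : ∀ᵐ t, f t = g t) (hgp : Function.Periodic g T)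
    (hg : LocallyBoundedVariationOn g univ) : perVar T f ≤ eVariationOn g (Icc 0 T) := by
  refine perVar_le_of_lintegral_translate_le hT hp hf fun h hh => ?_
  refine le_trans (le_of_eq ?_) (lintegral_translate_le_eVariationOn hT hgp hg hh)
  refine lintegral_congr_ae (ae_restrict_of_ae ?_)
  have h2 : ∀ᵐ t, f (t - h) = g (t - h) :=
    (measurePreserving_sub_right volume h).quasiMeasurePreserving.ae hfg
  filter_upwards [hfg, h2] with t h1 h2
  rw [h1, h2]

/-- The pointwise variation of a continuous function is at most the distributional one. -/
lemma eVariationOn_le_perVar {f : ℝ → R2} (hT : 0 < T) (hp : Function.Periodic f T)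
    (hf : Continuous f) (hV : perVar T f ≠ ∞) (a : ℝ) :
    eVariationOn f (Icc a (a + T)) ≤ perVar T f := by
  have hpos : ∀ᶠ ε : ℝ in 𝓝[>] 0, 0 < ε := self_mem_nhdsWithin
  by_contra! hcon
  have hl := hf.locallyIntegrable (μ := volume)
  have h1 := eVariationOn.lowerSemicontinuous_aux (F := fun ε => leftAvg f ε) (p := 𝓝[>] (0:ℝ))
    (f := f) (s := Icc a (a + T)) (fun x _ => tendsto_leftAvg_of_hasDerivAt hl
      (intervalIntegral.integral_hasDerivAt_right (hf.intervalIntegrable _ _)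
        (hf.stronglyMeasurableAtFilter _ _) hf.continuousAt)) hcon
  obtain ⟨ε, h2, h3⟩ := (h1.and hpos).exists
  exact absurd (eVariationOn_leftAvg_le hT hp hl hV h3 a) (not_le.mpr h2)

/-- The length of a Lipschitz closed curve is at most its pointwise variation. -/
lemma lintegral_deriv_le_eVariationOn {φ : ℝ → R2} (hT : 0 < T) (hp : Function.Periodic φ T)
    {K : NNReal} (hφ : LipschitzWith K φ) :
    ∫⁻ t in Ioc 0 T, ‖deriv φ t‖ₑ ≤ eVariationOn φ (Icc 0 T) := by
  have hbv : LocallyBoundedVariationOn φ univ := hφ.locallyBoundedVariationOn univ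
  set ε : ℕ → ℝ := fun n => 1 / ((n : ℝ) + 1) with hε
  have hεpos : ∀ n, 0 < ε n := fun n => Nat.one_div_pos_of_nat
  have hε0 : Tendsto (fun n => -ε n) atTop (𝓝[≠] 0) := by
    refine tendsto_nhdsWithin_iff.mpr ⟨?_, Eventually.of_forall fun n => ?_⟩
    · have := (tendsto_one_div_add_atTop_nhds_zero_nat (𝕜 := ℝ)).neg
      rwa [neg_zero] at this
    · simpa using (hεpos n).ne'
  have hc := hφ.continuous
  have h1 : ∫⁻ t in Ioc 0 T, ‖deriv φ t‖ₑ
      ≤ ∫⁻ t in Ioc 0 T, liminf (fun n => ‖(-ε n)⁻¹ • (φ (t + -ε n) - φ t)‖ₑ) atTop := by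
    refine lintegral_mono_ae (ae_restrict_of_ae ?_)
    filter_upwards [hφ.ae_differentiableAt_real] with t ht
    have := (hasDerivAt_iff_tendsto_slope_zero.mp ht.hasDerivAt).comp hε0
    exact (this.enorm.liminf_eq).ge
  refine h1.trans ((lintegral_liminf_le fun n => ?_).trans ?_)
  · exact Continuous.measurable (by fun_prop)
  · refine liminf_le_of_le (by isBoundedDefault) fun b hb => ?_
    obtain ⟨n, hn⟩ := hb.exists
    refine hn.trans ?_
    have h2 : ∀ t, ‖(-ε n)⁻¹ • (φ (t + -ε n) - φ t)‖ₑ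
        = ENNReal.ofReal (ε n)⁻¹ * ‖φ t - φ (t - ε n)‖ₑ := by
      intro t
      rw [enorm_smul, ← sub_eq_add_neg, inv_neg, enorm_neg,
        Real.enorm_of_nonneg (inv_nonneg.mpr (hεpos n).le), ← enorm_neg, neg_sub]
    simp_rw [h2]
    rw [lintegral_const_mul _ (Continuous.measurable (by fun_prop))]
    refine (mul_le_mul_right (lintegral_translate_le_eVariationOn hT hp hbv (hεpos n)) _).trans ?_
    rw [← mul_assoc, ← ENNReal.ofReal_mul (inv_nonneg.mpr (hεpos n).le),
      inv_mul_cancel₀ (hεpos n).ne']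
    simp

end PeriodicBV

/-! ### The traces and the completed curve -/

section CompletedCurve

variable {γ : S1 → R2}

lemma MemBVCircle.locallyIntegrable (hγ : MemBVCircle γ) :
    LocallyIntegrable (fun θ => γ (circ θ)) :=
  locallyIntegrable_of_periodic Real.two_pi_pos (fun θ => by simp only [circ_periodic θ]) hγ.1

lemma comp_circ_periodic (γ : S1 → R2) : Function.Periodic (fun θ => γ (circ θ)) (2 * Real.pi) :=
  fun θ => by simp only [circ_periodic θ]

lemma traces_spec (hγ : MemBVCircle γ) :
    (∀ᵐ t, γ (circ t) = leftTrace γ t) ∧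
    (∀ a, eVariationOn (leftTrace γ) (Icc a (a + 2 * Real.pi)) ≤ circleVariation γ) ∧
    (∀ t, ContinuousWithinAt (leftTrace γ) (Iic t) t) ∧
    (∀ t, Tendsto (leftTrace γ) (𝓝[>] t) (𝓝 (rightTrace γ t))) ∧
    Function.Periodic (leftTrace γ) (2 * Real.pi) := by
  obtain ⟨g, gp, h1, h2, h3, h4, h5, h6, h7⟩ := exists_leftContinuous_representative
    Real.two_pi_pos (comp_circ_periodic γ) hγ.locallyIntegrable hγ.2.ne
  have e1 : leftTrace γ = g := funext fun t => (h1 t).limUnder_eq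
  have e2 : rightTrace γ = gp := funext fun t => (h2 t).limUnder_eq
  rw [e1, e2]
  exact ⟨h3, h4, h5, h6, h7⟩

lemma leftTrace_lbv (hγ : MemBVCircle γ) : LocallyBoundedVariationOn (leftTrace γ) univ :=
  locallyBoundedVariationOn_of_periodic Real.two_pi_pos fun a =>
    (((traces_spec hγ).2.1 a).trans_lt hγ.2).ne

lemma circleVariation_eq_eVariationOn (hγ : MemBVCircle γ) :
    circleVariation γ = eVariationOn (leftTrace γ) (Icc 0 (2 * Real.pi)) := by
  obtain ⟨h1, h2, -, -, h5⟩ := traces_spec hγ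
  refine le_antisymm ?_ ?_
  · exact perVar_le_eVariationOn Real.two_pi_pos (comp_circ_periodic γ) hγ.locallyIntegrable h1 h5
      (leftTrace_lbv hγ)
  · have := h2 0
    rwa [zero_add] at this

lemma massBefore_eq (γ : S1 → R2) {t : ℝ} (ht : 0 ≤ t) :
    massBefore γ t = varFn (leftTrace γ) t := by
  rw [varFn, variationOnFromTo.eq_of_le _ _ ht, univ_inter, massBefore]

lemma massBefore_two_pi (hγ : MemBVCircle γ) :
    massBefore γ (2 * Real.pi) = (circleVariation γ).toReal := by
  rw [circleVariation_eq_eVariationOn hγ, massBefore]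

lemma speedFactor_pos (γ : S1 → R2) : 0 < speedFactor γ := by
  have h1 := Real.two_pi_pos
  have h2 : 0 ≤ massBefore γ (2 * Real.pi) := ENNReal.toReal_nonneg
  rw [speedFactor]; positivity

/-- The parameter change `s⁻`, extended to the whole line. -/
def newParam (γ : S1 → R2) (t : ℝ) : ℝ := speedFactor γ * (t + varFn (leftTrace γ) t)

lemma sMinus_eq (γ : S1 → R2) {t : ℝ} (ht : 0 ≤ t) : sMinus γ t = newParam γ t := by
  rw [sMinus, newParam, massBefore_eq γ ht]

lemma sPlus_eq (γ : S1 → R2) (t : ℝ) :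
    sPlus γ t = sMinus γ t + speedFactor γ * dist (leftTrace γ t) (rightTrace γ t) := by
  rw [sPlus, sMinus, dist_comm, dist_eq_norm]; ring

lemma newParam_zero (γ : S1 → R2) : newParam γ 0 = 0 := by
  simp [newParam, varFn, variationOnFromTo.self]

lemma newParam_strictMono (hγ : MemBVCircle γ) : StrictMono (newParam γ) := by
  intro x y h
  have := varFn_monotone (leftTrace_lbv hγ) h.le
  rw [newParam, newParam]
  exact mul_lt_mul_of_pos_left (by linarith) (speedFactor_pos γ)

lemma newParam_add_period (hγ : MemBVCircle γ) (t : ℝ) :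
    newParam γ (t + 2 * Real.pi) = newParam γ t + 2 * Real.pi := by
  have h := varFn_add_period Real.two_pi_pos (traces_spec hγ).2.2.2.2 (leftTrace_lbv hγ) t
  have h1 := Real.two_pi_pos
  have h2 : 0 ≤ massBefore γ (2 * Real.pi) := ENNReal.toReal_nonneg
  rw [newParam, newParam, h]
  change _ * (_ + (_ + massBefore γ (2 * Real.pi))) = _
  rw [speedFactor]
  field_simp
  ring

lemma newParam_two_pi (hγ : MemBVCircle γ) : newParam γ (2 * Real.pi) = 2 * Real.pi := by
  have := newParam_add_period hγ 0
  rwa [zero_add, newParam_zero, zero_add] at this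

lemma tendsto_varFn_left (hγ : MemBVCircle γ) (t : ℝ) :
    Tendsto (varFn (leftTrace γ)) (𝓝[<] t) (𝓝 (varFn (leftTrace γ) t)) := by
  have h := variationOnFromTo.tendsto_left (mem_univ 0) (mem_univ t) (leftTrace_lbv hγ)
    (l := leftTrace γ t) (by
      rw [univ_inter]
      exact ((traces_spec hγ).2.2.1 t).mono_left (nhdsWithin_mono _ Iio_subset_Iic_self))
  rw [dist_self, sub_zero, univ_inter] at h
  exact h

lemma tendsto_varFn_right (hγ : MemBVCircle γ) (t : ℝ) :
    Tendsto (varFn (leftTrace γ)) (𝓝[>] t)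
      (𝓝 (varFn (leftTrace γ) t + dist (leftTrace γ t) (rightTrace γ t))) := by
  have h := variationOnFromTo.tendsto_right (mem_univ 0) (mem_univ t) (leftTrace_lbv hγ)
    (l := rightTrace γ t) (by rw [univ_inter]; exact (traces_spec hγ).2.2.2.1 t)
  rw [univ_inter] at h
  exact h

lemma tendsto_newParam_left (hγ : MemBVCircle γ) (t : ℝ) :
    Tendsto (newParam γ) (𝓝[<] t) (𝓝 (newParam γ t)) :=
  ((tendsto_nhdsWithin_of_tendsto_nhds tendsto_id).add (tendsto_varFn_left hγ t)).const_mul _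

lemma tendsto_newParam_right (hγ : MemBVCircle γ) (t : ℝ) :
    Tendsto (newParam γ) (𝓝[>] t)
      (𝓝 (newParam γ t + speedFactor γ * dist (leftTrace γ t) (rightTrace γ t))) := by
  have := ((tendsto_nhdsWithin_of_tendsto_nhds (s := Ioi t) (tendsto_id (α := ℝ))).add
    (tendsto_varFn_right hγ t)).const_mul (speedFactor γ)
  have e : newParam γ t + speedFactor γ * dist (leftTrace γ t) (rightTrace γ t)
      = speedFactor γ * (t + (varFn (leftTrace γ) t + dist (leftTrace γ t) (rightTrace γ t))) := by
    rw [newParam]; ring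
  rw [e]
  exact this

lemma oldParam_set_eq (γ : S1 → R2) (s : ℝ) :
    {t | t ∈ Icc 0 (2 * Real.pi) ∧ sMinus γ t ≤ s}
      = {t | t ∈ Icc 0 (2 * Real.pi) ∧ newParam γ t ≤ s} := by
  ext t
  simp only [mem_ofPred_eq]
  refine and_congr_right fun h => ?_
  rw [sMinus_eq γ h.1]

lemma oldParam_mem {s : ℝ} (hs : s ∈ Icc 0 (2 * Real.pi)) :
    oldParam γ s ∈ Icc 0 (2 * Real.pi) := by
  have hbdd : BddAbove {t | t ∈ Icc 0 (2 * Real.pi) ∧ newParam γ t ≤ s} :=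
    ⟨2 * Real.pi, fun t ht => ht.1.2⟩
  have h0 : (0:ℝ) ∈ {t | t ∈ Icc 0 (2 * Real.pi) ∧ newParam γ t ≤ s} :=
    ⟨⟨le_rfl, Real.two_pi_pos.le⟩, by rw [newParam_zero]; exact hs.1⟩
  rw [oldParam, oldParam_set_eq]
  exact ⟨le_csSup hbdd h0, csSup_le ⟨0, h0⟩ fun t ht => ht.1.2⟩

lemma oldParam_mono {s s' : ℝ} (hs' : 0 ≤ s') (h : s' ≤ s) : oldParam γ s' ≤ oldParam γ s := by
  rw [oldParam, oldParam, oldParam_set_eq, oldParam_set_eq]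
  refine csSup_le_csSup ⟨2 * Real.pi, fun t ht => ht.1.2⟩ ⟨0, ⟨le_rfl, Real.two_pi_pos.le⟩, ?_⟩ ?_
  · rw [newParam_zero]; exact hs'
  · exact fun t ht => ⟨ht.1, ht.2.trans h⟩

lemma newParam_oldParam_le (hγ : MemBVCircle γ) {s : ℝ} (hs : s ∈ Icc 0 (2 * Real.pi)) :
    newParam γ (oldParam γ s) ≤ s := by
  set t := oldParam γ s with ht
  refine le_of_tendsto (tendsto_newParam_left hγ t) ?_
  filter_upwards [self_mem_nhdsWithin] with r hr
  rw [ht, oldParam, oldParam_set_eq] at hr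
  have hne : {t | t ∈ Icc 0 (2 * Real.pi) ∧ newParam γ t ≤ s}.Nonempty :=
    ⟨0, ⟨le_rfl, Real.two_pi_pos.le⟩, by rw [newParam_zero]; exact hs.1⟩
  obtain ⟨r', hr', hrr'⟩ := exists_lt_of_lt_csSup hne hr
  exact ((newParam_strictMono hγ hrr').le).trans hr'.2

lemma le_newParam_oldParam_add (hγ : MemBVCircle γ) {s : ℝ} (hs : s ∈ Icc 0 (2 * Real.pi)) :
    s ≤ newParam γ (oldParam γ s)
      + speedFactor γ * dist (leftTrace γ (oldParam γ s)) (rightTrace γ (oldParam γ s)) := by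
  set t := oldParam γ s with ht
  have htm : t ∈ Icc 0 (2 * Real.pi) := oldParam_mem hs
  rcases eq_or_lt_of_le htm.2 with h | h
  · rw [h, newParam_two_pi hγ]
    have := mul_nonneg (speedFactor_pos γ).le (dist_nonneg (x := leftTrace γ (2 * Real.pi))
      (y := rightTrace γ (2 * Real.pi)))
    linarith [hs.2]
  · refine ge_of_tendsto (tendsto_newParam_right hγ t) ?_
    filter_upwards [Ioo_mem_nhdsGT h] with r hr
    by_contra! hcon
    have : r ≤ t := by
      rw [ht, oldParam, oldParam_set_eq]
      exact le_csSup ⟨2 * Real.pi, fun t ht => ht.1.2⟩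
        ⟨⟨htm.1.trans hr.1.le, hr.2.le⟩, hcon.le⟩
    exact absurd hr.1 (not_lt.mpr this)

lemma oldParam_newParam (hγ : MemBVCircle γ) {t : ℝ} (ht : t ∈ Icc 0 (2 * Real.pi)) :
    oldParam γ (newParam γ t) = t := by
  rw [oldParam, oldParam_set_eq]
  refine IsGreatest.csSup_eq ⟨⟨ht, le_rfl⟩, fun r hr => ?_⟩
  exact (newParam_strictMono hγ).le_iff_le.mp hr.2

lemma completedParam_eq {s : ℝ} (hs : s ∈ Icc 0 (2 * Real.pi)) :
    completedParam γ s = AffineMap.lineMap (leftTrace γ (oldParam γ s))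
      (rightTrace γ (oldParam γ s)) ((s - newParam γ (oldParam γ s)) /
        (speedFactor γ * dist (leftTrace γ (oldParam γ s)) (rightTrace γ (oldParam γ s)))) := by
  simp only [completedParam]
  rw [sPlus_eq, sMinus_eq γ (oldParam_mem hs).1, add_sub_cancel_left]

lemma dist_completedParam_left (hγ : MemBVCircle γ) {s : ℝ} (hs : s ∈ Icc 0 (2 * Real.pi)) :
    dist (leftTrace γ (oldParam γ s)) (completedParam γ s)
      = (s - newParam γ (oldParam γ s)) / speedFactor γ := by
  have h1 := newParam_oldParam_le hγ hs
  have h2 := le_newParam_oldParam_add hγ hs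
  have hc := speedFactor_pos γ
  rw [completedParam_eq hs, dist_left_lineMap]
  set d := dist (leftTrace γ (oldParam γ s)) (rightTrace γ (oldParam γ s)) with hd
  rcases eq_or_lt_of_le (show 0 ≤ d from dist_nonneg) with h | h
  · rw [← h] at h2 ⊢
    have : s - newParam γ (oldParam γ s) = 0 := by linarith
    simp [this]
  · rw [Real.norm_of_nonneg (div_nonneg (by linarith) (by positivity))]
    field_simp

lemma dist_completedParam_right (hγ : MemBVCircle γ) {s : ℝ} (hs : s ∈ Icc 0 (2 * Real.pi)) :
    dist (completedParam γ s) (rightTrace γ (oldParam γ s))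
      = dist (leftTrace γ (oldParam γ s)) (rightTrace γ (oldParam γ s))
        - (s - newParam γ (oldParam γ s)) / speedFactor γ := by
  have h1 := newParam_oldParam_le hγ hs
  have h2 := le_newParam_oldParam_add hγ hs
  have hc := speedFactor_pos γ
  rw [completedParam_eq hs, dist_lineMap_right]
  set d := dist (leftTrace γ (oldParam γ s)) (rightTrace γ (oldParam γ s)) with hd
  rcases eq_or_lt_of_le (show 0 ≤ d from dist_nonneg) with h | h
  · rw [← h] at h2 ⊢
    have : s - newParam γ (oldParam γ s) = 0 := by linarith
    simp [this]
  · rw [Real.norm_of_nonneg]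
    · field_simp
    · rw [sub_nonneg, div_le_one (by positivity)]; linarith

lemma dist_rightTrace_leftTrace_le (hγ : MemBVCircle γ) {t t' : ℝ} (h : t' < t) :
    dist (rightTrace γ t') (leftTrace γ t) ≤ varFn (leftTrace γ) t - varFn (leftTrace γ) t'
      - dist (leftTrace γ t') (rightTrace γ t') := by
  have h1 := ((traces_spec hγ).2.2.2.1 t').dist (tendsto_const_nhds (x := leftTrace γ t))
  have h2 := (tendsto_varFn_right hγ t').const_sub (varFn (leftTrace γ) t)
  rw [← sub_sub] at h2
  refine le_of_tendsto_of_tendsto h1 h2 ?_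
  filter_upwards [Ioo_mem_nhdsGT h] with r hr
  exact dist_le_varFn_sub (leftTrace_lbv hγ) hr.2.le

/-- The completed curve spends time at most on its variation and on the elapsed old parameter;
this gives both its Lipschitz constant and its total variation. -/
lemma dist_completedParam_le (hγ : MemBVCircle γ) {s s' : ℝ} (hs' : s' ∈ Icc 0 (2 * Real.pi))
    (hs : s ∈ Icc 0 (2 * Real.pi)) (h : s' ≤ s) :
    dist (completedParam γ s') (completedParam γ s)
      ≤ (s / speedFactor γ - oldParam γ s) - (s' / speedFactor γ - oldParam γ s') := by
  have hc := speedFactor_pos γ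
  rcases eq_or_lt_of_le (oldParam_mono (γ := γ) hs'.1 h) with he | hlt
  · rw [he, sub_sub_sub_cancel_right, ← sub_div, completedParam_eq hs', completedParam_eq hs,
      he, dist_lineMap_lineMap, Real.dist_eq, ← sub_div]
    set d := dist (leftTrace γ (oldParam γ s)) (rightTrace γ (oldParam γ s)) with hd
    rcases eq_or_lt_of_le (show 0 ≤ d from dist_nonneg) with h0 | h0
    · rw [← h0, mul_zero]
      exact div_nonneg (by linarith) hc.le
    · rw [abs_div, abs_of_nonpos (by linarith), abs_of_pos (by positivity)]
      refine le_of_eq ?_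
      field_simp
      ring
  · have h1 := dist_completedParam_right hγ hs'
    have h2 := dist_completedParam_left hγ hs
    have h3 := dist_rightTrace_leftTrace_le hγ hlt
    have h4 := dist_triangle4 (completedParam γ s') (rightTrace γ (oldParam γ s'))
      (leftTrace γ (oldParam γ s)) (completedParam γ s)
    rw [h1, h2] at h4
    refine h4.trans ?_
    have e1 : newParam γ (oldParam γ s) / speedFactor γ
        = oldParam γ s + varFn (leftTrace γ) (oldParam γ s) := by
      rw [newParam]; field_simp
    have e2 : newParam γ (oldParam γ s') / speedFactor γ
        = oldParam γ s' + varFn (leftTrace γ) (oldParam γ s') := by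
      rw [newParam]; field_simp
    rw [sub_div, sub_div, e1, e2]
    linarith

lemma completedParam_newParam (hγ : MemBVCircle γ) {t : ℝ} (ht : t ∈ Icc 0 (2 * Real.pi)) :
    completedParam γ (newParam γ t) = leftTrace γ t := by
  have hs : newParam γ t ∈ Icc 0 (2 * Real.pi) := by
    constructor
    · rw [← newParam_zero γ]; exact (newParam_strictMono hγ).monotone ht.1
    · rw [← newParam_two_pi hγ]; exact (newParam_strictMono hγ).monotone ht.2
  have := dist_completedParam_left hγ hs
  rw [oldParam_newParam hγ ht, sub_self, zero_div, dist_eq_zero] at this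
  exact this.symm

lemma completedParam_two_pi (hγ : MemBVCircle γ) :
    completedParam γ (2 * Real.pi) = completedParam γ 0 := by
  have hp := Real.two_pi_pos.le
  have h1 := completedParam_newParam hγ (t := 2 * Real.pi) ⟨hp, le_rfl⟩
  have h2 := completedParam_newParam hγ (t := 0) ⟨le_rfl, hp⟩
  rw [newParam_two_pi hγ] at h1
  rw [newParam_zero] at h2
  rw [h1, h2]
  have := (traces_spec hγ).2.2.2.2 0
  rwa [zero_add] at this

lemma completedCurve_circ (hγ : MemBVCircle γ) {s : ℝ} (hs : s ∈ Icc 0 (2 * Real.pi)) :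
    completedCurve γ (circ s) = completedParam γ s := by
  rcases eq_or_lt_of_le hs.2 with h | h
  · have hp := Real.two_pi_pos
    have := circ_periodic 0
    rw [zero_add] at this
    rw [h, completedParam_two_pi hγ, this, completedCurve, angle_circ ⟨le_rfl, hp⟩]
  · rw [completedCurve, angle_circ ⟨hs.1, h⟩]

lemma dist_circ (a b : ℝ) : dist (circ a) (circ b) = 2 * |Real.sin ((a - b) / 2)| := by
  rw [Subtype.dist_eq, dist_eq_norm, ← sq_eq_sq₀ (norm_nonneg _) (by positivity), norm_sq_R2,
    mul_pow, sq_abs]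
  simp only [PiLp.sub_apply, circ_zero, circ_one]
  have h : Real.cos (a - b) = 1 - 2 * Real.sin ((a - b) / 2) ^ 2 := by
    have := Real.cos_two_mul' ((a - b) / 2)
    rw [mul_div_cancel₀ _ (two_ne_zero)] at this
    nlinarith [Real.sin_sq_add_cos_sq ((a - b) / 2)]
  rw [Real.cos_sub] at h
  nlinarith [Real.sin_sq_add_cos_sq a, Real.sin_sq_add_cos_sq b]

/-- Lipschitz continuity in the angle, up to and including the angle `2π`, gives Lipschitz
continuity on the circle, since an arc of at most half a turn is at most `π / 2` times its chord. -/
lemma lipschitz_of_angle {X : Type*} [PseudoMetricSpace X] {φ : S1 → X} {L : NNReal}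
    (h : ∀ a ∈ Icc 0 (2 * Real.pi), ∀ b ∈ Icc 0 (2 * Real.pi), a ≤ b →
      dist (φ (circ a)) (φ (circ b)) ≤ L * (b - a)) :
    LipschitzWith (L * (Real.pi / 2).toNNReal) φ := by
  have hpi := Real.pi_pos
  have hL : (0:ℝ) ≤ L := L.2
  have key : ∀ a ∈ Ico 0 (2 * Real.pi), ∀ b ∈ Ico 0 (2 * Real.pi), a ≤ b →
      dist (φ (circ a)) (φ (circ b)) ≤ L * (Real.pi / 2) * dist (circ a) (circ b) := by
    intro a ha b hb hab
    rw [dist_comm (circ a), dist_circ]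
    have ha' := Ico_subset_Icc_self ha
    have hb' := Ico_subset_Icc_self hb
    rcases le_total (b - a) Real.pi with hle | hle
    · have h1 := Real.mul_le_sin (x := (b - a) / 2) (by linarith) (by linarith)
      refine (h a ha' b hb' hab).trans ?_
      have h2 : b - a ≤ Real.pi / 2 * (2 * |Real.sin ((b - a) / 2)|) := by
        have h3 := le_abs_self (Real.sin ((b - a) / 2))
        have h4 : b - a = Real.pi * (2 / Real.pi * ((b - a) / 2)) := by field_simp
        nlinarith
      rw [mul_assoc]
      gcongr
    · have h1 := Real.mul_le_sin (x := Real.pi - (b - a) / 2) (by linarith [hb.2, ha.1])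
        (by linarith)
      rw [Real.sin_pi_sub] at h1
      have e0 : circ 0 = circ (2 * Real.pi) := by
        have := circ_periodic 0
        rw [zero_add] at this; exact this.symm
      have h5 := h 0 ⟨le_rfl, by linarith⟩ a ha' ha.1
      have h6 := h b hb' (2 * Real.pi) ⟨by linarith, le_rfl⟩ hb.2.le
      have h7 : dist (φ (circ a)) (φ (circ b)) ≤ L * (2 * Real.pi - (b - a)) := by
        have := dist_triangle (φ (circ a)) (φ (circ 0)) (φ (circ b))
        rw [dist_comm (φ (circ a)) (φ (circ 0)), dist_comm (φ (circ 0)) (φ (circ b))] at this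
        rw [← e0] at h6
        linarith
      refine h7.trans ?_
      have h2 : 2 * Real.pi - (b - a) ≤ Real.pi / 2 * (2 * |Real.sin ((b - a) / 2)|) := by
        have h3 := le_abs_self (Real.sin ((b - a) / 2))
        have h4 : Real.pi - (b - a) / 2
          = Real.pi / 2 * (2 / Real.pi * (Real.pi - (b - a) / 2)) := by field_simp
        nlinarith
      rw [mul_assoc]
      gcongr
  refine LipschitzWith.of_dist_le_mul fun y z => ?_
  rw [NNReal.coe_mul, Real.coe_toNNReal _ (by positivity)]
  rcases le_total (angle y) (angle z) with hyz | hyz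
  · have := key _ (angle_mem y) _ (angle_mem z) hyz
    rwa [circ_angle, circ_angle] at this
  · have := key _ (angle_mem z) _ (angle_mem y) hyz
    rw [circ_angle, circ_angle] at this
    rwa [dist_comm, dist_comm y]

lemma exists_lipschitz_completedCurve (hγ : MemBVCircle γ) :
    ∃ K, LipschitzWith K (completedCurve γ) := by
  have hc := speedFactor_pos γ
  refine ⟨_, lipschitz_of_angle (L := (1 / speedFactor γ).toNNReal) fun a ha b hb hab => ?_⟩
  rw [completedCurve_circ hγ ha, completedCurve_circ hγ hb, Real.coe_toNNReal _ (by positivity)]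
  have h1 := dist_completedParam_le hγ ha hb hab
  have h2 := oldParam_mono (γ := γ) ha.1 hab
  refine h1.trans ?_
  have : 1 / speedFactor γ * (b - a) = b / speedFactor γ - a / speedFactor γ := by ring
  linarith

lemma completedCurve_newParam (hγ : MemBVCircle γ) (t : ℝ) :
    completedCurve γ (circ (newParam γ t)) = leftTrace γ t := by
  have hp : Function.Periodic
      (fun t => completedCurve γ (circ (newParam γ t)) - leftTrace γ t) (2 * Real.pi) := by
    intro t
    simp only
    rw [newParam_add_period hγ, circ_periodic, (traces_spec hγ).2.2.2.2 t]
  obtain ⟨y, hy, hy2⟩ := hp.exists_mem_Ico₀ Real.two_pi_pos t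
  have hy' := Ico_subset_Icc_self hy
  have h1 : newParam γ y ∈ Icc 0 (2 * Real.pi) := by
    constructor
    · rw [← newParam_zero γ]; exact (newParam_strictMono hγ).monotone hy'.1
    · rw [← newParam_two_pi hγ]; exact (newParam_strictMono hγ).monotone hy'.2
  rw [completedCurve_circ hγ h1, completedParam_newParam hγ hy', sub_self, sub_eq_zero] at hy2
  exact hy2

lemma eVariationOn_completedCurve_le (hγ : MemBVCircle γ) :
    eVariationOn (fun s => completedCurve γ (circ s)) (Icc 0 (2 * Real.pi))
      ≤ circleVariation γ := by
  have hp := Real.two_pi_pos.le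
  have h := eVariationOn_le_of_dist_le (F := fun s => completedCurve γ (circ s))
    (m := fun s => s / speedFactor γ - oldParam γ s) hp (fun x hx y hy hxy => by
      rw [completedCurve_circ hγ hx, completedCurve_circ hγ hy]
      exact dist_completedParam_le hγ hx hy hxy)
  refine h.trans ?_
  have e1 := oldParam_newParam hγ (t := 2 * Real.pi) ⟨hp, le_rfl⟩
  have e2 := oldParam_newParam hγ (t := 0) ⟨le_rfl, hp⟩
  rw [newParam_two_pi hγ] at e1
  rw [newParam_zero] at e2
  rw [e1, e2, zero_div, sub_zero, sub_zero]
  have h2 : 0 ≤ massBefore γ (2 * Real.pi) := ENNReal.toReal_nonneg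
  have : 2 * Real.pi / speedFactor γ - 2 * Real.pi = massBefore γ (2 * Real.pi) := by
    rw [speedFactor]
    have := Real.pi_pos
    field_simp
    ring
  rw [this, massBefore_two_pi hγ, ENNReal.ofReal_toReal hγ.2.ne]

end CompletedCurve

/-! ### Jacobian determinants in the plane -/

/-- The first vector of the standard basis. -/
abbrev e0 : R2 := EuclideanSpace.single 0 1

/-- The second vector of the standard basis. -/
abbrev e1 : R2 := EuclideanSpace.single 1 1

lemma eq_smul_add (u : R2) : u = u 0 • e0 + u 1 • e1 :=
  ext2 (by simp) (by simp)

lemma clm_apply (A : R2 →L[ℝ] R2) (u : R2) : A u = u 0 • A e0 + u 1 • A e1 := by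
  conv_lhs => rw [eq_smul_add u]
  rw [map_add, map_smul, map_smul]

lemma det_eq (A : R2 →L[ℝ] R2) : A.det = A e0 0 * A e1 1 - A e1 0 * A e0 1 := by
  have : A.det = LinearMap.det (A : R2 →ₗ[ℝ] R2) := rfl
  rw [this, ← LinearMap.det_toMatrix (EuclideanSpace.basisFun (Fin 2) ℝ).toBasis,
    Matrix.det_fin_two]
  simp [LinearMap.toMatrix_apply]

lemma continuous_det : Continuous (fun A : R2 →L[ℝ] R2 => A.det) := by
  simp_rw [det_eq]
  fun_prop

lemma det_smul_sq (c : ℝ) (A : R2 →L[ℝ] R2) : (c • A).det = c ^ 2 * A.det := by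
  rw [det_eq, det_eq]
  simp only [smul_apply, PiLp.smul_apply, smul_eq_mul]
  ring

/-- The unit vector tangent to the circle at angle `θ`. -/
def tang (θ : ℝ) : R2 := !₂[-Real.sin θ, Real.cos θ]

@[simp] lemma tang_zero (θ : ℝ) : tang θ 0 = -Real.sin θ := rfl

@[simp] lemma tang_one (θ : ℝ) : tang θ 1 = Real.cos θ := rfl

lemma abs_det_le (A : R2 →L[ℝ] R2) (θ : ℝ) : |A.det| ≤ ‖A (circ θ)‖ * ‖A (tang θ)‖ := by
  have hcs := Real.sin_sq_add_cos_sq θ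
  set p := A (circ θ) with hp
  set q := A (tang θ) with hq
  have h1 : A.det = p 0 * q 1 - q 0 * p 1 := by
    rw [hp, hq, clm_apply A (circ θ), clm_apply A (tang θ), det_eq]
    simp only [circ_zero, circ_one, tang_zero, tang_one, PiLp.add_apply, PiLp.smul_apply,
      smul_eq_mul]
    linear_combination (-(A e0 0 * A e1 1 - A e1 0 * A e0 1)) * hcs
  rw [h1]
  refine abs_le_of_sq_le_sq ?_ (by positivity)
  rw [mul_pow, norm_sq_R2, norm_sq_R2]
  nlinarith [sq_nonneg (p 0 * q 0 + p 1 * q 1)]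

/-- If `p` is not isolated in its level set, then the Jacobian determinant vanishes at `p`. -/
lemma det_eq_zero_of_frequently_eq {F : R2 → R2} {p : R2}
    (h : ∃ᶠ z in 𝓝[≠] p, F z = F p) : (fderiv ℝ F p).det = 0 := by
  by_cases hd : DifferentiableAt ℝ F p
  · by_contra hne
    set e := ContinuousLinearMap.toContinuousLinearEquivOfDetNeZero _ hne with he
    have h1 : ∃ C, AntilipschitzWith C (fderiv ℝ F p) := ⟨_, e.antilipschitz⟩
    have h2 := hd.hasFDerivAt.eventually_ne h1 (c := F p)
    obtain ⟨z, hz, hz2⟩ := (h.and_eventually h2).exists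
    exact hz2 hz
  · rw [fderiv_zero_of_not_differentiableAt hd, det_eq]
    simp

/-- A map of the form `Ψ (h r θ)` in polar coordinates, with `h` real-valued and increasing in
the angle, has vanishing Jacobian determinant: its level sets contain those of `h`, which are
graphs over the radius. -/
lemma det_eq_zero_of_polar {F : R2 → R2} {Ψ : ℝ → R2} {h : ℝ → ℝ → ℝ} {U : Set ℝ} (hU : IsOpen U)
    (hF : ∀ r ∈ U, ∀ θ, F (polar r θ) = Ψ (h r θ)) (hr : ∀ θ, Continuous fun r => h r θ)
    (hθ : ∀ r, Continuous (h r)) (hm : ∀ r ∈ U, StrictMono (h r)) {x : R2} (hx : ‖x‖ ∈ U)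
    (hx0 : x ≠ 0) : (fderiv ℝ F x).det = 0 := by
  apply det_eq_zero_of_frequently_eq
  have hr0 : 0 < ‖x‖ := norm_pos_iff.mpr hx0
  set r₀ := ‖x‖ with hr0'
  set θ₀ := argR x with hθ0
  have hxp : polar r₀ θ₀ = x := polar_norm_argR x
  rw [Filter.frequently_iff]
  intro V hV
  rw [mem_nhdsWithin_iff_exists_mem_nhds_inter] at hV
  obtain ⟨W, hW, hWV⟩ := hV
  have hW' : (fun p : ℝ × ℝ => polar p.1 p.2) ⁻¹' W ∈ 𝓝 (r₀, θ₀) :=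
    continuous_polar.continuousAt.preimage_mem_nhds (by simpa only [hxp] using hW)
  obtain ⟨δ, hδ, hball⟩ := Metric.mem_nhds_iff.mp hW'
  have hlt1 : h r₀ (θ₀ - δ / 2) < h r₀ θ₀ := hm r₀ hx (by linarith)
  have hlt2 : h r₀ θ₀ < h r₀ (θ₀ + δ / 2) := hm r₀ hx (by linarith)
  have hev : ∀ᶠ r in 𝓝 r₀, (h r (θ₀ - δ / 2) < h r₀ θ₀ ∧ h r₀ θ₀ < h r (θ₀ + δ / 2)) ∧
      (r ∈ U ∧ r ∈ Metric.ball r₀ δ ∧ 0 < r) :=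
    ((((hr _).continuousAt.eventually_lt_const hlt1)).and
      ((hr _).continuousAt.eventually_const_lt hlt2)).and
      ((hU.eventually_mem hx).and ((Metric.isOpen_ball.eventually_mem
        (Metric.mem_ball_self hδ)).and (lt_mem_nhds hr0)))
  obtain ⟨r, ⟨⟨h1, h2⟩, hrU, hrδ, hrpos⟩, hne⟩ :=
    ((hev.filter_mono nhdsWithin_le_nhds).and (self_mem_nhdsWithin (s := {r₀}ᶜ))).exists
  obtain ⟨θ, hθm, hθe⟩ := intermediate_value_Icc (by linarith : θ₀ - δ / 2 ≤ θ₀ + δ / 2)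
    (hθ r).continuousOn ⟨h1.le, h2.le⟩
  refine ⟨polar r θ, hWV ⟨?_, ?_⟩, ?_⟩
  · refine hball (show (r, θ) ∈ _ from ?_)
    rw [← ball_prod_same]
    refine ⟨hrδ, ?_⟩
    rw [Metric.mem_ball, Real.dist_eq, abs_lt]
    constructor <;> linarith [hθm.1, hθm.2]
  · intro hcon
    have := congrArg norm hcon
    rw [norm_polar, abs_of_pos hrpos] at this
    exact hne this
  · rw [hF r hrU, hθe, ← hF r₀ hx, hxp]

open scoped Pointwise in
lemma lintegral_ball_smul {c : ℝ} (hc : 0 < c) (ρ : ℝ) (g : R2 → ℝ≥0∞) :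
    ∫⁻ x in Metric.ball 0 (c * ρ), g x
      = ENNReal.ofReal (c ^ 2) * ∫⁻ x in Metric.ball 0 ρ, g (c • x) := by
  have himg : (fun x : R2 => c • x) '' Metric.ball 0 ρ = Metric.ball 0 (c * ρ) := by
    change c • Metric.ball (0 : R2) ρ = _
    rw [_root_.smul_ball hc.ne', smul_zero, Real.norm_of_nonneg hc.le]
  have h := lintegral_image_eq_lintegral_abs_det_fderiv_mul volume
    (s := Metric.ball (0 : R2) ρ) (f := fun x : R2 => c • x)
    (f' := fun _ => c • ContinuousLinearMap.id ℝ R2) Metric.isOpen_ball.measurableSet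
    (fun x _ => ((hasFDerivAt_id x).const_smul c).hasFDerivWithinAt)
    (fun x _ y _ hxy => smul_right_injective _ hc.ne' hxy) g
  rw [himg] at h
  rw [h]
  have hdet : (c • ContinuousLinearMap.id ℝ R2).det = c ^ 2 := by
    rw [det_smul_sq, det_eq]; simp
  rw [hdet, abs_of_pos (by positivity), lintegral_const_mul' _ _ ENNReal.ofReal_ne_top]

/-- The total variation of the Jacobian is invariant under rescaling of the domain. -/
lemma tvJ_comp_smul {c : ℝ} (hc : 0 < c) (ρ : ℝ) (w : R2 → R2) :
    tvJ (fun x => w (c • x)) (Metric.ball 0 ρ) = tvJ w (Metric.ball 0 (c * ρ)) := by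
  rw [tvJ, tvJ, lintegral_ball_smul hc, ← lintegral_const_mul' _ _ ENNReal.ofReal_ne_top]
  refine lintegral_congr fun x => ?_
  rw [fderiv_comp_smul, det_smul_sq, abs_mul, ENNReal.ofReal_mul (abs_nonneg _),
    abs_of_pos (by positivity : 0 < c ^ 2)]

lemma tvJ_congr {v w : R2 → R2} {Ω : Set R2} (hΩ : IsOpen Ω) (h : EqOn v w Ω) :
    tvJ v Ω = tvJ w Ω := by
  refine setLIntegral_congr_fun hΩ.measurableSet fun x hx => ?_
  have : v =ᶠ[𝓝 x] w := h.eventuallyEq_of_mem (hΩ.mem_nhds hx)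
  simp only [this.fderiv_eq]

lemma tvJ_mono (v : R2 → R2) {Ω Ω' : Set R2} (h : Ω ⊆ Ω') : tvJ v Ω ≤ tvJ v Ω' :=
  lintegral_mono_set h

/-- Splitting off an annulus; the circle in between is negligible. -/
lemma tvJ_ball_le (w : R2 → R2) (r R : ℝ) :
    tvJ w (Metric.ball 0 R) ≤ tvJ w (Metric.ball 0 r)
      + tvJ w ({x | r < ‖x‖ ∧ ‖x‖ < R}) := by
  have hsub : Metric.ball (0 : R2) R ⊆
      (Metric.ball 0 r ∪ {x | r < ‖x‖ ∧ ‖x‖ < R}) ∪ Metric.sphere 0 r := by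
    intro x hx
    rw [mem_ball_zero_iff] at hx
    rcases lt_trichotomy ‖x‖ r with h | h | h
    · exact Or.inl (Or.inl (mem_ball_zero_iff.mpr h))
    · exact Or.inr (mem_sphere_zero_iff_norm.mpr h)
    · exact Or.inl (Or.inr ⟨h, hx⟩)
  rw [tvJ, tvJ, tvJ]
  refine (lintegral_mono_set hsub).trans ((lintegral_union_le _ _ _).trans ?_)
  have h0 : ∫⁻ x in Metric.sphere (0 : R2) r, ENNReal.ofReal |(fderiv ℝ w x).det| = 0 :=
    setLIntegral_measure_zero _ _ (Measure.addHaar_sphere volume 0 r)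
  rw [h0, add_zero]
  exact lintegral_union_le _ _ _

/-! ### Comparison of Plateau values -/

/-- The radial retraction of the plane onto the closed unit disk. -/
def clamp (x : R2) : R2 := (max 1 ‖x‖)⁻¹ • x

lemma one_le_max_norm (x : R2) : 1 ≤ max 1 ‖x‖ := le_max_left _ _

lemma norm_clamp_le (x : R2) : ‖clamp x‖ ≤ 1 := by
  have h := one_le_max_norm x
  rw [clamp, norm_smul, norm_inv, Real.norm_of_nonneg (by linarith),
    inv_mul_le_iff₀ (by linarith), mul_one]
  exact le_max_right _ _

lemma clamp_mem (x : R2) : clamp x ∈ Metric.closedBall (0 : R2) 1 := by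
  rw [mem_closedBall_zero_iff]; exact norm_clamp_le x

lemma clamp_of_norm_le {x : R2} (h : ‖x‖ ≤ 1) : clamp x = x := by
  rw [clamp, max_eq_left h]; simp

lemma clamp_of_le_norm {x : R2} (h : 1 ≤ ‖x‖) : clamp x = dirc x := by
  rw [clamp, max_eq_right h, dirc_eq]
  rw [← norm_pos_iff]; linarith

lemma lipschitz_clamp : LipschitzWith 2 clamp := by
  refine LipschitzWith.of_dist_le_mul fun x y => ?_
  set a := max 1 ‖x‖ with ha
  set b := max 1 ‖y‖ with hb
  have ha1 : 1 ≤ a := one_le_max_norm x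
  have hb1 : 1 ≤ b := one_le_max_norm y
  have hyb : ‖y‖ ≤ b := le_max_right _ _
  have hab : |b - a| ≤ ‖x - y‖ := by
    have := abs_max_sub_max_le_max 1 ‖y‖ 1 ‖x‖
    rw [sub_self, abs_zero, max_eq_right (abs_nonneg (‖y‖ - ‖x‖))] at this
    refine this.trans ?_
    rw [norm_sub_rev]
    exact abs_norm_sub_norm_le y x
  have e : clamp x - clamp y = a⁻¹ • (x - y) + (a⁻¹ - b⁻¹) • y := by
    rw [clamp, clamp, ← ha, ← hb]
    module
  rw [dist_eq_norm, dist_eq_norm, e]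
  refine (norm_add_le _ _).trans ?_
  rw [norm_smul, norm_smul, norm_inv, Real.norm_of_nonneg (by linarith : 0 ≤ a)]
  have h1 : a⁻¹ * ‖x - y‖ ≤ ‖x - y‖ :=
    mul_le_of_le_one_left (norm_nonneg _) (inv_le_one_of_one_le₀ ha1)
  have h2 : ‖a⁻¹ - b⁻¹‖ * ‖y‖ ≤ ‖x - y‖ := by
    have : a⁻¹ - b⁻¹ = (b - a) * (a⁻¹ * b⁻¹) := by field_simp
    rw [this, norm_mul, Real.norm_eq_abs, Real.norm_of_nonneg (by positivity), mul_assoc]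
    have h3 : a⁻¹ * b⁻¹ * ‖y‖ ≤ 1 := by
      rw [mul_assoc]
      have h4 : b⁻¹ * ‖y‖ ≤ 1 := by
        rw [inv_mul_le_iff₀ (by linarith), mul_one]; exact hyb
      exact mul_le_one₀ (inv_le_one_of_one_le₀ ha1) (by positivity) h4
    calc |b - a| * (a⁻¹ * b⁻¹ * ‖y‖) ≤ |b - a| * 1 := by gcongr
      _ ≤ ‖x - y‖ := by rw [mul_one]; exact hab
  have : ((2 : NNReal) : ℝ) = 2 := rfl
  rw [this]; linarith

lemma lipschitz_comp_clamp {v : R2 → R2} {K : NNReal}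
    (hv : LipschitzOnWith K v (Metric.closedBall 0 1)) :
    LipschitzWith (K * 2) (fun x => v (clamp x)) := by
  have := hv.comp (lipschitz_clamp.lipschitzOnWith (s := univ)) (fun x _ => clamp_mem x)
  exact lipschitzOnWith_univ.mp this

lemma polar_ne_zero {r : ℝ} (hr : 0 < r) (θ : ℝ) : polar r θ ≠ 0 := by
  rw [← norm_pos_iff, norm_polar, abs_of_pos hr]; exact hr

lemma clamp_polar {r : ℝ} (hr : 1 ≤ r) (θ : ℝ) : clamp (polar r θ) = circ θ := by
  rw [clamp_of_le_norm (by rw [norm_polar, abs_of_pos (by linarith)]; exact hr),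
    dirc_polar (by linarith)]

/-- Maps on the disk of radius `2` that prescribe a curve on its boundary bound the Plateau value
of this curve. -/
lemma plateau_le_of_ball_two {φ : S1 → R2} {w : R2 → R2} {K : NNReal}
    (hw : LipschitzOnWith K w (Metric.closedBall 0 2)) (hφ : ∀ y : S1, w ((2:ℝ) • (y : R2)) = φ y) :
    plateau φ ≤ tvJ w (Metric.ball 0 2) := by
  have h := tvJ_comp_smul (c := 2) two_pos 1 w
  rw [mul_one] at h
  rw [← h]
  refine iInf₂_le _ ⟨⟨K * 2, ?_⟩, hφ⟩
  refine LipschitzOnWith.of_dist_le_mul fun x hx y hy => ?_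
  have hmem : ∀ z ∈ Metric.closedBall (0 : R2) 1, (2:ℝ) • z ∈ Metric.closedBall (0 : R2) 2 := by
    intro z hz
    rw [mem_closedBall_zero_iff] at hz ⊢
    rw [norm_smul, Real.norm_of_nonneg two_pos.le]; linarith
  refine (hw.dist_le_mul _ (hmem x hx) _ (hmem y hy)).trans (le_of_eq ?_)
  rw [dist_smul₀, Real.norm_of_nonneg two_pos.le, NNReal.coe_mul]
  have : ((2 : NNReal) : ℝ) = 2 := rfl
  rw [this]; ring

/-- Counterclockwise rotation by the angle `t`. -/
def rot (t : ℝ) (x : R2) : R2 := ‖x‖ • (circ (argR x + t) : R2)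

lemma norm_circ (θ : ℝ) : ‖(circ θ : R2)‖ = 1 := mem_sphere_zero_iff_norm.mp (circ θ).2

lemma rot_zero (x : R2) : rot 0 x = x := by
  rw [rot, add_zero, ← polar_eq_smul, polar_norm_argR]

lemma norm_rot (t : ℝ) (x : R2) : ‖rot t x‖ = ‖x‖ := by
  rw [rot, norm_smul, norm_circ, norm_norm, mul_one]

lemma rot_coord_zero (t : ℝ) (x : R2) : rot t x 0 = Real.cos t * x 0 - Real.sin t * x 1 := by
  conv_rhs => rw [← polar_norm_argR x]
  simp [rot, Real.cos_add]; ring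

lemma rot_coord_one (t : ℝ) (x : R2) : rot t x 1 = Real.sin t * x 0 + Real.cos t * x 1 := by
  conv_rhs => rw [← polar_norm_argR x]
  simp [rot, Real.sin_add]; ring

lemma rot_circ (t θ : ℝ) : rot t (circ θ) = circ (θ + t) :=
  ext2 (by rw [rot_coord_zero]; simp [Real.cos_add]; ring)
    (by rw [rot_coord_one]; simp [Real.sin_add]; ring)

lemma rot_sub (t : ℝ) (x y : R2) : rot t x - rot t y = rot t (x - y) :=
  ext2 (by simp only [PiLp.sub_apply, rot_coord_zero]; ring)
    (by simp only [PiLp.sub_apply, rot_coord_one]; ring)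

lemma dist_rot_le (s t : ℝ) (x y : R2) : dist (rot s x) (rot t y) ≤ dist x y + |s - t| * ‖y‖ := by
  have h1 : dist (rot s x) (rot s y) = dist x y := by
    rw [dist_eq_norm, rot_sub, norm_rot, dist_eq_norm]
  have h2 : dist (rot s y) (rot t y) ≤ |s - t| * ‖y‖ := by
    rw [rot, rot, dist_smul₀, norm_norm, mul_comm]
    gcongr
    have := lipschitz_circ.dist_le_mul (argR y + s) (argR y + t)
    rw [NNReal.coe_one, one_mul, dist_add_left, Real.dist_eq] at this
    exact this
  linarith [dist_triangle (rot s x) (rot s y) (rot t y)]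

lemma periodic_angle {X : Type*} {F : ℝ → X} (hF : Function.Periodic F (2 * Real.pi)) (θ : ℝ) :
    F (angle (circ θ)) = F θ := by
  have h1 : circ (toIcoMod Real.two_pi_pos 0 θ) = circ θ := circ_periodic.sub_zsmul_eq _
  have h2 : toIcoMod Real.two_pi_pos 0 θ ∈ Ico 0 (0 + 2 * Real.pi) := toIcoMod_mem_Ico _ _ _
  rw [zero_add] at h2
  rw [← h1, angle_circ h2]
  exact hF.sub_zsmul_eq _

lemma lipschitzOn_comp_dirc {X : Type*} [PseudoMetricSpace X] {φ : S1 → X} {K : NNReal}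
    (hφ : LipschitzWith K φ) : LipschitzOnWith K (fun x => φ (dirc x)) (Metric.sphere 0 1) := by
  refine LipschitzOnWith.of_dist_le_mul fun x hx y hy => ?_
  have hx' : dirc x = ⟨x, hx⟩ := dirc_coe ⟨x, hx⟩
  have hy' : dirc y = ⟨y, hy⟩ := dirc_coe ⟨y, hy⟩
  rw [hx', hy']
  exact hφ.dist_le_mul _ _

/-- The radial function that grows from `0` to `1` across the annulus `1 ≤ |x| ≤ 2`. -/
def ramp (x : R2) : ℝ := max 0 (‖x‖ - 1)

lemma ramp_of_norm_le {x : R2} (h : ‖x‖ ≤ 1) : ramp x = 0 := max_eq_left (by linarith)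

lemma ramp_polar {r : ℝ} (hr : 1 ≤ r) (θ : ℝ) : ramp (polar r θ) = r - 1 := by
  rw [ramp, norm_polar, abs_of_pos (by linarith), max_eq_right (by linarith)]

lemma lipschitzOn_ramp_smul {g : R2 → R2} {K C : NNReal} (hg : LipschitzWith K g)
    (hC : ∀ x, ‖g x‖ ≤ C) :
    LipschitzOnWith (K + C) (fun x => ramp x • g x) (Metric.closedBall 0 2) := by
  refine LipschitzOnWith.of_dist_le_mul fun x hx y hy => ?_
  rw [mem_closedBall_zero_iff] at hx hy
  have h1 : |ramp x| ≤ 1 := by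
    rw [ramp, abs_of_nonneg (le_max_left _ _)]
    exact max_le zero_le_one (by linarith)
  have h2 : |ramp x - ramp y| ≤ dist x y := by
    have := abs_max_sub_max_le_max 0 (‖x‖ - 1) 0 (‖y‖ - 1)
    rw [sub_self, abs_zero, sub_sub_sub_cancel_right,
      max_eq_right (abs_nonneg (‖x‖ - ‖y‖))] at this
    refine this.trans ?_
    rw [dist_eq_norm]
    exact abs_norm_sub_norm_le x y
  have e : ramp x • g x - ramp y • g y = ramp x • (g x - g y) + (ramp x - ramp y) • g y := by
    module
  rw [dist_eq_norm, e, NNReal.coe_add, add_mul]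
  refine (norm_add_le _ _).trans ?_
  rw [norm_smul, norm_smul, Real.norm_eq_abs, Real.norm_eq_abs, ← dist_eq_norm]
  refine add_le_add ?_ ?_
  · exact (mul_le_of_le_one_left dist_nonneg h1).trans (hg.dist_le_mul x y)
  · rw [mul_comm]
    exact mul_le_mul (hC y) h2 (abs_nonneg _) C.2

lemma exists_bound_comp_clamp {Φ : R2 → R2} {K : NNReal} (hΦ : LipschitzWith K Φ) :
    ∃ C : NNReal, ∀ x, ‖Φ (clamp x)‖ ≤ C := by
  refine ⟨‖Φ 0‖₊ + K, fun x => ?_⟩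
  have h1 := hΦ.dist_le_mul (clamp x) 0
  rw [dist_zero_right] at h1
  have h2 : (K : ℝ) * ‖clamp x‖ ≤ K := mul_le_of_le_one_right K.2 (norm_clamp_le x)
  have h3 := norm_le_norm_add_norm_sub' (Φ (clamp x)) (Φ 0)
  rw [← dist_eq_norm] at h3
  rw [NNReal.coe_add, coe_nnnorm]
  rw [dist_comm] at h3
  rw [dist_comm] at h1
  linarith

/-- The part of the domain between the circles of radius `1` and `2`. -/
abbrev annulus : Set R2 := {x | 1 < ‖x‖ ∧ ‖x‖ < 2}

/-- Monotone reparametrizations of degree one do not increase the Plateau value: the curve can be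
reparametrized in an annulus at no cost, within its one-dimensional image. -/
theorem plateau_comp_le {φ ψ : S1 → R2} {α : ℝ → ℝ} {K : NNReal} (hα : LipschitzWith K α)
    (hm : Monotone α) (hp : ∀ θ, α (θ + 2 * Real.pi) = α θ + 2 * Real.pi)
    (h : ∀ θ, φ (circ θ) = ψ (circ (α θ))) : plateau φ ≤ plateau ψ := by
  refine le_iInf₂ ?_
  rintro v ⟨⟨Kv, hv⟩, hvψ⟩
  set β : ℝ → ℝ := fun θ => α θ - θ with hβ
  have hβp : Function.Periodic β (2 * Real.pi) := by
    intro θ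
    simp only [hβ, hp]; ring
  set b : S1 → ℝ := fun y => β (angle y) with hb
  have hbc : ∀ θ, b (circ θ) = β θ := fun θ => periodic_angle hβp θ
  have hbL : LipschitzWith ((K + 1) * (Real.pi / 2).toNNReal) b := by
    refine lipschitz_of_angle fun x _ y _ hxy => ?_
    rw [hbc, hbc, NNReal.coe_add, NNReal.coe_one, Real.dist_eq]
    have h1 := hα.dist_le_mul x y
    rw [Real.dist_eq, Real.dist_eq, abs_sub_comm x y, abs_of_nonneg (sub_nonneg.mpr hxy)] at h1
    have h2 : |β x - β y| ≤ |α x - α y| + |y - x| := by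
      have : β x - β y = (α x - α y) + (y - x) := by simp only [hβ]; ring
      rw [this]; exact abs_add_le _ _
    rw [abs_of_nonneg (sub_nonneg.mpr hxy)] at h2
    linarith
  obtain ⟨B, hBL, hBe⟩ := (lipschitzOn_comp_dirc hbL).extend_real
  have hBc : ∀ θ, B (circ θ) = β θ := by
    intro θ
    have := hBe (circ θ).2
    simp only [dirc_coe] at this
    rw [← this, hbc]
  -- The angle of rotation, as a vector-valued function in order to reuse the product estimate.
  set g : R2 → R2 := fun x => B x • e0 with hg
  have hgL : LipschitzWith ((K + 1) * (Real.pi / 2).toNNReal) g := by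
    refine LipschitzWith.of_dist_le_mul fun x y => ?_
    have : dist (g x) (g y) = dist (B x) (B y) := by
      simp only [hg]
      rw [dist_eq_norm, ← sub_smul, norm_smul, PiLp.norm_single, norm_one, mul_one,
        Real.dist_eq, Real.norm_eq_abs]
    rw [this]
    exact hBL.dist_le_mul x y
  obtain ⟨C, hC⟩ := exists_bound_comp_clamp hgL
  have hT := lipschitzOn_ramp_smul (hgL.comp lipschitz_clamp) hC
  set τ : R2 → ℝ := fun x => ramp x * B (clamp x) with hτ
  have hτL : ∀ x ∈ Metric.closedBall (0 : R2) 2, ∀ y ∈ Metric.closedBall (0 : R2) 2,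
      |τ x - τ y| ≤ ((K + 1) * (Real.pi / 2).toNNReal * 2 + C : NNReal) * dist x y := by
    intro x hx y hy
    have h1 := hT.dist_le_mul x hx y hy
    have h2 := PiLp.norm_apply_le (ramp x • (g ∘ clamp) x - ramp y • (g ∘ clamp) y) 0
    rw [← dist_eq_norm] at h2
    refine le_trans (le_of_eq ?_) (h2.trans h1)
    simp [hg, hτ]
  set w : R2 → R2 := fun x => v (rot (τ x) (clamp x)) with hw
  have hrm : ∀ x, rot (τ x) (clamp x) ∈ Metric.closedBall (0 : R2) 1 := fun x => by
    rw [mem_closedBall_zero_iff, norm_rot]; exact norm_clamp_le x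
  have hwL : LipschitzOnWith (Kv * (2 + ((K + 1) * (Real.pi / 2).toNNReal * 2 + C))) w
      (Metric.closedBall 0 2) := by
    refine LipschitzOnWith.of_dist_le_mul fun x hx y hy => ?_
    refine (hv.dist_le_mul _ (hrm x) _ (hrm y)).trans ?_
    rw [NNReal.coe_mul, mul_assoc]
    gcongr
    refine (dist_rot_le _ _ _ _).trans ?_
    rw [NNReal.coe_add, add_mul]
    refine add_le_add (lipschitz_clamp.dist_le_mul x y) ?_
    exact (mul_le_of_le_one_right (abs_nonneg _) (norm_clamp_le y)).trans (hτL x hx y hy)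
  have hwp : ∀ r, 1 ≤ r → ∀ θ, w (polar r θ) = ψ (circ (θ + (r - 1) * (α θ - θ))) := by
    intro r hr θ
    simp only [hw, hτ]
    rw [ramp_polar hr, clamp_polar hr, hBc, rot_circ, hvψ]
  refine (plateau_le_of_ball_two hwL ?_).trans ?_
  · intro y
    obtain ⟨θ, rfl⟩ := circ_surjective y
    rw [← polar_eq_smul, hwp 2 one_le_two, h]
    congr 2
    ring
  · refine (tvJ_ball_le w 1 2).trans ?_
    have h1 : tvJ w (Metric.ball 0 1) = tvJ v (Metric.ball 0 1) := by
      refine tvJ_congr Metric.isOpen_ball fun x hx => ?_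
      have hx' : ‖x‖ ≤ 1 := (mem_ball_zero_iff.mp hx).le
      simp only [hw, hτ]
      rw [ramp_of_norm_le hx', zero_mul, rot_zero, clamp_of_norm_le hx']
    have h2 : tvJ w annulus = 0 := by
      have hmeas : MeasurableSet annulus :=
        ((isOpen_lt continuous_const continuous_norm).inter
          (isOpen_lt continuous_norm continuous_const)).measurableSet
      rw [tvJ, setLIntegral_congr_fun hmeas (g := fun _ => 0), lintegral_zero]
      intro x hx
      have : (fderiv ℝ w x).det = 0 := by
        refine det_eq_zero_of_polar (Ψ := fun s => ψ (circ s))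
          (h := fun r θ => θ + (r - 1) * (α θ - θ)) (isOpen_Ioo (a := 1) (b := 2))
          (fun r hr θ => hwp r hr.1.le θ) (fun θ => by fun_prop) (fun r => ?_) ?_ hx ?_
        · have := hα.continuous
          fun_prop
        · intro r hr θ θ' hθ
          have := hm hθ.le
          simp only
          nlinarith [hr.1, hr.2]
        · rw [← norm_pos_iff]; linarith [hx.1]
      simp [this]
    rw [h1, h2, add_zero]

lemma hasDerivAt_polar (r θ : ℝ) : HasDerivAt (fun s => polar r s) (r • tang θ) θ := by
  have h : (fun s => polar r s) = fun s => (r * Real.cos s) • e0 + (r * Real.sin s) • e1 :=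
    funext fun s => eq_smul_add _
  have h2 : r • tang θ = (r * -Real.sin θ) • e0 + (r * Real.cos θ) • e1 := eq_smul_add _
  rw [h, h2]
  exact (((Real.hasDerivAt_cos θ).const_mul r).smul_const e0).add
    (((Real.hasDerivAt_sin θ).const_mul r).smul_const e1)

/-- The Plateau value changes little under linear homotopy. -/
lemma plateau_le_add {φ ψ : S1 → R2} {L : NNReal} (hφ : LipschitzWith L φ)
    (hψ : LipschitzWith L ψ) :
    plateau ψ ≤ plateau φ
      + ∫⁻ x in annulus, ENNReal.ofReal (L * ‖ψ (dirc x) - φ (dirc x)‖) := by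
  rw [plateau.eq_def φ, ENNReal.iInf_add]
  refine le_iInf fun v => ?_
  rw [ENNReal.iInf_add]
  refine le_iInf ?_
  rintro ⟨⟨Kv, hv⟩, hvφ⟩
  have hδ : LipschitzWith (L + L) (fun y => ψ y - φ y) := hψ.sub hφ
  obtain ⟨Δ, hΔL, hΔe⟩ := (lipschitzOn_comp_dirc hδ).extend_finite_dimension
  have hΔc : ∀ θ, Δ (circ θ) = ψ (circ θ) - φ (circ θ) := by
    intro θ
    have := hΔe (circ θ).2
    simp only [dirc_coe] at this
    exact this.symm
  obtain ⟨C, hC⟩ := exists_bound_comp_clamp hΔL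
  have hT := lipschitzOn_ramp_smul (hΔL.comp lipschitz_clamp) hC
  set w : R2 → R2 := fun x => v (clamp x) + ramp x • (Δ ∘ clamp) x with hw
  have hwL := (lipschitz_comp_clamp hv).lipschitzOnWith (s := Metric.closedBall 0 2) |>.add hT
  have hwp : ∀ r, 1 ≤ r → ∀ θ, w (polar r θ)
      = φ (circ θ) + (r - 1) • (ψ (circ θ) - φ (circ θ)) := by
    intro r hr θ
    simp only [hw, Function.comp]
    rw [ramp_polar hr, clamp_polar hr, hΔc, hvφ]
  refine (plateau_le_of_ball_two hwL ?_).trans ?_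
  · intro y
    obtain ⟨θ, rfl⟩ := circ_surjective y
    change w _ = _
    rw [← polar_eq_smul, hwp 2 one_le_two]
    module
  · refine (tvJ_ball_le w 1 2).trans (add_le_add ?_ ?_)
    · refine le_of_eq (tvJ_congr Metric.isOpen_ball fun x hx => ?_)
      have hx' : ‖x‖ ≤ 1 := (mem_ball_zero_iff.mp hx).le
      simp only [hw]
      rw [ramp_of_norm_le hx', zero_smul, add_zero, clamp_of_norm_le hx']
    · have hmeas : MeasurableSet annulus :=
        ((isOpen_lt continuous_const continuous_norm).inter
          (isOpen_lt continuous_norm continuous_const)).measurableSet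
      refine setLIntegral_mono' hmeas fun x hx => ENNReal.ofReal_le_ofReal ?_
      by_cases hd : DifferentiableAt ℝ w x
      swap
      · rw [fderiv_zero_of_not_differentiableAt hd, det_eq]
        simp only [zero_apply, PiLp.zero_apply, mul_zero, sub_zero, abs_zero]
        positivity
      set r := ‖x‖ with hr
      set θ := argR x with hθ
      have hxp : polar r θ = x := polar_norm_argR x
      have hA : HasFDerivAt w (fderiv ℝ w x) (polar r θ) := by rw [hxp]; exact hd.hasFDerivAt
      -- The radial derivative is the difference of the two curves.
      have hrad : fderiv ℝ w x (circ θ) = ψ (circ θ) - φ (circ θ) := by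
        have h1 : HasDerivAt (fun s => polar s θ) (circ θ : R2) r := by
          simp_rw [polar_eq_smul]
          simpa using (hasDerivAt_id r).smul_const (circ θ : R2)
        have h2 : HasDerivAt (fun s => w (polar s θ)) (fderiv ℝ w x (circ θ)) r :=
          HasFDerivAt.comp_hasDerivAt (f := fun s => polar s θ) r hA h1
        have h3 : HasDerivAt (fun s => w (polar s θ)) (ψ (circ θ) - φ (circ θ)) r := by
          have h4 : HasDerivAt
              (fun s : ℝ => φ (circ θ) + (s - 1) • (ψ (circ θ) - φ (circ θ)))
              (ψ (circ θ) - φ (circ θ)) r := by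
            have := (((hasDerivAt_id r).sub_const 1).smul_const
              (ψ (circ θ) - φ (circ θ))).const_add (φ (circ θ))
            simpa using this
          refine h4.congr_of_eventuallyEq ?_
          filter_upwards [lt_mem_nhds hx.1] with s hs
          exact hwp s hs.le θ
        exact h2.unique h3
      -- The tangential derivative is bounded by the Lipschitz constants of the curves.
      have htan : ‖fderiv ℝ w x (tang θ)‖ ≤ L := by
        have h1 : HasDerivAt (fun s => polar r s) (r • tang θ) θ := hasDerivAt_polar r θ
        have h2 : HasDerivAt (fun s => w (polar r s)) (fderiv ℝ w x (r • tang θ)) θ :=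
          hA.comp_hasDerivAt θ h1
        have h3 : LipschitzWith L (fun s => w (polar r s)) := by
          refine LipschitzWith.of_dist_le_mul fun s t => ?_
          rw [hwp r hx.1.le, hwp r hx.1.le]
          have hc : dist (circ s) (circ t) ≤ dist s t := by
            have := lipschitz_circ.dist_le_mul s t
            rwa [NNReal.coe_one, one_mul] at this
          have d1 := (hφ.dist_le_mul (circ s) (circ t)).trans
            (mul_le_mul_of_nonneg_left hc L.2)
          have d2 := (hψ.dist_le_mul (circ s) (circ t)).trans
            (mul_le_mul_of_nonneg_left hc L.2)
          have e : (φ (circ s) + (r - 1) • (ψ (circ s) - φ (circ s)))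
              - (φ (circ t) + (r - 1) • (ψ (circ t) - φ (circ t)))
              = (2 - r) • (φ (circ s) - φ (circ t)) + (r - 1) • (ψ (circ s) - ψ (circ t)) := by
            module
          rw [dist_eq_norm, e]
          refine (norm_add_le _ _).trans ?_
          rw [norm_smul, norm_smul, Real.norm_of_nonneg (by linarith [hx.2]),
            Real.norm_of_nonneg (by linarith [hx.1]), ← dist_eq_norm, ← dist_eq_norm]
          nlinarith [hx.1, hx.2]
        have h4 := h2.le_of_lipschitz h3
        rw [map_smul, norm_smul, Real.norm_of_nonneg (by linarith [hx.1])] at h4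
        have h5 := norm_nonneg (fderiv ℝ w x (tang θ))
        nlinarith [hx.1]
      refine (abs_det_le _ θ).trans ?_
      rw [hrad, mul_comm]
      have : dirc x = circ θ := rfl
      rw [this]
      gcongr

/-- The Plateau value is lower semicontinuous along equi-Lipschitz curves converging pointwise. -/
theorem plateau_le_liminf {φ : ℕ → S1 → R2} {ψ : S1 → R2} {L : NNReal}
    (hφ : ∀ n, LipschitzWith L (φ n)) (hψ : LipschitzWith L ψ)
    (hlim : ∀ y, Tendsto (fun n => φ n y) atTop (𝓝 (ψ y))) :
    plateau ψ ≤ liminf (fun n => plateau (φ n)) atTop := by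
  set e : ℕ → ℝ≥0∞ := fun n =>
    ∫⁻ x in annulus, ENNReal.ofReal (L * ‖ψ (dirc x) - φ n (dirc x)‖) with he
  have hvol : volume annulus ≠ ∞ := by
    refine ((measure_mono (t := Metric.ball (0 : R2) 2) ?_).trans_lt measure_ball_lt_top).ne
    intro x hx
    rw [mem_ball_zero_iff]; exact hx.2
  have he0 : Tendsto e atTop (𝓝 0) := by
    -- Equi-Lipschitz curves that converge at one point are uniformly bounded.
    obtain ⟨C, hC⟩ : ∃ C : ℝ, ∀ n y, L * ‖ψ y - φ n y‖ ≤ C := by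
      obtain ⟨D, hD⟩ := ((tendsto_const_nhds (x := ψ (circ 0))).sub
        (hlim (circ 0))).norm.bddAbove_range
      refine ⟨L * (D + (L + L) * 2), fun n y => ?_⟩
      have h1 : ‖ψ (circ 0) - φ n (circ 0)‖ ≤ D := hD ⟨n, rfl⟩
      have h2 : dist y (circ 0) ≤ 2 := by
        rw [Subtype.dist_eq, dist_eq_norm]
        refine (norm_sub_le _ _).trans ?_
        rw [norm_circ, mem_sphere_zero_iff_norm.mp y.2]; norm_num
      have h3 := ((hψ.sub (hφ n)).dist_le_mul y (circ 0)).trans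
        (mul_le_mul_of_nonneg_left h2 (L + L).2)
      rw [dist_eq_norm, NNReal.coe_add] at h3
      have h4 := norm_le_norm_add_norm_sub' (ψ y - φ n y) (ψ (circ 0) - φ n (circ 0))
      have h5 := norm_sub_rev (ψ (circ 0) - φ n (circ 0)) (ψ y - φ n y)
      gcongr
      linarith
    have := tendsto_lintegral_of_dominated_convergence (μ := volume.restrict annulus)
      (F := fun n x => ENNReal.ofReal (L * ‖ψ (dirc x) - φ n (dirc x)‖)) (f := fun _ => 0)
      (fun _ => ENNReal.ofReal C) (fun n => ?_) (fun n => ?_) ?_ ?_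
    · rwa [lintegral_zero] at this
    · have := (hψ.continuous.sub (hφ n).continuous).measurable.comp measurable_dirc
      exact (this.norm.const_mul _).ennreal_ofReal
    · exact ae_of_all _ fun x => ENNReal.ofReal_le_ofReal (hC n _)
    · rw [lintegral_const, Measure.restrict_apply_univ]
      exact ENNReal.mul_ne_top ENNReal.ofReal_ne_top hvol
    · refine ae_of_all _ fun x => ?_
      have h1 := ((tendsto_const_nhds (x := ψ (dirc x))).sub (hlim (dirc x))).norm.const_mul (L : ℝ)
      rw [sub_self, norm_zero, mul_zero] at h1
      have h2 := ENNReal.tendsto_ofReal h1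
      rwa [ENNReal.ofReal_zero] at h2
  have h1 : ∀ n, plateau ψ ≤ plateau (φ n) + e n := fun n => plateau_le_add (hφ n) hψ
  refine ENNReal.le_of_forall_pos_le_add fun δ hδ _ => ?_
  have h2 : ∀ᶠ n in atTop, e n ≤ δ := (ENNReal.tendsto_nhds_zero.mp he0) δ (by exact_mod_cast hδ)
  have h3 : plateau ψ - δ ≤ liminf (fun n => plateau (φ n)) atTop := by
    refine le_liminf_of_le (by isBoundedDefault) ?_
    filter_upwards [h2] with n hn
    rw [tsub_le_iff_right]
    exact (h1 n).trans (by gcongr)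
  exact tsub_le_iff_right.mp h3

/-! ### Lower bound for the relaxed Plateau value -/

section LowerBound

/-- The variation on an interval of a left-continuous function can be computed along a dense set
that contains the left endpoint. -/
lemma eVariationOn_le_inter_dense {g : ℝ → R2} (hg : ∀ t, ContinuousWithinAt g (Iic t) t)
    {D : Set ℝ} (hD : Dense D) {a b : ℝ} (ha : a ∈ D) :
    eVariationOn g (Icc a b) ≤ eVariationOn g (D ∩ Icc a b) := by
  have hex : ∀ (n j : ℕ), ∃ q ∈ D, j ≠ 0 → a + (j - 1) * (1 / ((n : ℝ) + 1)) < q ∧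
      q < a + j * (1 / ((n : ℝ) + 1)) := by
    intro n j
    have hη : 0 < 1 / ((n : ℝ) + 1) := Nat.one_div_pos_of_nat
    obtain ⟨q, hq, hq2⟩ := hD.exists_between
      (show a + (j - 1) * (1 / ((n : ℝ) + 1)) < a + j * (1 / ((n : ℝ) + 1)) by nlinarith)
    exact ⟨q, hq, fun _ => hq2⟩
  choose q hqD hq using hex
  -- The largest chosen point of `D` that surely lies to the left of `x`.
  set d : ℕ → ℝ → ℝ := fun n x =>
    if ⌈(x - a) * ((n : ℝ) + 1)⌉₊ - 1 = 0 then a else q n (⌈(x - a) * ((n : ℝ) + 1)⌉₊ - 1) with hd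
  have hdD : ∀ n x, d n x ∈ D := by
    intro n x
    simp only [hd]
    split_ifs
    exacts [ha, hqD _ _]
  have hda : ∀ n x, a ≤ d n x := by
    intro n x
    simp only [hd]
    split_ifs with h
    · exact le_rfl
    · have h1 := (hq n _ h).1
      have h2 : (1 : ℝ) ≤ ((⌈(x - a) * ((n : ℝ) + 1)⌉₊ - 1 : ℕ) : ℝ) := by
        exact_mod_cast Nat.one_le_iff_ne_zero.mpr h
      have hη : 0 < 1 / ((n : ℝ) + 1) := Nat.one_div_pos_of_nat
      nlinarith
  have hdx : ∀ n x, a ≤ x → d n x ≤ x ∧ x - 2 * (1 / ((n : ℝ) + 1)) ≤ d n x := by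
    intro n x hx
    have hn : (0:ℝ) < (n : ℝ) + 1 := by positivity
    have hη : 0 < 1 / ((n : ℝ) + 1) := by positivity
    have hηn : 1 / ((n : ℝ) + 1) * ((n : ℝ) + 1) = 1 := by field_simp
    have hc1 := Nat.le_ceil ((x - a) * ((n : ℝ) + 1))
    have hc2 := Nat.ceil_lt_add_one (mul_nonneg (sub_nonneg.mpr hx) hn.le)
    set j := ⌈(x - a) * ((n : ℝ) + 1)⌉₊ with hj
    simp only [hd, ← hj]
    have hxa : x - a = (x - a) * ((n : ℝ) + 1) * (1 / ((n : ℝ) + 1)) := by field_simp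
    split_ifs with h
    · refine ⟨hx, ?_⟩
      have : (j : ℝ) ≤ 1 := by
        have : j ≤ 1 := by omega
        exact_mod_cast this
      nlinarith
    · have h1 := hq n _ h
      have h2 : ((j - 1 : ℕ) : ℝ) = (j : ℝ) - 1 := by
        rw [Nat.cast_sub (by omega)]; simp
      rw [h2] at h1
      constructor <;> nlinarith [h1.1, h1.2]
  have hdm : ∀ n, Monotone (d n) := by
    intro n x y hxy
    have hn : (0:ℝ) < (n : ℝ) + 1 := by positivity
    have hη : 0 < 1 / ((n : ℝ) + 1) := by positivity
    have hle : ⌈(x - a) * ((n : ℝ) + 1)⌉₊ ≤ ⌈(y - a) * ((n : ℝ) + 1)⌉₊ :=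
      Nat.ceil_le_ceil (by gcongr)
    have hay := hda n y
    simp only [hd] at hay ⊢
    set i := ⌈(x - a) * ((n : ℝ) + 1)⌉₊
    set j := ⌈(y - a) * ((n : ℝ) + 1)⌉₊
    by_cases hi : i - 1 = 0
    · rw [if_pos hi]; exact hay
    · have hj : ¬ j - 1 = 0 := by omega
      rw [if_neg hi, if_neg hj]
      rcases eq_or_lt_of_le (show i - 1 ≤ j - 1 by omega) with he | hlt
      · rw [he]
      · have h1 := (hq n _ hi).2
        have h2 := (hq n _ hj).1
        have h3 : ((i - 1 : ℕ) : ℝ) ≤ ((j - 1 : ℕ) : ℝ) - 1 := by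
          have : (i - 1 : ℕ) + 1 ≤ (j - 1 : ℕ) := hlt
          have : (((i - 1 : ℕ) + 1 : ℕ) : ℝ) ≤ ((j - 1 : ℕ) : ℝ) := by exact_mod_cast this
          push_cast at this
          linarith
        nlinarith
  have hlim : ∀ x ∈ Icc a b, Tendsto (fun n => g (d n x)) atTop (𝓝 (g x)) := by
    intro x hx
    refine (hg x).tendsto.comp (tendsto_nhdsWithin_iff.mpr ⟨?_, ?_⟩)
    · have h0 : Tendsto (fun n : ℕ => x - 2 * (1 / ((n : ℝ) + 1))) atTop (𝓝 (x - 2 * 0)) :=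
        (tendsto_one_div_add_atTop_nhds_zero_nat.const_mul 2).const_sub x
      rw [mul_zero, sub_zero] at h0
      exact tendsto_of_tendsto_of_tendsto_of_le_of_le h0 tendsto_const_nhds
        (fun n => (hdx n x hx.1).2) (fun n => (hdx n x hx.1).1)
    · exact Eventually.of_forall fun n => (hdx n x hx.1).1
  by_contra! hcon
  obtain ⟨n, hn⟩ := (eVariationOn.lowerSemicontinuous_aux (F := fun n x => g (d n x)) hlim
    hcon).exists
  refine absurd hn (not_lt.mpr ?_)
  exact eVariationOn.comp_le_of_monotoneOn g (d n) ((hdm n).monotoneOn _)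
    (fun x hx => ⟨hdD n x, hda n x, (hdx n x hx.1).1.trans hx.2⟩)

/-- Equi-Lipschitz maps converge at a point if they converge along points approaching it. -/
lemma tendsto_of_lipschitz_of_tendsto {ι : Type*} {F : ℕ → ℝ → R2} {L : NNReal}
    (hF : ∀ n, LipschitzWith L (F n)) {l : Filter ι} [l.NeBot] {s : ι → ℝ} {p : ι → R2}
    {s₀ : ℝ} {p₀ : R2} (hs : Tendsto s l (𝓝 s₀)) (hp : Tendsto p l (𝓝 p₀))
    (h : ∀ᶠ i in l, Tendsto (fun n => F n (s i)) atTop (𝓝 (p i))) :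
    Tendsto (fun n => F n s₀) atTop (𝓝 p₀) := by
  rw [Metric.tendsto_nhds]
  intro ε hε
  have h1 : ∀ᶠ i in l, dist (p i) p₀ < ε / 3 := Metric.tendsto_nhds.mp hp _ (by positivity)
  have h2 : ∀ᶠ i in l, L * dist s₀ (s i) < ε / 3 := by
    have : Tendsto (fun i => (L : ℝ) * dist s₀ (s i)) l (𝓝 (L * dist s₀ s₀)) :=
      (tendsto_const_nhds.dist hs).const_mul _
    rw [dist_self, mul_zero] at this
    exact this.eventually_lt_const (by positivity)
  obtain ⟨i, hi1, hi2, hi3⟩ := (h1.and (h2.and h)).exists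
  filter_upwards [Metric.tendsto_nhds.mp hi3 (ε / 3) (by positivity)] with n hn
  have h4 := (hF n).dist_le_mul s₀ (s i)
  linarith [dist_triangle4 (F n s₀) (F n (s i)) (p i) p₀]

/-- A point of a segment is determined by upper bounds on its distances to the endpoints that add
up to the length of the segment. -/
lemma eq_of_dist_le_of_dist_le {A B P Q : R2} {x : ℝ} (hP : dist A P ≤ x)
    (hP' : dist P B ≤ dist A B - x) (hQ : dist A Q = x) (hQ' : dist Q B = dist A B - x) :
    P = Q := by
  have htri := dist_triangle A P B
  have e1 : dist A P = x := by linarith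
  have e2 : dist P B = dist A B - x := by linarith
  rcases eq_or_ne (dist A B) 0 with h0 | h0
  · have hx : x = 0 := by
      have := dist_nonneg (x := A) (y := P)
      have := dist_nonneg (x := P) (y := B)
      linarith
    rw [hx] at e1 hQ
    rw [← dist_eq_zero.mp e1, ← dist_eq_zero.mp hQ]
  · have key : ∀ R : R2, dist A R = x → dist R B = dist A B - x →
        R = AffineMap.lineMap A B (x / dist A B) := by
      intro R hR hR'
      refine eq_lineMap_of_dist_eq_mul_of_dist_eq_mul ?_ ?_
      · rw [hR]; field_simp
      · rw [hR']; field_simp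
    rw [key P e1 e2, key Q hQ hQ']

/-- The reparametrization of a Lipschitz closed curve `f` proportionally to the elapsed parameter
plus the elapsed variation, with prescribed value `s₀` of the new parameter at `t₀`. -/
lemma exists_reparam {f : ℝ → R2} {K : NNReal} (hf : LipschitzWith K f)
    (hp : Function.Periodic f (2 * Real.pi)) (t₀ s₀ : ℝ) {c : ℝ}
    (hc : c = 2 * Real.pi / ((eVariationOn f (Icc 0 (2 * Real.pi))).toReal + 2 * Real.pi)) :
    ∃ α : ℝ → ℝ, (∃ K', LipschitzWith K' α) ∧ Monotone α ∧
      (∀ s, α (s + 2 * Real.pi) = α s + 2 * Real.pi) ∧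
      (∀ s s', s' ≤ s → dist (f (α s')) (f (α s)) ≤ (s - s') / c) ∧
      ∀ t, α (s₀ + c * (t - t₀ + (varFn f t - varFn f t₀))) = t := by
  have hpi := Real.two_pi_pos
  have hbv : LocallyBoundedVariationOn f univ := hf.locallyBoundedVariationOn univ
  have hM : 0 ≤ (eVariationOn f (Icc 0 (2 * Real.pi))).toReal := ENNReal.toReal_nonneg
  have hcpos : 0 < c := by rw [hc]; positivity
  have hmono := varFn_monotone hbv
  set σ : ℝ → ℝ := fun t => s₀ + c * (t - t₀ + (varFn f t - varFn f t₀)) with hσ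
  have hσsub : ∀ x y, x ≤ y → c * (y - x) ≤ σ y - σ x := by
    intro x y h
    have := hmono h
    simp only [hσ]
    nlinarith
  have hmlip : LipschitzWith K (varFn f) := by
    refine LipschitzWith.of_le_add_mul K fun x y => ?_
    rcases le_total x y with h | h
    · exact le_add_of_le_of_nonneg (hmono h) (mul_nonneg K.coe_nonneg dist_nonneg)
    · have h1 := varFn_sub hbv h
      have h2 : eVariationOn f (Icc y x) ≤ ENNReal.ofReal (K * x - K * y) :=
        eVariationOn_le_of_dist_le (m := fun x => K * x) h fun a _ b _ hab => by
          have := hf.dist_le_mul a b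
          rw [Real.dist_eq, abs_sub_comm, abs_of_nonneg (sub_nonneg.mpr hab)] at this
          linarith
      have h3 := ENNReal.toReal_mono ENNReal.ofReal_ne_top h2
      rw [ENNReal.toReal_ofReal (by nlinarith [K.2])] at h3
      rw [Real.dist_eq, abs_of_nonneg (sub_nonneg.mpr h)]
      linarith
  have hσc : Continuous σ := by
    have := hmlip.continuous
    fun_prop
  have hσs : StrictMono σ := by
    intro x y h
    have := hσsub x y h.le
    nlinarith
  have hsurj : Function.Surjective σ := by
    intro s
    refine mem_range_of_exists_le_of_exists_ge hσc ⟨-(|s - σ 0| / c), ?_⟩ ⟨|s - σ 0| / c, ?_⟩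
    · have h1 : 0 ≤ |s - σ 0| / c := by positivity
      have h2 := hσsub (-(|s - σ 0| / c)) 0 (by linarith)
      have h3 : c * (0 - -(|s - σ 0| / c)) = |s - σ 0| := by field_simp; ring
      have := neg_abs_le (s - σ 0)
      linarith
    · have h1 : 0 ≤ |s - σ 0| / c := by positivity
      have h2 := hσsub 0 (|s - σ 0| / c) h1
      have h3 : c * (|s - σ 0| / c - 0) = |s - σ 0| := by field_simp; ring
      have := le_abs_self (s - σ 0)
      linarith
  have hσp : ∀ t, σ (t + 2 * Real.pi) = σ t + 2 * Real.pi := by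
    intro t
    simp only [hσ]
    rw [varFn_add_period hpi hp hbv, hc]
    field_simp
    ring
  set α := Function.surjInv hsurj with hα
  have hσα : ∀ s, σ (α s) = s := Function.surjInv_eq hsurj
  have hασ : ∀ t, α (σ t) = t := fun t => hσs.injective (hσα _)
  have hαm : Monotone α := by
    intro s s' h
    rw [← hσs.le_iff_le, hσα, hσα]; exact h
  have hαL : LipschitzWith (1 / c).toNNReal α := by
    refine LipschitzWith.of_le_add_mul _ fun s s' => ?_
    rw [Real.coe_toNNReal _ (by positivity)]
    rcases le_total s s' with h | h
    · have := hαm h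
      have : 0 ≤ 1 / c * dist s s' := by positivity
      linarith
    · have h1 := hσsub _ _ (hαm h)
      rw [hσα, hσα] at h1
      rw [Real.dist_eq, abs_of_nonneg (sub_nonneg.mpr h)]
      have : 1 / c * (c * (α s - α s')) ≤ 1 / c * (s - s') := by gcongr
      have e : 1 / c * (c * (α s - α s')) = α s - α s' := by field_simp
      linarith
  refine ⟨α, ⟨_, hαL⟩, hαm, ?_, ?_, hασ⟩
  · intro s
    apply hσs.injective
    rw [hσα, hσp, hσα]
  · intro s s' h
    have h0 := hαm h
    refine (dist_le_varFn_sub hbv h0).trans ?_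
    have h1 : s - s' = c * ((α s - α s') + (varFn f (α s) - varFn f (α s'))) := by
      conv_lhs => rw [← hσα s, ← hσα s']
      simp only [hσ]; ring
    rw [h1, mul_div_cancel_left₀ _ hcpos.ne']
    linarith

/-- Lipschitz curves are strictly compact up to reparametrization: the reparametrizations at
uniform speed of a strictly convergent sequence of curves converge to the completed curve. -/
lemma plateau_completedCurve_le_liminf {γ : S1 → R2} (hγ : MemBVCircle γ) {φ : ℕ → S1 → R2}
    (hL : ∀ n, ∃ K, LipschitzWith K (φ n))
    (hV : Tendsto (fun n => circleVariation (φ n)) atTop (𝓝 (circleVariation γ)))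
    (hVfin : ∀ n, circleVariation (φ n) ≠ ∞)
    (hae : ∀ᵐ t, Tendsto (fun n => φ n (circ t)) atTop (𝓝 (leftTrace γ t))) :
    plateau (completedCurve γ) ≤ liminf (fun n => plateau (φ n)) atTop := by
  have hpi := Real.two_pi_pos
  set g := leftTrace γ with hg
  obtain ⟨-, -, hgl, hgr, hgp⟩ := traces_spec hγ
  rw [← hg] at hgl hgr hgp
  have hgbv : LocallyBoundedVariationOn g univ := leftTrace_lbv hγ
  set f : ℕ → ℝ → R2 := fun n t => φ n (circ t) with hf
  have hfp : ∀ n, Function.Periodic (f n) (2 * Real.pi) := fun n => comp_circ_periodic (φ n)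
  have hfL : ∀ n, ∃ K, LipschitzWith K (f n) := fun n => by
    obtain ⟨K, hK⟩ := hL n
    refine ⟨K * 1, hK.comp (LipschitzWith.of_dist_le_mul fun s t => ?_)⟩
    exact lipschitz_circ.dist_le_mul s t
  have hfbv : ∀ n, LocallyBoundedVariationOn (f n) univ := fun n => by
    obtain ⟨K, hK⟩ := hfL n
    exact hK.locallyBoundedVariationOn univ
  have hfV : ∀ n, circleVariation (φ n) = eVariationOn (f n) (Icc 0 (2 * Real.pi)) := by
    intro n
    obtain ⟨K, hK⟩ := hfL n
    refine le_antisymm ?_ ?_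
    · exact perVar_le_eVariationOn hpi (hfp n) (hK.continuous.locallyIntegrable)
        (ae_of_all _ fun _ => rfl) (hfp n) (hfbv n)
    · have := eVariationOn_le_perVar hpi (hfp n) hK.continuous (hVfin n) 0
      rwa [zero_add] at this
  have hgV := circleVariation_eq_eVariationOn hγ
  rw [← hg] at hgV
  set D : Set ℝ := {t | Tendsto (fun n => f n t) atTop (𝓝 (g t))} with hDdef
  have hD : Dense D := Measure.dense_of_ae hae
  obtain ⟨t₀, ht₀⟩ : ∃ t₀, t₀ ∈ D := hD.nonempty
  -- Lower semicontinuity of the variation on intervals with endpoints in `D`.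
  have hlsc : ∀ a ∈ D, ∀ b, ∀ v < eVariationOn g (Icc a b),
      ∀ᶠ n in atTop, v < eVariationOn (f n) (Icc a b) := by
    intro a ha b v hv
    have h1 := hv.trans_le (eVariationOn_le_inter_dense hgl hD ha)
    have h2 := eVariationOn.lowerSemicontinuous_aux (F := f) (p := atTop) (f := g)
      (s := D ∩ Icc a b) (fun x hx => hx.1) h1
    filter_upwards [h2] with n hn
    exact hn.trans_le (eVariationOn.mono _ inter_subset_right)
  set M : ℝ := (circleVariation γ).toReal with hM
  set Mn : ℕ → ℝ := fun n => (circleVariation (φ n)).toReal with hMn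
  have hMlim : Tendsto Mn atTop (𝓝 M) := (ENNReal.tendsto_toReal hγ.2.ne).comp hV
  have hlscR : ∀ a ∈ D, ∀ b, a ≤ b → ∀ ε > 0,
      ∀ᶠ n in atTop, varFn g b - varFn g a - ε < varFn (f n) b - varFn (f n) a := by
    intro a ha b hab ε hε
    have hfin : ∀ {k : ℝ → R2}, LocallyBoundedVariationOn k univ →
        eVariationOn k (Icc a b) ≠ ∞ := fun hk => by
      have := hk a b (mem_univ _) (mem_univ _)
      rwa [univ_inter] at this
    by_cases h0 : varFn g b - varFn g a - ε < 0
    · filter_upwards with n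
      have := varFn_monotone (hfbv n) hab
      linarith
    · push Not at h0
      have hlt : ENNReal.ofReal (varFn g b - varFn g a - ε) < eVariationOn g (Icc a b) := by
        rw [ENNReal.ofReal_lt_iff_lt_toReal h0 (hfin hgbv), ← varFn_sub hgbv hab]
        linarith
      filter_upwards [hlsc a ha b _ hlt] with n hn
      rw [ENNReal.ofReal_lt_iff_lt_toReal h0 (hfin (hfbv n)), ← varFn_sub (hfbv n) hab] at hn
      exact hn
  have hper : ∀ n t, varFn (f n) (t + 2 * Real.pi) = varFn (f n) t + Mn n := by
    intro n t
    rw [varFn_add_period hpi (hfp n) (hfbv n), ← hfV n]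
  have hperg : ∀ t, varFn g (t + 2 * Real.pi) = varFn g t + M := by
    intro t
    rw [varFn_add_period hpi hgp hgbv, ← hgV]
  -- Since the total variations converge, so do the variations between points of `D`.
  have hvlim : ∀ t ∈ D, t₀ ≤ t → t ≤ t₀ + 2 * Real.pi →
      Tendsto (fun n => varFn (f n) t - varFn (f n) t₀) atTop (𝓝 (varFn g t - varFn g t₀)) := by
    intro t ht h1 h2
    rw [Metric.tendsto_nhds]
    intro ε hε
    filter_upwards [hlscR t₀ ht₀ t h1 (ε / 2) (by positivity),
      hlscR t ht (t₀ + 2 * Real.pi) h2 (ε / 2) (by positivity),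
      Metric.tendsto_nhds.mp hMlim (ε / 2) (by positivity)] with n a1 a2 a3
    rw [hper, hperg] at a2
    rw [Real.dist_eq, abs_lt] at a3 ⊢
    constructor <;> linarith
  set c := speedFactor γ with hc
  have hcpos : 0 < c := speedFactor_pos γ
  have hcM : c = 2 * Real.pi / (M + 2 * Real.pi) := by
    rw [hc, speedFactor, massBefore_two_pi hγ]
  have hM0 : 0 ≤ M := ENNReal.toReal_nonneg
  have hMn0 : ∀ n, 0 ≤ Mn n := fun n => ENNReal.toReal_nonneg
  set cn : ℕ → ℝ := fun n => 2 * Real.pi / (Mn n + 2 * Real.pi) with hcn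
  have hcnpos : ∀ n, 0 < cn n := fun n => by
    have := hMn0 n
    simp only [hcn]; positivity
  have hcnlim : Tendsto cn atTop (𝓝 c) := by
    rw [hcM]
    exact tendsto_const_nhds.div (hMlim.add_const _) (by positivity)
  choose Kf hKf using hfL
  have hrep := fun n => exists_reparam (hKf n) (hfp n) t₀ (newParam γ t₀) (c := cn n)
    (by simp only [hcn, hMn]; rw [hfV n])
  choose α hαL hαm hαp hαd hασ using hrep
  -- The reparametrized curves and their uniform Lipschitz bound.
  set F : ℕ → ℝ → R2 := fun n s => f n (α n s) with hF
  have hFp : ∀ n, Function.Periodic (F n) (2 * Real.pi) := by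
    intro n s
    simp only [hF]
    rw [hαp n, hfp n]
  obtain ⟨L, hLn⟩ : ∃ L : NNReal, ∀ n, 1 / cn n ≤ L := by
    obtain ⟨B, hB⟩ := (hcnlim.inv₀ hcpos.ne').bddAbove_range
    refine ⟨B.toNNReal, fun n => ?_⟩
    rw [one_div]
    exact (hB ⟨n, rfl⟩).trans (Real.le_coe_toNNReal B)
  have hFL' : ∀ n s s', s' ≤ s → dist (F n s') (F n s) ≤ L * (s - s') := by
    intro n s s' h
    refine (hαd n s s' h).trans ?_
    rw [div_eq_mul_one_div, mul_comm]
    exact mul_le_mul_of_nonneg_right (hLn n) (sub_nonneg.mpr h)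
  have hFL : ∀ n, LipschitzWith L (F n) := by
    intro n
    refine LipschitzWith.of_dist_le_mul fun s s' => ?_
    rcases le_total s s' with h | h
    · rw [Real.dist_eq, abs_sub_comm, abs_of_nonneg (sub_nonneg.mpr h)]
      exact hFL' n s' s h
    · rw [Real.dist_eq, abs_of_nonneg (sub_nonneg.mpr h), dist_comm]
      exact hFL' n s s' h
  have hFD0 : ∀ t ∈ D, t₀ ≤ t → t ≤ t₀ + 2 * Real.pi →
      Tendsto (fun n => F n (newParam γ t)) atTop (𝓝 (g t)) := by
    intro t ht h1 h2
    have hσlim : Tendsto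
        (fun n => newParam γ t₀ + cn n * (t - t₀ + (varFn (f n) t - varFn (f n) t₀)))
        atTop (𝓝 (newParam γ t)) := by
      have e : newParam γ t = newParam γ t₀ + c * (t - t₀ + (varFn g t - varFn g t₀)) := by
        rw [newParam, newParam]; ring
      rw [e]
      exact (hcnlim.mul ((hvlim t ht h1 h2).const_add _)).const_add _
    have hd : Tendsto (fun n => dist (F n (newParam γ t)) (f n t)) atTop (𝓝 0) := by
      have h3 : Tendsto (fun n => L * dist (newParam γ t)
          (newParam γ t₀ + cn n * (t - t₀ + (varFn (f n) t - varFn (f n) t₀)))) atTop (𝓝 0) := by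
        have := (tendsto_const_nhds (x := newParam γ t)).dist hσlim
        rw [dist_self] at this
        simpa using this.const_mul (L : ℝ)
      refine squeeze_zero (fun _ => dist_nonneg) (fun n => ?_) h3
      have := (hFL n).dist_le_mul (newParam γ t)
        (newParam γ t₀ + cn n * (t - t₀ + (varFn (f n) t - varFn (f n) t₀)))
      simp only [hF] at this
      rw [hασ n t] at this
      exact this
    exact (tendsto_iff_of_dist hd).mpr ht
  have hDp : ∀ t, t + 2 * Real.pi ∈ D ↔ t ∈ D := by
    intro t
    simp only [hDdef, mem_ofPred_eq]
    rw [hgp]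
    simp_rw [hfp _ t]
  have hFD : ∀ t ∈ D, Tendsto (fun n => F n (newParam γ t)) atTop (𝓝 (g t)) := by
    intro t ht
    have hperP : Function.Periodic (fun t => t ∈ D →
        Tendsto (fun n => F n (newParam γ t)) atTop (𝓝 (g t))) (2 * Real.pi) := by
      intro t
      simp only
      rw [hDp, newParam_add_period hγ, hgp]
      simp_rw [hFp _ (newParam γ t)]
    obtain ⟨y, hy, hy2⟩ := hperP.exists_mem_Ico hpi t t₀
    have hy2' := hy2.mpr (fun hyD => hFD0 y hyD hy.1 hy.2.le)
    exact hy2' ht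
  have hleft : ∀ t, Tendsto (fun n => F n (newParam γ t)) atTop (𝓝 (g t)) := by
    intro t
    have hne : (𝓝[Iio t ∩ D] t).NeBot := by
      rw [← mem_closure_iff_nhdsWithin_neBot]
      refine closure_minimal (hD.open_subset_closure_inter isOpen_Iio) isClosed_closure ?_
      rw [closure_Iio]
      exact self_mem_Iic
    refine tendsto_of_lipschitz_of_tendsto hFL (l := 𝓝[Iio t ∩ D] t)
      ((tendsto_newParam_left hγ t).mono_left (nhdsWithin_mono _ inter_subset_left))
      ((hgl t).mono_left (nhdsWithin_mono _ (inter_subset_left.trans Iio_subset_Iic_self))) ?_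
    filter_upwards [self_mem_nhdsWithin] with t' ht'
    exact hFD t' ht'.2
  have hright : ∀ t, Tendsto (fun n => F n (newParam γ t + c * dist (g t) (rightTrace γ t)))
      atTop (𝓝 (rightTrace γ t)) := by
    intro t
    have hne : (𝓝[Ioi t ∩ D] t).NeBot := by
      rw [← mem_closure_iff_nhdsWithin_neBot]
      refine closure_minimal (hD.open_subset_closure_inter isOpen_Ioi) isClosed_closure ?_
      rw [closure_Ioi]
      exact self_mem_Ici
    refine tendsto_of_lipschitz_of_tendsto hFL (l := 𝓝[Ioi t ∩ D] t)
      ((tendsto_newParam_right hγ t).mono_left (nhdsWithin_mono _ inter_subset_left))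
      ((hgr t).mono_left (nhdsWithin_mono _ inter_subset_left)) ?_
    filter_upwards [self_mem_nhdsWithin] with t' ht'
    exact hFD t' ht'.2
  -- In a gap, the limit is forced by the speed bound: it must run along the segment.
  have hall : ∀ s ∈ Icc 0 (2 * Real.pi),
      Tendsto (fun n => F n s) atTop (𝓝 (completedParam γ s)) := by
    intro s hs
    have b1 := newParam_oldParam_le hγ hs
    have b2 := le_newParam_oldParam_add hγ hs
    have q1 := dist_completedParam_left hγ hs
    have q2 := dist_completedParam_right hγ hs
    set t := oldParam γ s with ht
    refine tendsto_of_subseq_tendsto fun ns hns => ?_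
    have hcl := (hcnlim.comp hns)
    have lim1 : Tendsto (fun n => (s - newParam γ t) / cn (ns n)) atTop
        (𝓝 ((s - newParam γ t) / c)) := tendsto_const_nhds.div hcl hcpos.ne'
    have lim2 : Tendsto (fun n => (newParam γ t + c * dist (g t) (rightTrace γ t) - s) / cn (ns n))
        atTop (𝓝 ((newParam γ t + c * dist (g t) (rightTrace γ t) - s) / c)) :=
      tendsto_const_nhds.div hcl hcpos.ne'
    have hbd : ∃ R, ∀ n, F (ns n) s ∈ Metric.closedBall (0 : R2) R := by
      obtain ⟨B, hB⟩ := ((hleft t).comp hns).norm.bddAbove_range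
      refine ⟨B + L * (s - newParam γ t), fun n => ?_⟩
      rw [mem_closedBall_zero_iff]
      have h1 : ‖F (ns n) (newParam γ t)‖ ≤ B := hB ⟨n, rfl⟩
      have h2 := hFL' (ns n) s (newParam γ t) b1
      rw [dist_eq_norm, norm_sub_rev] at h2
      have h3 := norm_le_norm_add_norm_sub' (F (ns n) s) (F (ns n) (newParam γ t))
      linarith
    obtain ⟨R, hR⟩ := hbd
    obtain ⟨P, -, ms, hms, hP⟩ := tendsto_subseq_of_bounded Metric.isBounded_closedBall hR
    refine ⟨ms, ?_⟩
    have hPQ : P = completedParam γ s := by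
      refine eq_of_dist_le_of_dist_le (A := g t) (B := rightTrace γ t)
        (x := (s - newParam γ t) / c) ?_ ?_ q1 q2
      · refine le_of_tendsto_of_tendsto
          ((((hleft t).comp hns).comp hms.tendsto_atTop).dist hP)
          (lim1.comp hms.tendsto_atTop) (Eventually.of_forall fun n => ?_)
        exact hαd _ _ _ b1
      · have e : dist (g t) (rightTrace γ t) - (s - newParam γ t) / c
            = (newParam γ t + c * dist (g t) (rightTrace γ t) - s) / c := by
          field_simp; ring
        rw [e]
        refine le_of_tendsto_of_tendsto (hP.dist
          (((hright t).comp hns).comp hms.tendsto_atTop))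
          (lim2.comp hms.tendsto_atTop) (Eventually.of_forall fun n => ?_)
        exact hαd _ _ _ b2
    rw [← hPQ]
    exact hP
  set Φ : ℕ → S1 → R2 := fun n y => F n (angle y) with hΦ
  have hΦc : ∀ n s, Φ n (circ s) = F n s := fun n s => periodic_angle (hFp n) s
  have hΦL : ∀ n, LipschitzWith (L * (Real.pi / 2).toNNReal) (Φ n) := fun n =>
    lipschitz_of_angle fun a _ b _ hab => by
      rw [hΦc, hΦc]; exact hFL' n b a hab
  obtain ⟨Kγ, hKγ⟩ := exists_lipschitz_completedCurve hγ
  have hpl : ∀ n, plateau (Φ n) ≤ plateau (φ n) := by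
    intro n
    obtain ⟨K', hK'⟩ := hαL n
    exact plateau_comp_le hK' (hαm n) (hαp n) (hΦc n)
  refine (plateau_le_liminf (L := max (L * (Real.pi / 2).toNNReal) Kγ)
    (fun n => (hΦL n).weaken (le_max_left _ _)) (hKγ.weaken (le_max_right _ _)) ?_).trans
    (liminf_le_liminf (Eventually.of_forall hpl))
  intro y
  exact hall (angle y) (Ico_subset_Icc_self (angle_mem y))

theorem plateau_completedCurve_le_relaxedPlateau {γ : S1 → R2} (hγ : MemBVCircle γ) :
    plateau (completedCurve γ) ≤ relaxedPlateau γ := by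
  refine le_iInf₂ ?_
  rintro φ ⟨hL, hmem, -, hl1, hvar⟩
  by_contra! hcon
  obtain ⟨a, ha1, ha2⟩ := exists_between hcon
  have hfreq : ∃ᶠ n in atTop, plateau (φ n) < a :=
    frequently_lt_of_liminf_lt (by isBoundedDefault) ha1
  obtain ⟨ns, hns, hnsa⟩ := extraction_of_frequently_atTop hfreq
  -- Along a further subsequence the curves converge almost everywhere.
  have hmeas : ∀ n, AEStronglyMeasurable (fun θ => φ n (circ θ))
      (volume.restrict (Ioc 0 (2 * Real.pi))) := fun n => (hmem n).1.aestronglyMeasurable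
  have hconv : TendstoInMeasure (volume.restrict (Ioc 0 (2 * Real.pi)))
      (fun n θ => φ (ns n) (circ θ)) atTop (fun θ => γ (circ θ)) := by
    refine tendstoInMeasure_of_tendsto_eLpNorm (p := 1) one_ne_zero (fun n => hmeas _)
      hγ.1.aestronglyMeasurable ?_
    simp_rw [eLpNorm_one_eq_lintegral_enorm]
    exact hl1.comp hns.tendsto_atTop
  obtain ⟨ms, hms, hae⟩ := hconv.exists_seq_tendsto_ae
  have hae2 := ae_circ (p := fun y => Tendsto (fun n => φ (ns (ms n)) y) atTop (𝓝 (γ y))) hae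
  have key := plateau_completedCurve_le_liminf hγ (φ := fun n => φ (ns (ms n)))
    (fun n => hL _) (hvar.comp (hns.tendsto_atTop.comp hms.tendsto_atTop))
    (fun n => (hmem _).2.ne) (by
      filter_upwards [hae2, (traces_spec hγ).1] with t h1 h2
      rwa [← h2])
  refine absurd (key.trans ?_) (not_le.mpr ha2)
  exact liminf_le_of_le (by isBoundedDefault) fun b hb => by
    obtain ⟨n, hn⟩ := hb.exists
    exact hn.trans (hnsa _).le

end LowerBound

/-! ### Total variation of smooth maps -/

section TotalVariation

/-- The Frobenius norm of a linear endomorphism of the plane. -/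
def frob (A : R2 →L[ℝ] R2) : ℝ := √(‖A e0‖ ^ 2 + ‖A e1‖ ^ 2)

lemma continuous_frob : Continuous frob := by
  unfold frob; fun_prop

lemma inner_le_frob (A : R2 →L[ℝ] R2) {p q : R2} (h : ‖p‖ ^ 2 + ‖q‖ ^ 2 ≤ 1) :
    |A p 0 + A q 1| ≤ frob A := by
  refine Real.abs_le_sqrt ?_
  rw [clm_apply A p, clm_apply A q]
  rw [norm_sq_R2, norm_sq_R2] at h ⊢
  simp only [PiLp.add_apply, PiLp.smul_apply, smul_eq_mul]
  set a := A e0 0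
  set b := A e0 1
  set c := A e1 0
  set d := A e1 1
  have key : (p 0 * a + p 1 * c + (q 0 * b + q 1 * d)) ^ 2
      ≤ (p 0 ^ 2 + p 1 ^ 2 + (q 0 ^ 2 + q 1 ^ 2)) * (a ^ 2 + b ^ 2 + (c ^ 2 + d ^ 2)) := by
    nlinarith [sq_nonneg (p 0 * c - p 1 * a), sq_nonneg (p 0 * b - q 0 * a),
      sq_nonneg (p 0 * d - q 1 * a), sq_nonneg (p 1 * b - q 0 * c),
      sq_nonneg (p 1 * d - q 1 * c), sq_nonneg (q 0 * d - q 1 * b)]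
  exact key.trans (mul_le_of_le_one_left (by positivity) h)

lemma frob_le (A : R2 →L[ℝ] R2) : frob A ≤ 2 * ‖A‖ := by
  refine Real.sqrt_le_iff.mpr ⟨by positivity, ?_⟩
  have h0 : ‖A e0‖ ≤ ‖A‖ := by simpa using A.le_opNorm e0
  have h1 : ‖A e1‖ ≤ ‖A‖ := by simpa using A.le_opNorm e1
  nlinarith [norm_nonneg (A e0), norm_nonneg (A e1), norm_nonneg A]

lemma continuous_of_continuousOn_tsupport {X Y : Type*} [TopologicalSpace X] [TopologicalSpace Y]
    [Zero Y] {f : X → Y} {Ω : Set X} (hΩ : IsOpen Ω) (hf : ContinuousOn f Ω)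
    (h : tsupport f ⊆ Ω) : Continuous f :=
  continuous_of_tsupport fun _ hx => hf.continuousAt (hΩ.mem_nhds (h hx))

variable {Ω : Set R2}

lemma tsupport_clm_apply_subset (B : R2 → R2 →L[ℝ] R2) (G : R2 → R2) :
    tsupport (fun x => B x (G x)) ⊆ tsupport G :=
  closure_mono fun x hx => by
    rw [Function.mem_support] at hx ⊢
    exact fun h => hx (by rw [h, map_zero])

lemma continuous_fderiv_apply (hΩ : IsOpen Ω) {v : R2 → R2} (hv : ContDiffOn ℝ 1 v Ω)
    {G : R2 → R2} (hG : Continuous G) (hs : tsupport G ⊆ Ω) :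
    Continuous (fun x => fderiv ℝ v x (G x)) :=
  continuous_of_continuousOn_tsupport hΩ
    ((hv.continuousOn_fderiv_of_isOpen hΩ le_rfl).clm_apply hG.continuousOn)
    ((tsupport_clm_apply_subset _ G).trans hs)

lemma hasCompactSupport_fderiv_apply (v : R2 → R2) {G : R2 → R2} (hc : HasCompactSupport G) :
    HasCompactSupport (fun x => fderiv ℝ v x (G x)) :=
  hc.of_isClosed_subset (isClosed_tsupport _) (tsupport_clm_apply_subset _ G)

lemma continuous_divergence {P : R2 → R2} (hP : ContDiff ℝ 1 P) : Continuous (divergence P) := by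
  have := hP.continuous_fderiv one_ne_zero
  unfold divergence; fun_prop

lemma divergence_of_eventuallyEq_zero {P : R2 → R2} {x : R2} (h : P =ᶠ[𝓝 x] 0) :
    divergence P x = 0 := by
  rw [divergence, h.fderiv_eq]; simp

lemma support_divergence_subset (P : R2 → R2) :
    Function.support (divergence P) ⊆ tsupport P := fun _ hx => by
  by_contra h
  exact hx (divergence_of_eventuallyEq_zero (notMem_tsupport_iff_eventuallyEq.mp h))

lemma integrable_divergence {P : R2 → R2} (hP : ContDiff ℝ 1 P) (hc : HasCompactSupport P) :
    Integrable (divergence P) :=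
  (continuous_divergence hP).integrable_of_hasCompactSupport
    (hc.mono' (support_divergence_subset P))

/-- The partial derivatives of a compactly supported field have integral zero. -/
lemma integral_divergence_eq_zero {P : R2 → R2} (hP : ContDiff ℝ 1 P)
    (hc : HasCompactSupport P) : ∫ x, divergence P x = 0 := by
  have hcd : HasCompactSupport (fderiv ℝ P) := hc.fderiv ℝ
  have hcont : Continuous (fderiv ℝ P) := hP.continuous_fderiv one_ne_zero
  have hint : ∀ j : Fin 2, Integrable
      (fun x => (fderiv ℝ P x (EuclideanSpace.single j 1)) j) := fun j => by
    refine Continuous.integrable_of_hasCompactSupport (by fun_prop) ?_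
    refine hcd.mono' fun x hx => ?_
    refine subset_tsupport _ ?_
    rw [Function.mem_support] at hx ⊢
    exact fun h => hx (by simp [h])
  have hPi : ∀ j : Fin 2, Integrable (fun x => P x j) := fun j => by
    refine Continuous.integrable_of_hasCompactSupport (by have := hP.continuous; fun_prop) ?_
    refine hc.mono' fun x hx => subset_tsupport _ ?_
    rw [Function.mem_support] at hx ⊢
    exact fun h => hx (by simp [h])
  unfold divergence
  rw [integral_finsetSum _ fun j _ => hint j]
  refine Finset.sum_eq_zero fun j _ => ?_
  have key := integral_bilinear_hasLineDerivAt_right_eq_neg_left_of_integrable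
    (μ := (volume : Measure R2)) (B := ContinuousLinearMap.mul ℝ ℝ)
    (f := fun x => P x j) (f' := fun x => (fderiv ℝ P x (EuclideanSpace.single j 1)) j)
    (g := fun _ => (1 : ℝ)) (g' := fun _ => (0 : ℝ)) (v := EuclideanSpace.single j 1)
    (by simpa using hint j) (by simp) (by simpa using hPi j)
    (fun x _ => by
      have h1 := (hP.differentiable one_ne_zero x).hasFDerivAt
      have h2 := ((EuclideanSpace.proj j : R2 →L[ℝ] ℝ).hasFDerivAt.comp x h1).hasLineDerivAt
        (EuclideanSpace.single j 1)
      exact h2)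
    (fun x _ => (hasFDerivAt_const (1 : ℝ) x).hasLineDerivAt _)
  simp only [ContinuousLinearMap.mul_apply', mul_zero, mul_one, integral_zero] at key
  linarith

lemma divergence_smul {f : R2 → ℝ} {G : R2 → R2} {x : R2} (hf : DifferentiableAt ℝ f x)
    (hG : DifferentiableAt ℝ G x) :
    divergence (fun x => f x • G x) x = f x * divergence G x + fderiv ℝ f x (G x) := by
  have e : fderiv ℝ f x (G x) = G x 0 * fderiv ℝ f x e0 + G x 1 * fderiv ℝ f x e1 := by
    conv_lhs => rw [eq_smul_add (G x)]
    rw [map_add, map_smul, map_smul, smul_eq_mul, smul_eq_mul]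
  rw [e, divergence, divergence, fderiv_fun_smul hf hG, Fin.sum_univ_two, Fin.sum_univ_two]
  simp only [add_apply, smul_apply, ContinuousLinearMap.smulRight_apply, PiLp.add_apply,
    PiLp.smul_apply, smul_eq_mul]
  ring

lemma divergence_smul_of_tsupport_subset (hΩ : IsOpen Ω) {f : R2 → ℝ} (hf : ContDiffOn ℝ 1 f Ω)
    {G : R2 → R2} (hG : ContDiff ℝ 1 G) (hs : tsupport G ⊆ Ω) :
    ContDiff ℝ 1 (fun x => f x • G x) ∧
      ∀ x, divergence (fun x => f x • G x) x = f x * divergence G x + fderiv ℝ f x (G x) := by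
  have hzero : ∀ x, x ∉ Ω → G =ᶠ[𝓝 x] 0 := fun x hx =>
    notMem_tsupport_iff_eventuallyEq.mp fun h => hx (hs h)
  have hzero' : ∀ x, x ∉ Ω → (fun x => f x • G x) =ᶠ[𝓝 x] 0 := fun x hx => by
    filter_upwards [hzero x hx] with y hy
    rw [hy, Pi.zero_apply, smul_zero]
  refine ⟨contDiff_iff_contDiffAt.mpr fun x => ?_, fun x => ?_⟩
  · by_cases hx : x ∈ Ω
    · exact (hf.contDiffAt (hΩ.mem_nhds hx)).smul hG.contDiffAt
    · exact (contDiffAt_const (c := (0 : R2))).congr_of_eventuallyEq (hzero' x hx)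
  · by_cases hx : x ∈ Ω
    · exact divergence_smul
        ((hf.contDiffAt (hΩ.mem_nhds hx)).differentiableAt one_ne_zero)
        (hG.differentiable one_ne_zero x)
    · rw [divergence_of_eventuallyEq_zero (hzero' x hx),
        divergence_of_eventuallyEq_zero (hzero x hx), (hzero x hx).self_of_nhds, Pi.zero_apply,
        map_zero, mul_zero, zero_add]

/-- Integration by parts against a compactly supported field. -/
lemma integral_mul_divergence (hΩ : IsOpen Ω) {f : R2 → ℝ} (hf : ContDiffOn ℝ 1 f Ω)
    {G : R2 → R2} (hG : ContDiff ℝ 1 G) (hc : HasCompactSupport G) (hs : tsupport G ⊆ Ω) :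
    ∫ x in Ω, f x * divergence G x = - ∫ x in Ω, fderiv ℝ f x (G x) := by
  obtain ⟨hP, hdiv⟩ := divergence_smul_of_tsupport_subset hΩ hf hG hs
  have hPc : HasCompactSupport (fun x => f x • G x) := hc.mono fun x hx => by
    rw [Function.mem_support] at hx ⊢
    exact fun h => hx (by rw [h, smul_zero])
  have h0 := integral_divergence_eq_zero hP hPc
  have hoff : ∀ x, x ∉ Ω → f x * divergence G x = 0 ∧ fderiv ℝ f x (G x) = 0 := by
    intro x hx
    have h := notMem_tsupport_iff_eventuallyEq.mp fun h => hx (hs h)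
    rw [divergence_of_eventuallyEq_zero h, h.self_of_nhds, Pi.zero_apply, map_zero, mul_zero]
    exact ⟨rfl, rfl⟩
  have hsub : Function.support (fun x => fderiv ℝ f x (G x)) ⊆ tsupport G := fun x hx => by
    refine subset_tsupport _ ?_
    rw [Function.mem_support] at hx ⊢
    exact fun h => hx (by rw [h, map_zero])
  have hcont : Continuous (fun x => fderiv ℝ f x (G x)) :=
    continuous_of_continuousOn_tsupport hΩ
      ((hf.continuousOn_fderiv_of_isOpen hΩ le_rfl).clm_apply hG.continuous.continuousOn)
      ((closure_minimal hsub (isClosed_tsupport _)).trans hs)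
  have hint := hcont.integrable_of_hasCompactSupport (μ := volume) (hc.mono' hsub)
  have hdivint := integrable_divergence hP hPc
  rw [setIntegral_eq_integral_of_forall_compl_eq_zero fun x hx => (hoff x hx).1,
    setIntegral_eq_integral_of_forall_compl_eq_zero fun x hx => (hoff x hx).2]
  have e : ∀ x, f x * divergence G x = divergence (fun x => f x • G x) x - fderiv ℝ f x (G x) :=
    fun x => by rw [hdiv]; ring
  simp_rw [e]
  rw [integral_sub hdivint hint, h0, zero_sub]

lemma integrable_fderiv_apply (hΩ : IsOpen Ω) {v : R2 → R2} (hv : ContDiffOn ℝ 1 v Ω)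
    {G : R2 → R2} (hG : Continuous G) (hc : HasCompactSupport G) (hs : tsupport G ⊆ Ω)
    (i : Fin 2) : Integrable (fun x => fderiv ℝ v x (G x) i) := by
  have h1 := continuous_fderiv_apply hΩ hv hG hs
  refine Continuous.integrable_of_hasCompactSupport (by fun_prop) ?_
  refine (hasCompactSupport_fderiv_apply v hc).mono' fun x hx => subset_tsupport _ ?_
  rw [Function.mem_support] at hx ⊢
  exact fun h => hx (by simp [h])

/-- Against a `C¹` map the total variation pairs test fields with the gradient. -/
lemma integral_test_eq (hΩ : IsOpen Ω) {v : R2 → R2} (hv : ContDiffOn ℝ 1 v Ω)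
    {g : Fin 2 → R2 → R2} (hg : ∀ i, ContDiff ℝ 1 (g i) ∧ HasCompactSupport (g i) ∧
      tsupport (g i) ⊆ Ω) :
    ∫ x in Ω, ∑ i : Fin 2, v x i * divergence (g i) x
      = - ∫ x in Ω, (fderiv ℝ v x (g 0 x) 0 + fderiv ℝ v x (g 1 x) 1) := by
  have hvi : ∀ i : Fin 2, ContDiffOn ℝ 1 (fun x => v x i) Ω := fun i =>
    (EuclideanSpace.proj i : R2 →L[ℝ] ℝ).contDiff.comp_contDiffOn hv
  have hfd : ∀ i : Fin 2, ∀ x ∈ Ω, ∀ w, fderiv ℝ (fun x => v x i) x w = fderiv ℝ v x w i := by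
    intro i x hx w
    have h1 := ((hv.contDiffAt (hΩ.mem_nhds hx)).differentiableAt one_ne_zero).hasFDerivAt
    have h2 := (EuclideanSpace.proj i : R2 →L[ℝ] ℝ).hasFDerivAt.comp x h1
    have h3 : fderiv ℝ (fun x => v x i) x
        = (EuclideanSpace.proj i : R2 →L[ℝ] ℝ).comp (fderiv ℝ v x) := h2.fderiv
    rw [h3]; rfl
  have hibp : ∀ i : Fin 2, ∫ x in Ω, v x i * divergence (g i) x
      = - ∫ x in Ω, fderiv ℝ v x (g i x) i := by
    intro i
    rw [integral_mul_divergence hΩ (hvi i) (hg i).1 (hg i).2.1 (hg i).2.2]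
    congr 1
    exact setIntegral_congr_fun hΩ.measurableSet fun x hx => hfd i x hx _
  have hint : ∀ i : Fin 2, IntegrableOn (fun x => v x i * divergence (g i) x) Ω := by
    intro i
    have hdc := continuous_divergence (hg i).1
    have hsup : tsupport (fun x => v x i * divergence (g i) x) ⊆ tsupport (g i) := by
      refine closure_minimal (fun x hx => ?_) (isClosed_tsupport _)
      by_contra h
      refine hx ?_
      simp only
      rw [divergence_of_eventuallyEq_zero (notMem_tsupport_iff_eventuallyEq.mp h), mul_zero]
    refine (Continuous.integrable_of_hasCompactSupport ?_ ?_).integrableOn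
    · exact continuous_of_continuousOn_tsupport hΩ
        ((hvi i).continuousOn.mul hdc.continuousOn) (hsup.trans (hg i).2.2)
    · exact (hg i).2.1.of_isClosed_subset (isClosed_tsupport _) hsup
  have hint2 : ∀ i : Fin 2, IntegrableOn (fun x => fderiv ℝ v x (g i x) i) Ω := fun i =>
    (integrable_fderiv_apply hΩ hv (hg i).1.continuous (hg i).2.1 (hg i).2.2 i).integrableOn
  rw [integral_finsetSum _ fun i _ => hint i, Fin.sum_univ_two, hibp, hibp,
    integral_add (hint2 0) (hint2 1)]
  ring

/-- The total variation of a `C¹` map is at most the integral of the norm of its gradient. -/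
lemma totalVariation_le_lintegral_frob (hΩ : IsOpen Ω) {v : R2 → R2} (hv : ContDiffOn ℝ 1 v Ω) :
    totalVariation v Ω ≤ ∫⁻ x in Ω, ENNReal.ofReal (frob (fderiv ℝ v x)) := by
  refine iSup₂_le fun g hg => ?_
  rw [integral_test_eq hΩ hv hg.1]
  refine (Real.ofReal_le_enorm _).trans ?_
  rw [enorm_neg]
  refine (enorm_integral_le_lintegral_enorm _).trans (lintegral_mono fun x => ?_)
  rw [← ofReal_norm, Real.norm_eq_abs]
  refine ENNReal.ofReal_le_ofReal (inner_le_frob _ ?_)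
  have := hg.2 x
  rwa [Fin.sum_univ_two] at this

/-- The total variation is lower semicontinuous under convergence in `L¹`. -/
lemma totalVariation_le_liminf {v : ℕ → R2 → R2} {u : R2 → R2}
    (hv : ∀ k, IntegrableOn (v k) Ω) (hu : IntegrableOn u Ω)
    (hlim : Tendsto (fun k => ∫⁻ x in Ω, ‖v k x - u x‖ₑ) atTop (𝓝 0)) :
    totalVariation u Ω ≤ liminf (fun k => totalVariation (v k) Ω) atTop := by
  refine iSup₂_le fun g hg => ?_
  have hdc : ∀ i, Continuous (divergence (g i)) := fun i => continuous_divergence (hg.1 i).1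
  have hdb : ∀ i, ∃ C, ∀ x, ‖divergence (g i) x‖ ≤ C := fun i =>
    (hdc i).bounded_above_of_compact_support
      ((hg.1 i).2.1.mono' (support_divergence_subset (g i)))
  have hint : ∀ {w : R2 → R2}, IntegrableOn w Ω → ∀ i : Fin 2,
      IntegrableOn (fun x => w x i * divergence (g i) x) Ω := fun {w} hw i => by
    obtain ⟨C, hC⟩ := hdb i
    have h1 : Integrable (fun x => w x i) (volume.restrict Ω) :=
      (EuclideanSpace.proj i : R2 →L[ℝ] ℝ).integrable_comp hw
    exact h1.mul_bdd (hdc i).aestronglyMeasurable (ae_of_all _ hC)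
  have hcomp : ∀ i : Fin 2, Tendsto (fun k => ∫ x in Ω, v k x i * divergence (g i) x) atTop
      (𝓝 (∫ x in Ω, u x i * divergence (g i) x)) := fun i => by
    obtain ⟨C, hC⟩ := hdb i
    refine tendsto_integral_of_L1 _ (hint hu i).1 (Eventually.of_forall fun k => hint (hv k) i) ?_
    have h0 : Tendsto (fun k => ENNReal.ofReal C * ∫⁻ x in Ω, ‖v k x - u x‖ₑ) atTop (𝓝 0) := by
      have := ENNReal.Tendsto.const_mul (a := ENNReal.ofReal C) hlim (Or.inr ENNReal.ofReal_ne_top)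
      rwa [mul_zero] at this
    refine tendsto_of_tendsto_of_tendsto_of_le_of_le tendsto_const_nhds h0 (fun _ => zero_le)
      fun k => ?_
    simp only
    rw [← lintegral_const_mul' _ _ ENNReal.ofReal_ne_top]
    refine lintegral_mono fun x => ?_
    rw [← sub_mul, ← ofReal_norm, norm_mul, mul_comm, ← ofReal_norm,
      ← ENNReal.ofReal_mul ((norm_nonneg _).trans (hC x))]
    refine ENNReal.ofReal_le_ofReal (mul_le_mul (hC x) ?_ (norm_nonneg _)
      ((norm_nonneg _).trans (hC x)))
    exact PiLp.norm_apply_le (v k x - u x) i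
  have hall : Tendsto (fun k => ∫ x in Ω, ∑ i : Fin 2, v k x i * divergence (g i) x) atTop
      (𝓝 (∫ x in Ω, ∑ i : Fin 2, u x i * divergence (g i) x)) := by
    rw [integral_finsetSum _ fun i _ => hint hu i]
    simp_rw [fun k => integral_finsetSum Finset.univ fun i _ => hint (hv k) i]
    exact tendsto_finsetSum _ fun i _ => hcomp i
  rw [← (ENNReal.tendsto_ofReal hall).liminf_eq]
  refine liminf_le_liminf (Eventually.of_forall fun k => ?_)
  exact le_iSup₂_of_le g hg le_rfl

end TotalVariation

/-! ### The tangential part of the total variation -/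

section Tangential

lemma abs_apply_le (A : R2 →L[ℝ] R2) (p : R2) (i : Fin 2) : |A p i| ≤ ‖A‖ * ‖p‖ :=
  (PiLp.norm_apply_le (A p) i).trans (A.le_opNorm p)

/-- In the dual description of the total variation of a `C¹` map, merely continuous test fields
are admissible, since they can be mollified. -/
lemma integral_continuous_test_le {l ρ : ℝ} (hρ : 0 < ρ) (hρl : ρ < l) {v : R2 → R2}
    (hv : ContDiffOn ℝ 1 v (Metric.ball 0 l)) {p q : R2 → R2} (hp : Continuous p)
    (hq : Continuous q) (hp0 : ∀ x, ρ ≤ ‖x‖ → p x = 0) (hq0 : ∀ x, ρ ≤ ‖x‖ → q x = 0)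
    (hpq : ∀ x, ‖p x‖ ^ 2 + ‖q x‖ ^ 2 ≤ 1) :
    ENNReal.ofReal (∫ x in Metric.ball 0 l, (fderiv ℝ v x (p x) 0 + fderiv ℝ v x (q x) 1))
      ≤ totalVariation v (Metric.ball 0 l) := by
  have hΩ : IsOpen (Metric.ball (0 : R2) l) := Metric.isOpen_ball
  rcases eq_or_ne (totalVariation v (Metric.ball 0 l)) ∞ with htop | htop
  · rw [htop]; exact le_top
  have hcs : ∀ {w : R2 → R2}, (∀ x, ρ ≤ ‖x‖ → w x = 0) →
      HasCompactSupport w ∧ tsupport w ⊆ Metric.ball 0 l := fun {w} hw => by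
    have hsub : tsupport w ⊆ Metric.closedBall 0 ρ :=
      closure_minimal (fun x hx => by
        rw [mem_closedBall_zero_iff]
        by_contra h
        exact hx (hw x (not_le.mp h).le)) Metric.isClosed_closedBall
    exact ⟨(isCompact_closedBall _ _).of_isClosed_subset (isClosed_tsupport _) hsub,
      hsub.trans (Metric.closedBall_subset_ball hρl)⟩
  obtain ⟨hpc, hps⟩ := hcs hp0
  obtain ⟨hqc, hqs⟩ := hcs hq0
  let η : ContDiffBump (0 : R2) := ⟨ρ, (ρ + l) / 2, hρ, by linarith⟩
  have hηs : tsupport η ⊆ Metric.ball (0 : R2) l := by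
    rw [η.tsupport_eq]
    exact Metric.closedBall_subset_ball (by change (ρ + l) / 2 < l; linarith)
  have hη1 : ∀ x : R2, ‖x‖ ≤ ρ → η x = 1 := fun x hx =>
    η.one_of_mem_closedBall (mem_closedBall_zero_iff.mpr hx)
  have hsmul : ∀ {w : R2 → R2}, (∀ x, ρ ≤ ‖x‖ → w x = 0) → ∀ x, w x = η x • w x := by
    intro w hw x
    rcases le_total ‖x‖ ρ with h | h
    · rw [hη1 x h, one_smul]
    · rw [hw x h, smul_zero]
  have hηint : Integrable (fun x => η x * ‖fderiv ℝ v x‖) := by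
    have hsub : tsupport (fun x => η x * ‖fderiv ℝ v x‖) ⊆ tsupport η :=
      closure_mono fun x hx => by
        rw [Function.mem_support] at hx ⊢
        exact fun h => hx (by rw [h, zero_mul])
    refine Continuous.integrable_of_hasCompactSupport ?_
      (η.hasCompactSupport.of_isClosed_subset (isClosed_tsupport _) hsub)
    exact continuous_of_continuousOn_tsupport hΩ (η.continuous.continuousOn.mul
      (hv.continuousOn_fderiv_of_isOpen hΩ le_rfl).norm) (hsub.trans hηs)
  set C : ℝ := ∫ x in Metric.ball 0 l, η x * ‖fderiv ℝ v x‖ with hC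
  set I : ℝ := ∫ x in Metric.ball 0 l, (fderiv ℝ v x (p x) 0 + fderiv ℝ v x (q x) 1) with hI
  set T : ℝ := (totalVariation v (Metric.ball 0 l)).toReal with hT
  have key : ∀ ε > 0, I ≤ (1 + 2 * ε) * T + 2 * ε * C := by
    intro ε hε
    obtain ⟨P, hP, hPd⟩ :=
      (hpc.uniformContinuous_of_continuous hp).exists_contDiff_dist_le hε
    obtain ⟨Q, hQ, hQd⟩ :=
      (hqc.uniformContinuous_of_continuous hq).exists_contDiff_dist_le hε
    have hP1 : ContDiff ℝ 1 P := hP.of_le (by exact_mod_cast le_top)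
    have hQ1 : ContDiff ℝ 1 Q := hQ.of_le (by exact_mod_cast le_top)
    set g : Fin 2 → R2 → R2 := fun i x => (-(1 + 2 * ε)⁻¹ * η x) • (![P, Q] i x) with hg
    have hg1 : ∀ i, ContDiff ℝ 1 (g i) ∧ HasCompactSupport (g i) ∧
        tsupport (g i) ⊆ Metric.ball 0 l := by
      intro i
      have hsub : tsupport (g i) ⊆ tsupport η := closure_mono fun x hx => by
        rw [Function.mem_support] at hx ⊢
        exact fun h => hx (by simp only [hg]; rw [h, mul_zero, zero_smul])
      refine ⟨?_, η.hasCompactSupport.of_isClosed_subset (isClosed_tsupport _) hsub,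
        hsub.trans hηs⟩
      have hPQ : ContDiff ℝ 1 (![P, Q] i) := by
        fin_cases i
        exacts [hP1, hQ1]
      exact (contDiff_const.mul η.contDiff).smul hPQ
    have hbound : ∀ x, ‖P x‖ ^ 2 + ‖Q x‖ ^ 2 ≤ (1 + 2 * ε) ^ 2 := by
      intro x
      have h1 : ‖P x‖ ≤ ‖p x‖ + ε := by
        have := hPd x
        rw [dist_eq_norm] at this
        linarith [norm_le_norm_add_norm_sub' (P x) (p x)]
      have h2 : ‖Q x‖ ≤ ‖q x‖ + ε := by
        have := hQd x
        rw [dist_eq_norm] at this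
        linarith [norm_le_norm_add_norm_sub' (Q x) (q x)]
      have h3 := hpq x
      have h4 : ‖P x‖ ^ 2 ≤ (‖p x‖ + ε) ^ 2 := by gcongr
      have h5 : ‖Q x‖ ^ 2 ≤ (‖q x‖ + ε) ^ 2 := by gcongr
      have h6 : ‖p x‖ + ‖q x‖ ≤ 2 := by nlinarith [sq_nonneg (‖p x‖ - 1), sq_nonneg (‖q x‖ - 1)]
      nlinarith
    have htest : IsTestField (Metric.ball 0 l) g := by
      refine ⟨hg1, fun x => ?_⟩
      rw [Fin.sum_univ_two]
      simp only [hg, norm_smul, mul_pow, Real.norm_eq_abs, sq_abs, Matrix.cons_val_zero,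
        Matrix.cons_val_one]
      have h1 : η x ^ 2 ≤ 1 := by nlinarith [η.nonneg (x := x), η.le_one (x := x)]
      have h2 := hbound x
      have h3 : ((1 + 2 * ε)⁻¹) ^ 2 * (‖P x‖ ^ 2 + ‖Q x‖ ^ 2) ≤ 1 := by
        rw [inv_pow, inv_mul_le_iff₀ (by positivity), mul_one]
        exact h2
      calc (-(1 + 2 * ε)⁻¹) ^ 2 * η x ^ 2 * ‖P x‖ ^ 2 + (-(1 + 2 * ε)⁻¹) ^ 2 * η x ^ 2 * ‖Q x‖ ^ 2
          = η x ^ 2 * (((1 + 2 * ε)⁻¹) ^ 2 * (‖P x‖ ^ 2 + ‖Q x‖ ^ 2)) := by ring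
        _ ≤ 1 * 1 := mul_le_mul h1 h3 (by positivity) zero_le_one
        _ = 1 := one_mul 1
    have h1 : ENNReal.ofReal (∫ x in Metric.ball 0 l, ∑ i : Fin 2, v x i * divergence (g i) x)
        ≤ totalVariation v (Metric.ball 0 l) := le_iSup₂_of_le g htest le_rfl
    rw [integral_test_eq hΩ hv hg1] at h1
    have h2 := (ENNReal.ofReal_le_iff_le_toReal htop).mp h1
    have h3 : - ∫ x in Metric.ball 0 l, (fderiv ℝ v x (g 0 x) 0 + fderiv ℝ v x (g 1 x) 1)
        = (1 + 2 * ε)⁻¹ * ∫ x in Metric.ball 0 l,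
          η x * (fderiv ℝ v x (P x) 0 + fderiv ℝ v x (Q x) 1) := by
      rw [← integral_neg, ← integral_const_mul]
      refine integral_congr_ae (ae_of_all _ fun x => ?_)
      simp only [hg, map_smul, PiLp.smul_apply, smul_eq_mul, Matrix.cons_val_zero,
        Matrix.cons_val_one]
      ring
    rw [h3, inv_mul_le_iff₀ (by positivity)] at h2
    have hintW : IntegrableOn (fun x => fderiv ℝ v x (p x) 0 + fderiv ℝ v x (q x) 1)
        (Metric.ball 0 l) :=
      ((integrable_fderiv_apply hΩ hv hp hpc hps 0).add
        (integrable_fderiv_apply hΩ hv hq hqc hqs 1)).integrableOn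
    have hintG : IntegrableOn (fun x => η x * (fderiv ℝ v x (P x) 0 + fderiv ℝ v x (Q x) 1))
        (Metric.ball 0 l) := by
      have h4 := ((integrable_fderiv_apply hΩ hv (hg1 0).1.continuous (hg1 0).2.1 (hg1 0).2.2 0).add
        (integrable_fderiv_apply hΩ hv (hg1 1).1.continuous (hg1 1).2.1 (hg1 1).2.2 1)).const_mul
          (-(1 + 2 * ε))
      refine (h4.congr (ae_of_all _ fun x => ?_)).integrableOn
      simp only [hg, map_smul, PiLp.smul_apply, smul_eq_mul, Matrix.cons_val_zero,
        Matrix.cons_val_one, Pi.add_apply]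
      have : (1 + 2 * ε) ≠ 0 := by positivity
      field_simp
      ring
    have h5 : I - ∫ x in Metric.ball 0 l, η x * (fderiv ℝ v x (P x) 0 + fderiv ℝ v x (Q x) 1)
        ≤ 2 * ε * C := by
      rw [hI, ← integral_sub hintW hintG, hC, ← integral_const_mul]
      refine integral_mono (hintW.sub hintG) (hηint.integrableOn.const_mul _) fun x => ?_
      have e : fderiv ℝ v x (p x) 0 + fderiv ℝ v x (q x) 1
          - η x * (fderiv ℝ v x (P x) 0 + fderiv ℝ v x (Q x) 1)
          = η x * (fderiv ℝ v x (p x - P x) 0 + fderiv ℝ v x (q x - Q x) 1) := by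
        conv_lhs => rw [hsmul hp0 x, hsmul hq0 x]
        simp only [map_smul, map_sub, PiLp.smul_apply, PiLp.sub_apply, smul_eq_mul]
        ring
      simp only
      rw [e]
      have b1 := (le_abs_self _).trans (abs_apply_le (fderiv ℝ v x) (p x - P x) 0)
      have b2 := (le_abs_self _).trans (abs_apply_le (fderiv ℝ v x) (q x - Q x) 1)
      have d1 : ‖p x - P x‖ ≤ ε := by rw [← dist_eq_norm, dist_comm]; exact (hPd x).le
      have d2 : ‖q x - Q x‖ ≤ ε := by rw [← dist_eq_norm, dist_comm]; exact (hQd x).le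
      have b3 := mul_le_mul_of_nonneg_left d1 (norm_nonneg (fderiv ℝ v x))
      have b4 := mul_le_mul_of_nonneg_left d2 (norm_nonneg (fderiv ℝ v x))
      calc η x * (fderiv ℝ v x (p x - P x) 0 + fderiv ℝ v x (q x - Q x) 1)
          ≤ η x * (2 * ε * ‖fderiv ℝ v x‖) :=
            mul_le_mul_of_nonneg_left (by linarith) η.nonneg
        _ = 2 * ε * (η x * ‖fderiv ℝ v x‖) := by ring
    linarith
  have hlim : Tendsto (fun ε : ℝ => (1 + 2 * ε) * T + 2 * ε * C) (𝓝[>] 0) (𝓝 T) := by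
    have : Tendsto (fun ε : ℝ => (1 + 2 * ε) * T + 2 * ε * C) (𝓝 0)
        (𝓝 ((1 + 2 * 0) * T + 2 * 0 * C)) := by
      apply Continuous.tendsto
      fun_prop
    simp only [mul_zero, add_zero, one_mul, zero_mul] at this
    exact this.mono_left nhdsWithin_le_nhds
  have hIT : I ≤ T := ge_of_tendsto hlim (by
    filter_upwards [self_mem_nhdsWithin] with ε hε
    exact key ε hε)
  exact (ENNReal.ofReal_le_iff_le_toReal htop).mpr hIT

/-- The unit field in the angular direction, with the value `0` at the origin. -/
def angField (x : R2) : R2 := ‖x‖⁻¹ • !₂[-x 1, x 0]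

lemma norm_angField_le (x : R2) : ‖angField x‖ ≤ 1 := by
  have h : ‖(!₂[-x 1, x 0] : R2)‖ = ‖x‖ := by
    rw [← sq_eq_sq₀ (norm_nonneg _) (norm_nonneg _), norm_sq_R2, norm_sq_R2]
    simp; ring
  rw [angField, norm_smul, norm_inv, norm_norm, h]
  exact inv_mul_le_one

lemma angField_polar {r : ℝ} (hr : 0 < r) (θ : ℝ) : angField (polar r θ) = tang θ := by
  rw [angField, norm_polar, abs_of_pos hr]
  refine ext2 ?_ ?_
  · simp [tang, hr.ne']
  · simp [tang, hr.ne']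

lemma continuousOn_angField : ContinuousOn angField {0}ᶜ := by
  unfold angField
  refine ContinuousOn.smul
    (continuous_norm.continuousOn.inv₀ fun x hx => norm_ne_zero_iff.mpr hx) ?_
  exact Continuous.continuousOn (by fun_prop)

lemma measurable_fderiv_angField (v : R2 → R2) :
    Measurable (fun x => fderiv ℝ v x (angField x)) := by
  have h1 : Measurable angField := by
    unfold angField
    exact (measurable_norm.inv).smul (Continuous.measurable (by fun_prop))
  have e : (fun x => fderiv ℝ v x (angField x))
      = fun x => angField x 0 • fderiv ℝ v x e0 + angField x 1 • fderiv ℝ v x e1 :=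
    funext fun x => clm_apply _ _
  rw [e]
  have m0 := measurable_fderiv_apply_const ℝ v e0
  have m1 := measurable_fderiv_apply_const ℝ v e1
  fun_prop

/-- A continuous cutoff that is equal to one on most of the punctured disk of radius `l`. -/
def cutoff (l : ℝ) (n : ℕ) (x : R2) : ℝ := min 1 (max 0 (n * min ‖x‖ (l - ‖x‖) - 1))

lemma cutoff_nonneg (l : ℝ) (n : ℕ) (x : R2) : 0 ≤ cutoff l n x :=
  le_min zero_le_one (le_max_left _ _)

lemma cutoff_le_one (l : ℝ) (n : ℕ) (x : R2) : cutoff l n x ≤ 1 := min_le_left _ _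

lemma continuous_cutoff (l : ℝ) (n : ℕ) : Continuous (cutoff l n) := by
  unfold cutoff; fun_prop

lemma cutoff_eq_zero {l : ℝ} {n : ℕ} {x : R2} (h : n * min ‖x‖ (l - ‖x‖) ≤ 1) :
    cutoff l n x = 0 := by
  rw [cutoff, max_eq_left (by linarith), min_eq_right zero_le_one]

lemma tendsto_cutoff {l : ℝ} {x : R2} (hx : x ≠ 0) (hxl : ‖x‖ < l) :
    Tendsto (fun n => cutoff l n x) atTop (𝓝 1) := by
  have hpos : 0 < min ‖x‖ (l - ‖x‖) := lt_min (norm_pos_iff.mpr hx) (by linarith)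
  have h : ∀ᶠ n : ℕ in atTop, 2 ≤ n * min ‖x‖ (l - ‖x‖) :=
    (tendsto_natCast_atTop_atTop.atTop_mul_const hpos).eventually_ge_atTop 2
  refine tendsto_const_nhds.congr' ?_
  filter_upwards [h] with n hn
  rw [cutoff, max_eq_right (by linarith), min_eq_left (by linarith)]

/-- The integral of the angular derivative is bounded by the total variation. -/
lemma lintegral_angular_le_totalVariation {l : ℝ} (hl : 0 < l) {v : R2 → R2}
    (hv : ContDiffOn ℝ 1 v (Metric.ball 0 l)) :
    ∫⁻ x in Metric.ball 0 l, ‖fderiv ℝ v x (angField x)‖ₑ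
      ≤ totalVariation v (Metric.ball 0 l) := by
  have hΩ : IsOpen (Metric.ball (0 : R2) l) := Metric.isOpen_ball
  set U : Set R2 := Metric.ball 0 l ∩ {0}ᶜ with hU
  have hUo : IsOpen U := hΩ.inter isOpen_compl_singleton
  set F : R2 → R2 := fun x => fderiv ℝ v x (angField x) with hF
  have hFc : ContinuousOn F U :=
    ((hv.continuousOn_fderiv_of_isOpen hΩ le_rfl).mono inter_subset_left).clm_apply
      (continuousOn_angField.mono inter_subset_right)
  set k : ℕ → R2 → ℝ := fun n x => cutoff l n x * (((n : ℝ) + 1)⁻¹ + ‖F x‖)⁻¹ with hk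
  have hden : ∀ (n : ℕ) x, 0 < ((n : ℝ) + 1)⁻¹ + ‖F x‖ := fun n x => by positivity
  have hk0 : ∀ n x, 0 ≤ k n x := fun n x =>
    mul_nonneg (cutoff_nonneg _ _ _) (inv_nonneg.mpr (hden n x).le)
  -- Up to cutoff, `W n` pairs `Dv` with `F / (1 / (n + 1) + ‖F‖)` in the angular direction; the
  -- cutoff avoids the origin, where `angField` is discontinuous, and the boundary.
  set W : ℕ → Fin 2 → R2 → R2 := fun n i x => (k n x * F x i) • angField x with hW
  have hsupp : ∀ n i, tsupport (W n i) ⊆ U := by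
    intro n i
    have hcl : IsClosed {x : R2 | 1 ≤ n * min ‖x‖ (l - ‖x‖)} :=
      isClosed_le continuous_const (by fun_prop)
    refine (closure_minimal (fun x hx => ?_) hcl).trans fun x hx => ?_
    · by_contra h
      simp only [mem_ofPred_eq, not_le] at h
      refine hx ?_
      simp only [hW, hk]
      rw [cutoff_eq_zero h.le, zero_mul, zero_mul, zero_smul]
    · simp only [mem_ofPred_eq] at hx
      have hpos : 0 < min ‖x‖ (l - ‖x‖) := by
        by_contra h
        have : (n : ℝ) * min ‖x‖ (l - ‖x‖) ≤ 0 :=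
          mul_nonpos_of_nonneg_of_nonpos n.cast_nonneg (not_lt.mp h)
        linarith
      obtain ⟨h1, h2⟩ := lt_min_iff.mp hpos
      exact ⟨mem_ball_zero_iff.mpr (by linarith), norm_pos_iff.mp h1⟩
  have hWc : ∀ n i, Continuous (W n i) := by
    intro n i
    refine continuous_of_continuousOn_tsupport hUo ?_ (hsupp n i)
    have h1 : ContinuousOn (k n) U := (continuous_cutoff l n).continuousOn.mul
      ((continuousOn_const.add hFc.norm).inv₀ fun x _ => (hden n x).ne')
    have h2 : ContinuousOn (fun x => F x i) U :=
      (EuclideanSpace.proj i : R2 →L[ℝ] ℝ).continuous.comp_continuousOn hFc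
    exact (h1.mul h2).smul (continuousOn_angField.mono inter_subset_right)
  have hkF : ∀ n x, k n x * ‖F x‖ ≤ 1 := by
    intro n x
    have h1 : (((n : ℝ) + 1)⁻¹ + ‖F x‖)⁻¹ * ‖F x‖ ≤ 1 := by
      rw [inv_mul_le_iff₀ (hden n x), mul_one]
      have : 0 < ((n : ℝ) + 1)⁻¹ := by positivity
      linarith
    simp only [hk]
    rw [mul_assoc]
    exact mul_le_one₀ (cutoff_le_one _ _ _)
      (mul_nonneg (inv_nonneg.mpr (hden n x).le) (norm_nonneg _)) h1
  have hint : ∀ n, ∫⁻ x in Metric.ball 0 l, ENNReal.ofReal (k n x * ‖F x‖ ^ 2)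
      ≤ totalVariation v (Metric.ball 0 l) := by
    intro n
    have hpair : ∀ x, fderiv ℝ v x (W n 0 x) 0 + fderiv ℝ v x (W n 1 x) 1 = k n x * ‖F x‖ ^ 2 := by
      intro x
      simp only [hW, map_smul, PiLp.smul_apply, smul_eq_mul]
      rw [norm_sq_R2]
      simp only [hF]
      ring
    have hcs : ∀ i, HasCompactSupport (W n i) := fun i =>
      (isCompact_closedBall (0 : R2) l).of_isClosed_subset (isClosed_tsupport _)
        ((hsupp n i).trans (inter_subset_left.trans Metric.ball_subset_closedBall))
    have hs : ∀ i, tsupport (W n i) ⊆ Metric.ball 0 l := fun i =>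
      (hsupp n i).trans inter_subset_left
    have hI : IntegrableOn (fun x => k n x * ‖F x‖ ^ 2) (Metric.ball 0 l) := by
      refine Integrable.integrableOn ?_
      simp_rw [← hpair]
      exact (integrable_fderiv_apply hΩ hv (hWc n 0) (hcs 0) (hs 0) 0).add
        (integrable_fderiv_apply hΩ hv (hWc n 1) (hcs 1) (hs 1) 1)
    rw [← ofReal_integral_eq_lintegral_ofReal hI
      (ae_of_all _ fun x => mul_nonneg (hk0 n x) (sq_nonneg _))]
    simp_rw [← hpair]
    have hvan : ∀ i x, max (l / 2) (l - ((n : ℝ) + 1)⁻¹) ≤ ‖x‖ → W n i x = 0 := by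
      intro i x hx
      have h1 := (le_max_right _ _).trans hx
      simp only [hW, hk]
      rw [cutoff_eq_zero, zero_mul, zero_mul, zero_smul]
      have hn : (0:ℝ) < (n : ℝ) + 1 := by positivity
      have h2 : min ‖x‖ (l - ‖x‖) ≤ ((n : ℝ) + 1)⁻¹ := (min_le_right _ _).trans (by linarith)
      calc (n : ℝ) * min ‖x‖ (l - ‖x‖) ≤ n * ((n : ℝ) + 1)⁻¹ := by gcongr
        _ ≤ 1 := by rw [mul_inv_le_iff₀ hn]; linarith
    have hn : (0:ℝ) < ((n : ℝ) + 1)⁻¹ := by positivity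
    refine integral_continuous_test_le (ρ := max (l / 2) (l - ((n : ℝ) + 1)⁻¹))
      (lt_max_of_lt_left (by linarith)) (max_lt (by linarith) (by linarith)) hv (hWc n 0) (hWc n 1)
      (hvan 0) (hvan 1) fun x => ?_
    have h2 : ‖angField x‖ ^ 2 ≤ 1 := pow_le_one₀ (norm_nonneg _) (norm_angField_le x)
    have h3 : (k n x * ‖F x‖) ^ 2 ≤ 1 :=
      pow_le_one₀ (mul_nonneg (hk0 n x) (norm_nonneg _)) (hkF n x)
    simp only [hW]
    generalize k n x = κ at h3 ⊢
    generalize F x = y at h3 ⊢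
    simp only [norm_smul, mul_pow, Real.norm_eq_abs, sq_abs]
    calc κ ^ 2 * y 0 ^ 2 * ‖angField x‖ ^ 2 + κ ^ 2 * y 1 ^ 2 * ‖angField x‖ ^ 2
        = (κ * ‖y‖) ^ 2 * ‖angField x‖ ^ 2 := by rw [mul_pow κ, norm_sq_R2 y]; ring
      _ ≤ 1 := mul_le_one₀ h3 (sq_nonneg _) h2
  have hlim : ∀ x ∈ U, Tendsto (fun n => ENNReal.ofReal (k n x * ‖F x‖ ^ 2)) atTop
      (𝓝 ‖F x‖ₑ) := by
    intro x hx
    rw [← ofReal_norm]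
    refine ENNReal.tendsto_ofReal ?_
    rcases eq_or_ne ‖F x‖ 0 with h0 | h0
    · rw [h0]; simp
    have h1 : Tendsto (fun n : ℕ => ((n : ℝ) + 1)⁻¹) atTop (𝓝 0) := by
      simpa using tendsto_one_div_add_atTop_nhds_zero_nat (𝕜 := ℝ)
    have h2 := (((tendsto_cutoff (l := l) hx.2 (mem_ball_zero_iff.mp hx.1)).mul
      ((h1.add_const ‖F x‖).inv₀ (by rwa [zero_add]))).mul_const (‖F x‖ ^ 2))
    rw [zero_add, one_mul] at h2
    have e : ‖F x‖⁻¹ * ‖F x‖ ^ 2 = ‖F x‖ := by field_simp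
    rwa [e] at h2
  have hmeasU : ∀ᵐ x ∂volume.restrict (Metric.ball (0 : R2) l), x ∈ U := by
    have h0 : ∀ᵐ x : R2, x ≠ 0 := by
      rw [ae_iff]; simp
    filter_upwards [ae_restrict_mem hΩ.measurableSet, ae_restrict_of_ae h0] with x h1 h2
    exact ⟨h1, h2⟩
  have hFm : Measurable F := measurable_fderiv_angField v
  calc ∫⁻ x in Metric.ball 0 l, ‖F x‖ₑ
      = ∫⁻ x in Metric.ball 0 l, liminf (fun n => ENNReal.ofReal (k n x * ‖F x‖ ^ 2)) atTop := by
        refine lintegral_congr_ae ?_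
        filter_upwards [hmeasU] with x hx
        exact (hlim x hx).liminf_eq.symm
    _ ≤ liminf (fun n => ∫⁻ x in Metric.ball 0 l, ENNReal.ofReal (k n x * ‖F x‖ ^ 2)) atTop := by
        refine lintegral_liminf_le fun n => ?_
        have := (continuous_cutoff l n).measurable
        simp only [hk]
        fun_prop
    _ ≤ totalVariation v (Metric.ball 0 l) :=
        liminf_le_of_le (by isBoundedDefault) fun b hb => by
          obtain ⟨n, hn⟩ := hb.exists
          exact hn.trans (hint n)

end Tangential

/-! ### Total variation of homogeneous maps from below -/

section Homogeneous

lemma periodic_argR_polar {X : Type*} {f : ℝ → X} (hf : Function.Periodic f (2 * Real.pi)) {r : ℝ}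
    (hr : 0 < r) (θ : ℝ) : f (argR (polar r θ)) = f θ := by
  have h : circ (argR (polar r θ)) = circ θ := dirc_polar hr θ
  rw [← periodic_angle hf, h, periodic_angle hf]

/-- A periodic `C¹` function of the polar angle is `C¹` away from the origin. -/
lemma contDiffAt_comp_argR {f : ℝ → R2} (hf : ContDiff ℝ 1 f)
    (hp : Function.Periodic f (2 * Real.pi)) {x : R2} (hx : x ≠ 0) :
    ContDiffAt ℝ 1 (fun x => f (argR x)) x := by
  have hlin : ContDiff ℝ 1 (fun x : R2 => (x 0 : ℂ) + x 1 * Complex.I) := by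
    have h : ∀ i : Fin 2, ContDiff ℝ 1 (fun x : R2 => (x i : ℂ)) := fun i =>
      Complex.ofRealCLM.contDiff.comp (EuclideanSpace.proj i : R2 →L[ℝ] ℝ).contDiff
    exact (h 0).add ((h 1).mul contDiff_const)
  have harg : ∀ x : R2, argR x = Complex.arg ((x 0 : ℂ) + x 1 * Complex.I) := fun x => by
    rw [argR]; congr 1; exact Complex.mk_eq_add_mul_I _ _
  have hslit : ∀ z : ℂ, z ∈ Complex.slitPlane → ContDiffAt ℝ 1 Complex.arg z := fun z hz => by
    have h1 : ContDiffAt ℝ 1 Complex.log z := (Complex.contDiffAt_log hz).restrict_scalars ℝ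
    exact (Complex.imCLM.contDiff.contDiffAt.comp z h1).congr_of_eventuallyEq
      (Eventually.of_forall fun w => (Complex.log_im w).symm)
  set z : ℂ := (x 0 : ℂ) + x 1 * Complex.I with hz
  by_cases hsz : z ∈ Complex.slitPlane
  · have h1 : ContDiffAt ℝ 1 (fun x : R2 => Complex.arg ((x 0 : ℂ) + x 1 * Complex.I)) x :=
      ContDiffAt.comp (f := fun x : R2 => (x 0 : ℂ) + x 1 * Complex.I) x (hslit z hsz)
        hlin.contDiffAt
    simp_rw [harg]
    exact hf.contDiffAt.comp x h1
  · -- On the negative half-axis the angle is measured from the opposite direction.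
    have hz0 : z ≠ 0 := fun h => hx (ext2
      (by simpa [hz] using congrArg Complex.re h) (by simpa [hz] using congrArg Complex.im h))
    have hnz : -z ∈ Complex.slitPlane := by
      rw [Complex.mem_slitPlane_iff] at hsz ⊢
      push Not at hsz
      have : z.re ≠ 0 := fun h => hz0 (Complex.ext h hsz.2)
      exact Or.inl (by rw [Complex.neg_re]; have := lt_of_le_of_ne hsz.1 this; linarith)
    have hneg : ∀ w : ℂ, w ≠ 0 → f (Complex.arg w) = f (Complex.arg (-w) + Real.pi) := by
      intro w hw
      have h1 := Complex.arg_neg_coe_angle hw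
      have h2 : ((Complex.arg (-w) + Real.pi : ℝ) : Real.Angle) = (Complex.arg w : Real.Angle) := by
        rw [Real.Angle.coe_add, h1, add_assoc, Real.Angle.coe_pi_add_coe_pi, add_zero]
      obtain ⟨k, hk⟩ := Real.Angle.angle_eq_iff_two_pi_dvd_sub.mp h2
      have h3 : Complex.arg (-w) + Real.pi = Complex.arg w + k * (2 * Real.pi) := by linarith
      rw [h3, (hp.int_mul k) _]
    have hcd : ContDiffAt ℝ 1 (fun x : R2 =>
        f (Complex.arg (-((x 0 : ℂ) + x 1 * Complex.I)) + Real.pi)) x :=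
      hf.contDiffAt.comp x
        (((hslit (-z) hnz).comp x hlin.neg.contDiffAt).add contDiffAt_const)
    refine hcd.congr_of_eventuallyEq ?_
    filter_upwards [hlin.continuous.continuousAt.eventually_ne hz0] with y hy
    rw [harg, hneg _ hy]

lemma contDiffAt_angField {x : R2} (hx : x ≠ 0) : ContDiffAt ℝ 1 angField x := by
  have h1 : ContDiffAt ℝ 1 (fun x : R2 => ‖x‖⁻¹) x :=
    (contDiffAt_norm ℝ hx).inv (norm_ne_zero_iff.mpr hx)
  have h2 : ContDiff ℝ 1 (fun x : R2 => (!₂[-x 1, x 0] : R2)) := by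
    refine contDiff_euclidean.mpr fun i => ?_
    fin_cases i
    · exact (EuclideanSpace.proj 1 : R2 →L[ℝ] ℝ).contDiff.neg
    · exact (EuclideanSpace.proj 0 : R2 →L[ℝ] ℝ).contDiff
  exact h1.smul h2.contDiffAt

lemma hasDerivAt_polar_radial (r θ : ℝ) :
    HasDerivAt (fun s => polar s θ) (circ θ : R2) r := by
  simp_rw [polar_eq_smul]
  simpa using (hasDerivAt_id r).smul_const (circ θ : R2)

lemma hasDerivAt_tang (θ : ℝ) : HasDerivAt tang (-(circ θ : R2)) θ := by
  have h : HasDerivAt (fun θ => (-Real.sin θ) • e0 + Real.cos θ • e1)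
      ((-Real.cos θ) • e0 + (-Real.sin θ) • e1) θ :=
    ((Real.hasDerivAt_sin θ).neg.smul_const e0).add ((Real.hasDerivAt_cos θ).smul_const e1)
  have e : tang = fun θ => (-Real.sin θ) • e0 + Real.cos θ • e1 :=
    funext fun θ => (eq_smul_add (tang θ))
  have e' : -(circ θ : R2) = (-Real.cos θ) • e0 + (-Real.sin θ) • e1 :=
    (eq_smul_add _)
  rw [e, e']
  exact h

/-- The divergence of an angular field whose size is a product in polar coordinates. -/
lemma divergence_angular {W : R2 → R2} {χ h : ℝ → ℝ} {r θ χ' h' : ℝ} (hr : 0 < r)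
    (hW : DifferentiableAt ℝ W (polar r θ)) (hχ : HasDerivAt χ χ' r) (hh : HasDerivAt h h' θ)
    (hform : ∀ s > 0, ∀ t, W (polar s t) = (χ s * h t) • tang t) :
    divergence W (polar r θ) = χ r * h' / r := by
  set A := fderiv ℝ W (polar r θ) with hA
  have hν : A (circ θ) = (χ' * h θ) • tang θ := by
    have h1 := HasFDerivAt.comp_hasDerivAt (f := fun s => polar s θ) r hW.hasFDerivAt
      (hasDerivAt_polar_radial r θ)
    have h2 : HasDerivAt (fun s => (χ s * h θ) • tang θ) ((χ' * h θ) • tang θ) r :=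
      (hχ.mul_const (h θ)).smul_const (tang θ)
    refine (h1.congr_of_eventuallyEq ?_).unique h2
    filter_upwards [Ioi_mem_nhds hr] with s hs
    exact (hform s hs θ).symm
  have hτ : r • A (tang θ) = (χ r * h θ) • (-(circ θ : R2)) + (χ r * h') • tang θ := by
    rw [← map_smul]
    have h1 := HasFDerivAt.comp_hasDerivAt (f := fun t => polar r t) θ hW.hasFDerivAt
      (hasDerivAt_polar r θ)
    have h2 := (hh.const_mul (χ r)).smul (hasDerivAt_tang θ)
    refine (h1.congr_of_eventuallyEq ?_).unique h2
    exact Eventually.of_forall fun t => (hform r hr t).symm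
  have e0' : A e0 = Real.cos θ • A (circ θ) - Real.sin θ • A (tang θ) := by
    rw [clm_apply A (circ θ), clm_apply A (tang θ)]
    refine ext2 ?_ ?_ <;> simp [tang]
    · linear_combination (-(A e0 0)) * Real.sin_sq_add_cos_sq θ
    · linear_combination (-(A e0 1)) * Real.sin_sq_add_cos_sq θ
  have e1' : A e1 = Real.sin θ • A (circ θ) + Real.cos θ • A (tang θ) := by
    rw [clm_apply A (circ θ), clm_apply A (tang θ)]
    refine ext2 ?_ ?_ <;> simp [tang]
    · linear_combination (-(A e1 0)) * Real.sin_sq_add_cos_sq θ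
    · linear_combination (-(A e1 1)) * Real.sin_sq_add_cos_sq θ
  have hdiv : divergence W (polar r θ) = A e0 0 + A e1 1 := by
    rw [divergence, Fin.sum_univ_two]
  have c0 := congrArg (fun y : R2 => y 0) hτ
  have c1 := congrArg (fun y : R2 => y 1) hτ
  simp only [PiLp.smul_apply, PiLp.add_apply, PiLp.neg_apply, smul_eq_mul, circ_zero, circ_one,
    tang, Matrix.cons_val_zero, Matrix.cons_val_one] at c0 c1
  rw [hdiv, e0', e1', hν, eq_div_iff hr.ne']
  simp only [PiLp.smul_apply, PiLp.add_apply, PiLp.sub_apply, smul_eq_mul, tang,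
    Matrix.cons_val_zero, Matrix.cons_val_one]
  linear_combination (-Real.sin θ) * c0 + Real.cos θ * c1
    + χ r * h' * (Real.sin_sq_add_cos_sq θ)

/-- A radial cutoff times a test function on the circle yields a test field on the disk. -/
lemma ofReal_mul_le_totalVariation {l ε : ℝ} (hε : 0 < ε) (hεl : 4 * ε < l) {γ : S1 → R2}
    {u : R2 → R2} (hu : u =ᵐ[volume.restrict (Metric.ball 0 l)] homExt γ) {f : ℝ → R2}
    (hf : ContDiff ℝ 1 f) (hp : Function.Periodic f (2 * Real.pi)) (hf1 : ∀ θ, ‖f θ‖ ≤ 1)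
    (hJ : 0 ≤ ∫ θ in Ioc 0 (2 * Real.pi), inner ℝ (γ (circ θ)) (deriv f θ)) :
    ENNReal.ofReal ((l - 4 * ε) *
        ∫ θ in Ioc 0 (2 * Real.pi), inner ℝ (γ (circ θ)) (deriv f θ))
      ≤ totalVariation u (Metric.ball 0 l) := by
  let χ : ContDiffBump (l / 2 : ℝ) := ⟨l / 2 - 2 * ε, l / 2 - ε, by linarith, by linarith⟩
  have hχ0 : ∀ r, l / 2 - ε ≤ |r - l / 2| → χ r = 0 := fun r hr => χ.zero_of_le_dist hr
  set W : Fin 2 → R2 → R2 := fun i x => (χ ‖x‖ * f (argR x) i) • angField x with hW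
  have hnear : ∀ i (x : R2), ‖x‖ < ε → W i x = 0 := fun i x hx => by
    simp only [hW]
    rw [hχ0, zero_mul, zero_smul]
    rw [abs_sub_comm]
    refine le_trans ?_ (le_abs_self _)
    linarith
  have hfar : ∀ i (x : R2), l - ε < ‖x‖ → W i x = 0 := fun i x hx => by
    simp only [hW]
    rw [hχ0, zero_mul, zero_smul]
    refine le_trans ?_ (le_abs_self _)
    linarith
  have hWc : ∀ i, ContDiff ℝ 1 (W i) := fun i => contDiff_iff_contDiffAt.mpr fun x => by
    rcases eq_or_ne x 0 with rfl | hx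
    · refine (contDiffAt_const (c := (0 : R2))).congr_of_eventuallyEq ?_
      filter_upwards [Metric.ball_mem_nhds (0 : R2) hε] with y hy
      exact hnear i y (mem_ball_zero_iff.mp hy)
    · have h1 : ContDiffAt ℝ 1 (fun x : R2 => χ ‖x‖) x :=
        χ.contDiff.contDiffAt.comp x (contDiffAt_norm ℝ hx)
      have h2 : ContDiffAt ℝ 1 (fun x : R2 => f (argR x) i) x :=
        (EuclideanSpace.proj i : R2 →L[ℝ] ℝ).contDiff.contDiffAt.comp x
          (contDiffAt_comp_argR hf hp hx)
      exact (h1.mul h2).smul (contDiffAt_angField hx)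
  have hsub : ∀ i, tsupport (W i) ⊆ Metric.closedBall 0 (l - ε) := fun i =>
    closure_minimal (fun x hx => by
      rw [mem_closedBall_zero_iff]
      by_contra h
      exact hx (hfar i x (not_le.mp h))) Metric.isClosed_closedBall
  have hsubl : ∀ i, tsupport (W i) ⊆ Metric.ball 0 l := fun i =>
    (hsub i).trans (Metric.closedBall_subset_ball (by linarith))
  have htest : IsTestField (Metric.ball 0 l) W := by
    refine ⟨fun i => ⟨hWc i, ?_, hsubl i⟩, fun x => ?_⟩
    · exact (isCompact_closedBall (0 : R2) (l - ε)).of_isClosed_subset (isClosed_tsupport _)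
        (hsub i)
    · rw [Fin.sum_univ_two]
      simp only [hW, norm_smul, mul_pow, Real.norm_eq_abs, sq_abs]
      have h2 : ‖angField x‖ ^ 2 ≤ 1 := pow_le_one₀ (norm_nonneg _) (norm_angField_le x)
      have h3 : χ ‖x‖ ^ 2 ≤ 1 := pow_le_one₀ χ.nonneg χ.le_one
      have h4 : ‖f (argR x)‖ ^ 2 ≤ 1 := pow_le_one₀ (norm_nonneg _) (hf1 _)
      calc χ ‖x‖ ^ 2 * f (argR x) 0 ^ 2 * ‖angField x‖ ^ 2
            + χ ‖x‖ ^ 2 * f (argR x) 1 ^ 2 * ‖angField x‖ ^ 2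
          = χ ‖x‖ ^ 2 * ‖f (argR x)‖ ^ 2 * ‖angField x‖ ^ 2 := by
            rw [norm_sq_R2 (f (argR x))]; ring
        _ ≤ 1 := mul_le_one₀ (mul_le_one₀ h3 (sq_nonneg _) h4) (sq_nonneg _) h2
  have hdiv : ∀ i, ∀ r > 0, ∀ θ, divergence (W i) (polar r θ) = χ r * (deriv f θ i) / r := by
    intro i r hr θ
    have hd : HasDerivAt (fun t => f t i) (deriv f θ i) θ :=
      HasFDerivAt.comp_hasDerivAt (f := f) θ (EuclideanSpace.proj i : R2 →L[ℝ] ℝ).hasFDerivAt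
        (hf.differentiable one_ne_zero θ).hasDerivAt
    have hχd : HasDerivAt χ (deriv χ r) r :=
      ((χ.contDiff (n := 1)).differentiable one_ne_zero r).hasDerivAt
    refine divergence_angular hr ((hWc i).differentiable one_ne_zero _) hχd hd fun s hs t => ?_
    simp only [hW]
    rw [norm_polar, abs_of_pos hs, periodic_argR_polar hp hs, angField_polar hs]
  have hmain : ∫ x in Metric.ball 0 l, ∑ i : Fin 2, u x i * divergence (W i) x
      = (∫ r in Ioi (0 : ℝ), χ r) *
        ∫ θ in Ioc 0 (2 * Real.pi), inner ℝ (γ (circ θ)) (deriv f θ) := by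
    have h0 : ∫ x in Metric.ball 0 l, ∑ i : Fin 2, u x i * divergence (W i) x
        = ∫ x, ∑ i : Fin 2, homExt γ x i * divergence (W i) x := by
      rw [← setIntegral_eq_integral_of_forall_compl_eq_zero (s := Metric.ball (0 : R2) l)
        (f := fun x => ∑ i : Fin 2, homExt γ x i * divergence (W i) x)]
      · refine integral_congr_ae ?_
        filter_upwards [hu] with x hx
        rw [hx]
      · intro x hx
        refine Finset.sum_eq_zero fun i _ => ?_
        have h0 : divergence (W i) x = 0 := by
          by_contra h
          exact hx (hsubl i (support_divergence_subset _ h))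
        rw [h0, mul_zero]
    rw [h0, integral_polar]
    have h1 : ∀ p ∈ Ioi (0 : ℝ) ×ˢ Ioo (-Real.pi) Real.pi,
        p.1 * ∑ i : Fin 2, homExt γ (polar p.1 p.2) i * divergence (W i) (polar p.1 p.2)
          = χ p.1 * inner ℝ (γ (circ p.2)) (deriv f p.2) := by
      rintro ⟨r, θ⟩ ⟨hr, -⟩
      have hr' : 0 < r := hr
      rw [homExt_of_ne (polar_ne_zero hr' θ), dirc_polar hr', Fin.sum_univ_two, hdiv 0 r hr',
        hdiv 1 r hr', PiLp.inner_apply, Fin.sum_univ_two]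
      simp only [RCLike.inner_apply, conj_trivial]
      field_simp
    rw [setIntegral_congr_fun (measurableSet_Ioi.prod measurableSet_Ioo) h1,
      Measure.volume_eq_prod, ← Measure.prod_restrict,
      integral_prod_mul (fun r => χ r) (fun θ => inner ℝ (γ (circ θ)) (deriv f θ))]
    congr 1
    have hper : Function.Periodic (fun θ => inner ℝ (γ (circ θ)) (deriv f θ)) (2 * Real.pi) := by
      intro θ
      simp only
      rw [circ_periodic, ← deriv_comp_add_const, funext hp]
    have h2 := hper.intervalIntegral_add_eq (-Real.pi) 0
    rw [intervalIntegral.integral_of_le (by linarith [Real.pi_pos]),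
      intervalIntegral.integral_of_le (by linarith [Real.pi_pos]), zero_add] at h2
    rw [← h2, ← integral_Ioc_eq_integral_Ioo]
    congr 2
    ring_nf
  have hχint : l - 4 * ε ≤ ∫ r in Ioi (0 : ℝ), χ r := by
    have hi : IntegrableOn χ (Ioi 0) :=
      (χ.continuous.integrable_of_hasCompactSupport χ.hasCompactSupport).integrableOn
    have h1 : ∫ r in Icc (2 * ε) (l - 2 * ε), (1 : ℝ) ≤ ∫ r in Icc (2 * ε) (l - 2 * ε), χ r := by
      have hsubI : Icc (2 * ε) (l - 2 * ε) ⊆ Ioi 0 := fun r hr => by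
        have := hr.1
        exact lt_of_lt_of_le (by positivity) this
      refine setIntegral_mono_on (by simp) (hi.mono_set hsubI) measurableSet_Icc fun r hr => ?_
      refine (χ.one_of_mem_closedBall ?_).ge
      rw [mem_closedBall_iff_norm, Real.norm_eq_abs]
      change |r - l / 2| ≤ l / 2 - 2 * ε
      rw [abs_le]
      constructor <;> linarith [hr.1, hr.2]
    have h2 : ∫ r in Icc (2 * ε) (l - 2 * ε), χ r ≤ ∫ r in Ioi (0 : ℝ), χ r := by
      refine setIntegral_mono_set hi (ae_of_all _ fun r => χ.nonneg) (Eventually.of_forall ?_)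
      intro r hr
      have := hr.1
      exact lt_of_lt_of_le (by positivity) this
    rw [setIntegral_const, Measure.real, Real.volume_Icc, ENNReal.toReal_ofReal (by linarith),
      smul_eq_mul, mul_one] at h1
    linarith
  refine le_trans ?_ (le_iSup₂_of_le (f := fun g (_ : IsTestField (Metric.ball 0 l) g) =>
    ENNReal.ofReal (∫ x in Metric.ball 0 l, ∑ i : Fin 2, u x i * divergence (g i) x))
      W htest le_rfl)
  rw [hmain]
  exact ENNReal.ofReal_le_ofReal (mul_le_mul_of_nonneg_right hχint hJ)

/-- The total variation of the homogeneous extension on the disk of radius `l` is at least `l`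
times the total variation of the curve. -/
lemma mul_circleVariation_le_totalVariation {l : ℝ} (hl : 0 < l) {γ : S1 → R2} {u : R2 → R2}
    (hu : u =ᵐ[volume.restrict (Metric.ball 0 l)] homExt γ) :
    ENNReal.ofReal l * circleVariation γ ≤ totalVariation u (Metric.ball 0 l) := by
  unfold circleVariation
  simp_rw [ENNReal.mul_iSup]
  refine iSup₂_le fun f hf => ?_
  set J := ∫ θ in Ioc 0 (2 * Real.pi), inner ℝ (γ (circ θ)) (deriv f θ) with hJ
  rcases le_total J 0 with h0 | h0
  · rw [ENNReal.ofReal_of_nonpos h0, mul_zero]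
    exact zero_le
  rw [← ENNReal.ofReal_mul hl.le]
  have hlim : Tendsto (fun ε : ℝ => ENNReal.ofReal ((l - 4 * ε) * J)) (𝓝[>] 0)
      (𝓝 (ENNReal.ofReal (l * J))) := by
    refine ENNReal.tendsto_ofReal ?_
    have : Tendsto (fun ε : ℝ => (l - 4 * ε) * J) (𝓝 0) (𝓝 ((l - 4 * 0) * J)) := by
      apply Continuous.tendsto
      fun_prop
    rw [mul_zero, sub_zero] at this
    exact this.mono_left nhdsWithin_le_nhds
  refine le_of_tendsto hlim ?_
  filter_upwards [Ioo_mem_nhdsGT (show (0:ℝ) < l / 4 by positivity)] with ε hε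
  exact ofReal_mul_le_totalVariation hε.1 (by linarith [hε.2]) hu hf.1 hf.2.1 hf.2.2 h0

end Homogeneous

/-! ### Smooth approximation of homogeneous maps -/

section Recovery

/-- The convolution of a Lipschitz map with a smooth kernel has the mollified gradient. -/
lemma hasFDerivAt_normed_convolution {w : R2 → R2} {K : NNReal} (hw : LipschitzWith K w)
    (b : ContDiffBump (0 : R2)) (x : R2) :
    HasFDerivAt (convolution (b.normed volume) w (ContinuousLinearMap.lsmul ℝ ℝ) volume)
      (convolution (b.normed volume) (fderiv ℝ w) (ContinuousLinearMap.lsmul ℝ ℝ) volume x) x ∧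
    ‖convolution (b.normed volume) (fderiv ℝ w) (ContinuousLinearMap.lsmul ℝ ℝ) volume x‖ ≤ K := by
  have hbi : Integrable (fun t => b.normed volume t * (K : ℝ)) := b.integrable_normed.mul_const _
  have hbn : ∀ t, 0 ≤ b.normed volume t := fun t => b.nonneg_normed t
  have hDm : Measurable (fderiv ℝ w) := measurable_fderiv ℝ w
  have hDsub : Measurable (fun t => fderiv ℝ w (x - t)) :=
    hDm.comp (measurable_const.sub measurable_id)
  constructor
  · have key := hasFDerivAt_integral_of_dominated_loc_of_lip (μ := (volume : Measure R2)) (𝕜 := ℝ)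
      (F := fun x t => b.normed volume t • w (x - t))
      (F' := fun t => b.normed volume t • fderiv ℝ w (x - t)) (x₀ := x) (s := univ)
      (bound := fun t => b.normed volume t * K) univ_mem
      (Eventually.of_forall fun y => ?_) ?_ ?_ (ae_of_all _ fun t => ?_) hbi ?_
    · exact key.2
    · exact (b.continuous_normed.smul
        (hw.continuous.comp (continuous_const.sub continuous_id))).aestronglyMeasurable
    · refine Continuous.integrable_of_hasCompactSupport (b.continuous_normed.smul
        (hw.continuous.comp (continuous_const.sub continuous_id))) ?_
      exact b.hasCompactSupport_normed.mono fun t ht => by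
        rw [Function.mem_support] at ht ⊢
        exact fun h => ht (by rw [h, zero_smul])
    · exact b.continuous_normed.aestronglyMeasurable.smul hDsub.aestronglyMeasurable
    · refine LipschitzOnWith.of_dist_le_mul fun y _ z _ => ?_
      rw [dist_smul₀, Real.norm_of_nonneg (hbn t), Real.coe_nnabs,
        abs_of_nonneg (mul_nonneg (hbn t) K.coe_nonneg), mul_assoc]
      refine mul_le_mul_of_nonneg_left ?_ (hbn t)
      refine (hw.dist_le_mul _ _).trans_eq ?_
      rw [dist_sub_right]
    · have h1 := (Measure.measurePreserving_sub_left (volume : Measure R2)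
        x).quasiMeasurePreserving.ae (hw.ae_differentiableAt (μ := volume))
      filter_upwards [h1] with t ht
      have h2 := ht.hasFDerivAt.comp x ((hasFDerivAt_id x).sub_const t)
      exact h2.const_smul (b.normed volume t)
  · refine (norm_integral_le_of_norm_le hbi (ae_of_all _ fun t => ?_)).trans_eq ?_
    · rw [ContinuousLinearMap.lsmul_apply, norm_smul, Real.norm_of_nonneg (hbn t)]
      exact mul_le_mul_of_nonneg_left (norm_fderiv_le_of_lipschitz ℝ hw) (hbn t)
    · rw [integral_mul_const, b.integral_normed, one_mul]

lemma tendsto_lintegral_comp_fderiv {Φ : (R2 →L[ℝ] R2) → ℝ} (hΦ : Continuous Φ) {w : R2 → R2}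
    {K : NNReal} {v : ℕ → R2 → R2} (hv : ∀ n x, ‖fderiv ℝ (v n) x‖ ≤ K)
    (hlim : ∀ᵐ x, Tendsto (fun n => fderiv ℝ (v n) x) atTop (𝓝 (fderiv ℝ w x))) (l : ℝ) :
    Tendsto (fun n => ∫⁻ x in Metric.ball 0 l, ENNReal.ofReal (Φ (fderiv ℝ (v n) x))) atTop
      (𝓝 (∫⁻ x in Metric.ball 0 l, ENNReal.ofReal (Φ (fderiv ℝ w x)))) := by
  have : ProperSpace (R2 →L[ℝ] R2) := FiniteDimensional.proper ℝ _
  obtain ⟨C, hC⟩ := (isCompact_closedBall (0 : R2 →L[ℝ] R2) K).bddAbove_image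
    (f := Φ) hΦ.continuousOn
  refine tendsto_lintegral_of_dominated_convergence (fun _ => ENNReal.ofReal C) (fun n => ?_)
    (fun n => ae_of_all _ fun x => ?_) ?_ (ae_restrict_of_ae ?_)
  · exact ENNReal.measurable_ofReal.comp (hΦ.measurable.comp (measurable_fderiv ℝ (v n)))
  · exact ENNReal.ofReal_le_ofReal (hC ⟨_, mem_closedBall_zero_iff.mpr (hv n x), rfl⟩)
  · rw [lintegral_const, Measure.restrict_apply_univ]
    exact ENNReal.mul_ne_top ENNReal.ofReal_ne_top measure_ball_lt_top.ne
  · filter_upwards [hlim] with x hx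
    exact ENNReal.tendsto_ofReal ((hΦ.tendsto _).comp hx)

/-- A Lipschitz map is approximated by smooth maps uniformly and in energy. -/
lemma exists_contDiff_approx {w : R2 → R2} {K : NNReal} (hw : LipschitzWith K w) (l : ℝ) {δ : ℝ}
    (hδ : 0 < δ) :
    ∃ v : R2 → R2, ContDiff ℝ 1 v ∧ (∀ x, dist (v x) (w x) ≤ δ) ∧
      tvJ v (Metric.ball 0 l) ≤ tvJ w (Metric.ball 0 l) + ENNReal.ofReal δ ∧
      ∫⁻ x in Metric.ball 0 l, ENNReal.ofReal (frob (fderiv ℝ v x))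
        ≤ (∫⁻ x in Metric.ball 0 l, ENNReal.ofReal (frob (fderiv ℝ w x))) + ENNReal.ofReal δ := by
  let b : ℕ → ContDiffBump (0 : R2) := fun n =>
    ⟨1 / ((n : ℝ) + 1) / 2, 1 / ((n : ℝ) + 1), by positivity, half_lt_self (by positivity)⟩
  set v : ℕ → R2 → R2 := fun n =>
    convolution ((b n).normed volume) w (ContinuousLinearMap.lsmul ℝ ℝ) volume with hv
  have hvd : ∀ n x, fderiv ℝ (v n) x =
      convolution ((b n).normed volume) (fderiv ℝ w) (ContinuousLinearMap.lsmul ℝ ℝ) volume x :=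
    fun n x => (hasFDerivAt_normed_convolution hw (b n) x).1.fderiv
  have hvK : ∀ n x, ‖fderiv ℝ (v n) x‖ ≤ K := fun n x => by
    rw [hvd]; exact (hasFDerivAt_normed_convolution hw (b n) x).2
  have hvc : ∀ n, ContDiff ℝ 1 (v n) := fun n =>
    (b n).hasCompactSupport_normed.contDiff_convolution_left (n := 1) _ (b n).contDiff_normed
      hw.continuous.locallyIntegrable
  have hDint : LocallyIntegrable (fderiv ℝ w) := by
    refine (locallyIntegrable_const (K : ℝ)).mono (measurable_fderiv ℝ w).aestronglyMeasurable
      (ae_of_all _ fun x => ?_)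
    rw [Real.norm_of_nonneg K.coe_nonneg]
    exact norm_fderiv_le_of_lipschitz ℝ hw
  have hlim : ∀ᵐ x, Tendsto (fun n => fderiv ℝ (v n) x) atTop (𝓝 (fderiv ℝ w x)) := by
    have h := ContDiffBump.ae_convolution_tendsto_right_of_locallyIntegrable (φ := b)
      (l := atTop) (K := 2) (μ := (volume : Measure R2)) tendsto_one_div_add_atTop_nhds_zero_nat
      (Eventually.of_forall fun n => by
        change 1 / ((n : ℝ) + 1) ≤ 2 * (1 / ((n : ℝ) + 1) / 2)
        linarith) hDint
    simp_rw [hvd]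
    exact h
  have hdist : ∀ n x, dist (v n x) (w x) ≤ K * (1 / ((n : ℝ) + 1)) := fun n x =>
    (b n).dist_normed_convolution_le hw.continuous.aestronglyMeasurable fun y hy =>
      (hw.dist_le_mul y x).trans
        (mul_le_mul_of_nonneg_left (Metric.mem_ball.mp hy).le K.coe_nonneg)
  have hdist0 : Tendsto (fun n : ℕ => (K : ℝ) * (1 / ((n : ℝ) + 1))) atTop (𝓝 0) := by
    simpa using tendsto_one_div_add_atTop_nhds_zero_nat.const_mul (K : ℝ)
  have hev : ∀ {Φ : (R2 →L[ℝ] R2) → ℝ}, Continuous Φ → ∀ᶠ n in atTop,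
      ∫⁻ x in Metric.ball 0 l, ENNReal.ofReal (Φ (fderiv ℝ (v n) x))
        ≤ (∫⁻ x in Metric.ball 0 l, ENNReal.ofReal (Φ (fderiv ℝ w x))) + ENNReal.ofReal δ := by
    intro Φ hΦ
    have h1 := tendsto_lintegral_comp_fderiv hΦ hvK hlim l
    rcases eq_or_ne (∫⁻ x in Metric.ball 0 l, ENNReal.ofReal (Φ (fderiv ℝ w x))) ∞ with h0 | h0
    · rw [h0, top_add]; exact Eventually.of_forall fun _ => le_top
    · exact (h1.eventually_lt_const (ENNReal.lt_add_right h0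
        (ENNReal.ofReal_pos.mpr hδ).ne')).mono fun _ h => h.le
  obtain ⟨n, hn1, hn2, hn3⟩ := ((hdist0.eventually_lt_const hδ).and
    ((hev continuous_det.abs).and (hev continuous_frob))).exists
  exact ⟨v n, hvc n, fun x => (hdist n x).trans hn1.le, hn2, hn3⟩

/-- The gradient of a `0`-homogeneous map is given by the derivative along the circle. -/
lemma frob_fderiv_le_of_homogeneous {W : R2 → R2} {Ψ : ℝ → R2} {ε : ℝ} (hε : 0 < ε)
    (hW : ∀ r > ε, ∀ θ, W (polar r θ) = Ψ θ) {r : ℝ} (hr : ε < r) (θ : ℝ) :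
    r * frob (fderiv ℝ W (polar r θ)) ≤ ‖deriv Ψ θ‖ := by
  have hr0 : 0 < r := hε.trans hr
  by_cases hd : DifferentiableAt ℝ W (polar r θ)
  swap
  · rw [fderiv_zero_of_not_differentiableAt hd]
    simp [frob]
  set A := fderiv ℝ W (polar r θ) with hA
  -- `W` is constant along rays, so its radial derivative vanishes.
  have hν : A (circ θ) = 0 := by
    have h1 := HasFDerivAt.comp_hasDerivAt (f := fun s => polar s θ) r hd.hasFDerivAt
      (hasDerivAt_polar_radial r θ)
    refine (h1.congr_of_eventuallyEq (f₁ := fun _ => Ψ θ) ?_).unique (hasDerivAt_const r (Ψ θ))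
    filter_upwards [Ioi_mem_nhds hr] with s hs
    exact (hW s hs θ).symm
  have hτ : deriv Ψ θ = r • A (tang θ) := by
    rw [← map_smul]
    have h1 := HasFDerivAt.comp_hasDerivAt (f := fun t => polar r t) θ hd.hasFDerivAt
      (hasDerivAt_polar r θ)
    refine (h1.congr_of_eventuallyEq (f₁ := Ψ) ?_).deriv
    exact Eventually.of_forall fun t => (hW r hr t).symm
  have e0' : A e0 = (-Real.sin θ) • A (tang θ) := by
    have h : (e0 : R2) = Real.cos θ • (circ θ : R2) + (-Real.sin θ) • tang θ := by
      refine ext2 ?_ ?_ <;> simp [tang]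
      · linear_combination -Real.sin_sq_add_cos_sq θ
      · ring
    rw [h, map_add, map_smul, map_smul, hν, smul_zero, zero_add]
  have e1' : A e1 = Real.cos θ • A (tang θ) := by
    have h : (e1 : R2) = Real.sin θ • (circ θ : R2) + Real.cos θ • tang θ := by
      refine ext2 ?_ ?_ <;> simp [tang]
      · ring
      · linear_combination -Real.sin_sq_add_cos_sq θ
    rw [h, map_add, map_smul, map_smul, hν, smul_zero, zero_add]
  have hfrob : frob A = ‖A (tang θ)‖ := by
    have h : ‖A e0‖ ^ 2 + ‖A e1‖ ^ 2 = ‖A (tang θ)‖ ^ 2 := by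
      rw [e0', e1', norm_smul, norm_smul, mul_pow, mul_pow, Real.norm_eq_abs, Real.norm_eq_abs,
        sq_abs, sq_abs, ← add_mul, neg_sq, Real.sin_sq_add_cos_sq, one_mul]
    rw [frob, h, Real.sqrt_sq (norm_nonneg _)]
  rw [hfrob, hτ, norm_smul, Real.norm_of_nonneg hr0.le]

lemma lintegral_frob_le_of_homogeneous {W : R2 → R2} {Ψ : ℝ → R2} {ε : ℝ} (hε : 0 < ε)
    (hW : ∀ r > ε, ∀ θ, W (polar r θ) = Ψ θ) (l : ℝ) :
    ∫⁻ x in Metric.ball 0 l, {x | ε < ‖x‖}.indicator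
        (fun x => ENNReal.ofReal (frob (fderiv ℝ W x))) x
      ≤ ENNReal.ofReal l * ∫⁻ θ in Ioc 0 (2 * Real.pi), ‖deriv Ψ θ‖ₑ := by
  have hm : Measurable ({x : R2 | ε < ‖x‖}.indicator
      (fun x => ENNReal.ofReal (frob (fderiv ℝ W x)))) :=
    (ENNReal.measurable_ofReal.comp
      (continuous_frob.measurable.comp (measurable_fderiv ℝ W))).indicator
        (measurableSet_lt measurable_const measurable_norm)
  rw [lintegral_ball_polar hm]
  calc ∫⁻ r in Ioo 0 l, ENNReal.ofReal r * ∫⁻ θ in Ioc 0 (2 * Real.pi), {x : R2 | ε < ‖x‖}.indicator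
        (fun x => ENNReal.ofReal (frob (fderiv ℝ W x))) (polar r θ)
      ≤ ∫⁻ r in Ioo 0 l, ∫⁻ θ in Ioc 0 (2 * Real.pi), ‖deriv Ψ θ‖ₑ := by
        refine setLIntegral_mono' measurableSet_Ioo fun r hr => ?_
        rw [← lintegral_const_mul' _ _ ENNReal.ofReal_ne_top]
        refine lintegral_mono fun θ => ?_
        by_cases h : polar r θ ∈ {x : R2 | ε < ‖x‖}
        · rw [indicator_of_mem h, ← ENNReal.ofReal_mul hr.1.le, ← ofReal_norm]
          have h' : ε < ‖polar r θ‖ := h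
          rw [norm_polar, abs_of_pos hr.1] at h'
          exact ENNReal.ofReal_le_ofReal (frob_fderiv_le_of_homogeneous hε hW h' θ)
        · rw [indicator_of_notMem h, mul_zero]
          exact zero_le
    _ = ENNReal.ofReal l * ∫⁻ θ in Ioc 0 (2 * Real.pi), ‖deriv Ψ θ‖ₑ := by
        rw [lintegral_const, Measure.restrict_apply_univ, Real.volume_Ioo, sub_zero, mul_comm]

/-- A competitor for the Plateau problem with boundary datum `φ`, shrunk to a small disk and
extended homogeneously, is a nearly optimal approximation of the homogeneous extension of `φ`. -/
lemma exists_smooth_recovery {φ : S1 → R2} {v : R2 → R2} {K : NNReal}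
    (hv : LipschitzOnWith K v (Metric.closedBall 0 1)) (hvφ : ∀ y : S1, v y = φ y) {l : ℝ}
    {η : ℝ} (hη : 0 < η) :
    ∃ w : R2 → R2, ContDiff ℝ 1 w ∧
      tvJ w (Metric.ball 0 l) ≤ tvJ v (Metric.ball 0 1) + ENNReal.ofReal η ∧
      totalVariation w (Metric.ball 0 l) ≤ ENNReal.ofReal l *
        (∫⁻ θ in Ioc 0 (2 * Real.pi), ‖deriv (fun θ => φ (circ θ)) θ‖ₑ) + ENNReal.ofReal η ∧
      ∫⁻ x in Metric.ball 0 l, ‖w x - φ (dirc x)‖ₑ ≤ ENNReal.ofReal η := by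
  have hpi := Real.pi_pos
  have hK := K.coe_nonneg
  -- On the disk of radius `ε` the gradient contributes at most `4 K π ε`.
  obtain ⟨ε, hε, hε1, hε2⟩ : ∃ ε : ℝ, 0 < ε ∧ ε ≤ 1 ∧ 4 * K * Real.pi * ε ≤ η / 2 := by
    refine ⟨min 1 (η / (8 * Real.pi * (K + 1))), lt_min one_pos (by positivity),
      min_le_left _ _, ?_⟩
    have h1 : min 1 (η / (8 * Real.pi * (K + 1))) ≤ η / (8 * Real.pi * (K + 1)) := min_le_right _ _
    have h2 : 4 * K * Real.pi * (η / (8 * Real.pi * (K + 1))) ≤ η / 2 := by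
      rw [mul_div_assoc', div_le_div_iff₀ (by positivity) (by positivity)]
      nlinarith [mul_pos hη hpi]
    exact (mul_le_mul_of_nonneg_left h1 (by positivity)).trans h2
  set w₀ : R2 → R2 := fun x => v (clamp x) with hw₀
  set W : R2 → R2 := fun x => w₀ (ε⁻¹ • x) with hW
  have hw₀L : LipschitzWith (K * 2) w₀ := lipschitz_comp_clamp hv
  have hWL : LipschitzWith (K * 2 * ‖ε⁻¹‖₊) W := hw₀L.comp (lipschitzWith_smul ε⁻¹)
  have hWfar : ∀ x : R2, ε ≤ ‖x‖ → W x = φ (dirc x) := by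
    intro x hx
    have hx0 : 0 < ‖x‖ := hε.trans_le hx
    have h1 : 1 ≤ ‖ε⁻¹ • x‖ := by
      rw [norm_smul, norm_inv, Real.norm_of_nonneg hε.le, ← div_eq_inv_mul]
      exact (one_le_div hε).mpr hx
    have h2 : dirc (ε⁻¹ • x) = dirc x := by
      have e : ε⁻¹ • x = polar (ε⁻¹ * ‖x‖) (argR x) := by
        conv_lhs => rw [← norm_smul_dirc x, smul_smul]
        rw [polar_eq_smul, dirc]
      rw [e, dirc_polar (by positivity), dirc]
    simp only [hW, hw₀]
    rw [clamp_of_le_norm h1, h2, hvφ]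
  have hWpolar : ∀ r > ε, ∀ θ, W (polar r θ) = φ (circ θ) := fun r hr θ => by
    have hr0 : 0 < r := hε.trans hr
    rw [hWfar _ (by rw [norm_polar, abs_of_pos hr0]; exact hr.le), dirc_polar hr0]
  have hWJ : tvJ W (Metric.ball 0 l) ≤ tvJ v (Metric.ball 0 1) := by
    refine (tvJ_ball_le W ε l).trans ?_
    have h1 : tvJ W (Metric.ball 0 ε) = tvJ v (Metric.ball 0 1) := by
      rw [hW, tvJ_comp_smul (inv_pos.mpr hε), inv_mul_cancel₀ hε.ne']
      refine tvJ_congr Metric.isOpen_ball fun x hx => ?_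
      simp only [hw₀]
      rw [clamp_of_norm_le (mem_ball_zero_iff.mp hx).le]
    have h2 : tvJ W {x | ε < ‖x‖ ∧ ‖x‖ < l} = 0 := by
      have hms : MeasurableSet {x : R2 | ε < ‖x‖ ∧ ‖x‖ < l} :=
        (measurableSet_lt measurable_const measurable_norm).inter
          (measurableSet_lt measurable_norm measurable_const)
      rw [tvJ, setLIntegral_congr_fun (g := fun _ => 0) hms, lintegral_zero]
      intro x hx
      have h3 := det_eq_zero_of_polar (F := W) (Ψ := fun θ => φ (circ θ)) (h := fun _ θ => θ)
        (U := Ioi ε) isOpen_Ioi hWpolar (fun _ => continuous_const) (fun _ => continuous_id)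
        (fun _ _ => strictMono_id) hx.1 (norm_pos_iff.mp (hε.trans hx.1))
      simp only
      rw [h3, abs_zero, ENNReal.ofReal_zero]
    rw [h1, h2, add_zero]
  have hvol : volume (Metric.ball (0 : R2) ε) = ENNReal.ofReal (Real.pi * ε ^ 2) := by
    rw [EuclideanSpace.volume_ball_fin_two, ENNReal.ofReal_mul hpi.le, ENNReal.ofReal_pow hε.le,
      mul_comm]
  have hball : ∀ {f : R2 → ℝ≥0∞} {C : ℝ}, 0 ≤ C → (∀ x, ε ≤ ‖x‖ → f x = 0) →
      (∀ x, f x ≤ ENNReal.ofReal C) →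
      ∫⁻ x in Metric.ball 0 l, f x ≤ ENNReal.ofReal (C * (Real.pi * ε ^ 2)) := by
    intro f C hC h0 hfC
    calc ∫⁻ x in Metric.ball 0 l, f x
        ≤ ∫⁻ x, (Metric.ball (0 : R2) ε).indicator (fun _ => ENNReal.ofReal C) x := by
          refine (setLIntegral_le_lintegral _ _).trans (lintegral_mono fun x => ?_)
          by_cases hx : x ∈ Metric.ball (0 : R2) ε
          · rw [indicator_of_mem hx]; exact hfC x
          · rw [indicator_of_notMem hx, h0 x (by simpa using hx)]
      _ = ENNReal.ofReal (C * (Real.pi * ε ^ 2)) := by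
          rw [lintegral_indicator_const measurableSet_ball, hvol, ENNReal.ofReal_mul hC]
  have hWfrob : ∫⁻ x in Metric.ball 0 l, ENNReal.ofReal (frob (fderiv ℝ W x))
      ≤ ENNReal.ofReal l * (∫⁻ θ in Ioc 0 (2 * Real.pi), ‖deriv (fun θ => φ (circ θ)) θ‖ₑ)
        + ENNReal.ofReal (η / 2) := by
    set S : Set R2 := {x | ε < ‖x‖} with hS
    have hSm : MeasurableSet S := measurableSet_lt measurable_const measurable_norm
    set F : R2 → ℝ≥0∞ := fun x => ENNReal.ofReal (frob (fderiv ℝ W x)) with hF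
    have hFm : Measurable F := ENNReal.measurable_ofReal.comp
      (continuous_frob.measurable.comp (measurable_fderiv ℝ W))
    have hsplit : ∀ x, F x = S.indicator F x + Sᶜ.indicator F x := fun x =>
      (indicator_self_add_compl_apply S F x).symm
    have hsphere : ∀ᵐ x : R2, ‖x‖ ≠ ε := by
      rw [ae_iff]
      have : {x : R2 | ¬ ‖x‖ ≠ ε} = Metric.sphere 0 ε := by ext x; simp
      rw [this]
      exact Measure.addHaar_sphere _ _ _
    have h1 : ∫⁻ x in Metric.ball 0 l, F x = (∫⁻ x in Metric.ball 0 l, S.indicator F x)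
        + ∫⁻ x in Metric.ball 0 l, Sᶜ.indicator F x := by
      rw [← lintegral_add_left (hFm.indicator hSm)]
      exact lintegral_congr hsplit
    have hFC : ∀ x, F x ≤ ENNReal.ofReal (4 * K * ε⁻¹) := fun x => by
      refine ENNReal.ofReal_le_ofReal ((frob_le _).trans ?_)
      have h2 := norm_fderiv_le_of_lipschitz ℝ hWL (x₀ := x)
      push_cast at h2
      rw [norm_inv, Real.norm_of_nonneg hε.le] at h2
      linarith
    have h2 : ∫⁻ x in Metric.ball 0 l, Sᶜ.indicator F x
        ≤ ENNReal.ofReal (4 * K * ε⁻¹ * (Real.pi * ε ^ 2)) := by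
      have h3 : ∫⁻ x in Metric.ball 0 l, Sᶜ.indicator F x
          = ∫⁻ x in Metric.ball 0 l, (Metric.ball (0 : R2) ε).indicator F x := by
        refine lintegral_congr_ae (ae_restrict_of_ae ?_)
        filter_upwards [hsphere] with x hx
        by_cases h : ‖x‖ < ε
        · rw [indicator_of_mem (show x ∈ Sᶜ from fun h' => lt_asymm h h'),
            indicator_of_mem (mem_ball_zero_iff.mpr h)]
        · have h' : ε < ‖x‖ := lt_of_le_of_ne (not_lt.mp h) (Ne.symm hx)
          rw [indicator_of_notMem (show x ∉ Sᶜ from fun h'' => h'' h'),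
            indicator_of_notMem (show x ∉ Metric.ball (0 : R2) ε from
              fun h'' => h (mem_ball_zero_iff.mp h''))]
      rw [h3]
      refine hball (by positivity) (fun x hx => ?_) (fun x => ?_)
      · exact indicator_of_notMem (fun h => not_lt.mpr hx (mem_ball_zero_iff.mp h)) _
      · exact (indicator_le_self' (fun _ _ => zero_le) x).trans (hFC x)
    rw [h1]
    refine add_le_add (lintegral_frob_le_of_homogeneous hε hWpolar l) (h2.trans ?_)
    refine ENNReal.ofReal_le_ofReal (le_trans (le_of_eq ?_) hε2)
    field_simp
  have hWL1 : ∫⁻ x in Metric.ball 0 l, ‖W x - φ (dirc x)‖ₑ ≤ ENNReal.ofReal (η / 2) := by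
    refine (hball (C := 2 * K) (by positivity) (fun x hx => ?_) (fun x => ?_)).trans
      (ENNReal.ofReal_le_ofReal ?_)
    · rw [hWfar x hx, sub_self, enorm_zero]
    · rw [← ofReal_norm, ← dist_eq_norm]
      refine ENNReal.ofReal_le_ofReal ?_
      rw [← hvφ]
      refine (hv.dist_le_mul _ (clamp_mem _) _ (by simp)).trans ?_
      rw [mul_comm]
      refine mul_le_mul_of_nonneg_right ?_ hK
      refine (dist_le_norm_add_norm _ _).trans ?_
      have h1 := norm_clamp_le (ε⁻¹ • x)
      have h2 : ‖(dirc x : R2)‖ = 1 := by simp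
      linarith
    · have h3 : (2 * K * Real.pi) * ε ^ 2 ≤ (2 * K * Real.pi) * ε :=
        mul_le_mul_of_nonneg_left (by nlinarith) (by positivity)
      have h4 : 0 ≤ 2 * K * Real.pi * ε := by positivity
      linarith
  -- An approximation within `δ` in the supremum norm has `L¹` error at most `δ` times the area.
  obtain ⟨δ, hδ, hδ1, hδ2⟩ : ∃ δ : ℝ, 0 < δ ∧ δ ≤ η / 2 ∧
      δ * (volume (Metric.ball (0 : R2) l)).toReal ≤ η / 2 := by
    set m := (volume (Metric.ball (0 : R2) l)).toReal
    have hm : 0 ≤ m := ENNReal.toReal_nonneg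
    refine ⟨η / 2 / (1 + m), by positivity, ?_, ?_⟩
    · exact div_le_self (by positivity) (by linarith)
    · rw [div_mul_eq_mul_div, div_le_iff₀ (by positivity)]
      nlinarith
  obtain ⟨w, hw, hwW, hwJ, hwf⟩ := exists_contDiff_approx hWL l hδ
  have hδη : ENNReal.ofReal δ ≤ ENNReal.ofReal (η / 2) := ENNReal.ofReal_le_ofReal hδ1
  have hηη : ENNReal.ofReal (η / 2) + ENNReal.ofReal (η / 2) = ENNReal.ofReal η := by
    rw [← ENNReal.ofReal_add (by positivity) (by positivity), add_halves]
  refine ⟨w, hw, ?_, ?_, ?_⟩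
  · exact hwJ.trans (add_le_add hWJ (ENNReal.ofReal_le_ofReal (by linarith)))
  · refine (totalVariation_le_lintegral_frob Metric.isOpen_ball hw.contDiffOn).trans
      (hwf.trans ?_)
    refine (add_le_add hWfrob hδη).trans ?_
    rw [add_assoc, hηη]
  · have h1 : ∫⁻ x in Metric.ball 0 l, ‖w x - W x‖ₑ ≤ ENNReal.ofReal (η / 2) := by
      calc ∫⁻ x in Metric.ball 0 l, ‖w x - W x‖ₑ
          ≤ ∫⁻ _ in Metric.ball (0 : R2) l, ENNReal.ofReal δ := by
            refine lintegral_mono fun x => ?_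
            rw [← ofReal_norm, ← dist_eq_norm]
            exact ENNReal.ofReal_le_ofReal (hwW x)
        _ = ENNReal.ofReal (δ * (volume (Metric.ball (0 : R2) l)).toReal) := by
            rw [lintegral_const, Measure.restrict_apply_univ, ENNReal.ofReal_mul hδ.le,
              ENNReal.ofReal_toReal measure_ball_lt_top.ne]
        _ ≤ ENNReal.ofReal (η / 2) := ENNReal.ofReal_le_ofReal hδ2
    calc ∫⁻ x in Metric.ball 0 l, ‖w x - φ (dirc x)‖ₑ
        ≤ ∫⁻ x in Metric.ball 0 l, (‖w x - W x‖ₑ + ‖W x - φ (dirc x)‖ₑ) := by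
          refine lintegral_mono fun x => ?_
          rw [← sub_add_sub_cancel (w x) (W x) (φ (dirc x))]
          exact enorm_add_le _ _
      _ = (∫⁻ x in Metric.ball 0 l, ‖w x - W x‖ₑ)
          + ∫⁻ x in Metric.ball 0 l, ‖W x - φ (dirc x)‖ₑ := by
          have hc : Continuous (fun x => w x - W x) := hw.continuous.sub hWL.continuous
          exact lintegral_add_left hc.measurable.enorm _
      _ ≤ ENNReal.ofReal η := (add_le_add h1 hWL1).trans_eq hηη

end Recovery

/-! ### Upper bound for the relaxed total variation of the Jacobian -/

section UpperBound

/-- A left-continuous monotone change of parameter of the circle is the pointwise limit of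
Lipschitz ones, namely of its averages over short intervals to the left. -/
lemma exists_lipschitz_param {S : ℝ → ℝ} (hS : Monotone S)
    (hp : ∀ t, S (t + 2 * Real.pi) = S t + 2 * Real.pi)
    (hl : ∀ t, Tendsto S (𝓝[<] t) (𝓝 (S t))) :
    ∃ α : ℕ → ℝ → ℝ, (∀ k, ∃ K, LipschitzWith K (α k)) ∧ (∀ k, Monotone (α k)) ∧
      (∀ k t, α k (t + 2 * Real.pi) = α k t + 2 * Real.pi) ∧
      ∀ t, Tendsto (fun k => α k t) atTop (𝓝 (S t)) := by
  have hc : ∀ k : ℕ, (0 : ℝ) < (k : ℝ) + 1 := fun k => by positivity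
  have hanti : ∀ (k : ℕ) t, Antitone (fun x => S (t - x / ((k : ℝ) + 1))) := fun k t x y hxy =>
    hS (by have := hc k; gcongr)
  have hint : ∀ (k : ℕ) t, IntervalIntegrable (fun x => S (t - x / ((k : ℝ) + 1))) volume 0 1 :=
    fun k t => (hanti k t).intervalIntegrable
  have hSint : ∀ a b, IntervalIntegrable S volume a b := fun a b => hS.intervalIntegrable
  set α : ℕ → ℝ → ℝ := fun k t => ∫ x in (0:ℝ)..1, S (t - x / ((k : ℝ) + 1)) with hα
  have hmono : ∀ k, Monotone (α k) := fun k t t' h =>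
    intervalIntegral.integral_mono_on zero_le_one (hint k t) (hint k t')
      fun x _ => hS (by linarith)
  refine ⟨α, fun k => ?_, hmono, fun k t => ?_, fun t => ?_⟩
  · have hsub : ∀ t t', t ≤ t' →
        α k t' - α k t ≤ ((k : ℝ) + 1) * (2 * Real.pi) * (t' - t) := by
      intro t t' h
      have e : ∀ t, α k t = ((k : ℝ) + 1) * ∫ x in (t - 1 / ((k : ℝ) + 1))..t, S x := by
        intro t
        simp only [hα]
        rw [intervalIntegral.integral_comp_sub_div S (hc k).ne' t, zero_div, sub_zero, smul_eq_mul]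
      have h1 : (∫ x in (t' - 1 / ((k : ℝ) + 1))..t', S x) - ∫ x in (t - 1 / ((k : ℝ) + 1))..t, S x
          = (∫ x in t..t', S x) - ∫ x in t..t', S (x - 1 / ((k : ℝ) + 1)) := by
        rw [intervalIntegral.integral_comp_sub_right S]
        have a1 := intervalIntegral.integral_add_adjacent_intervals
          (hSint (t - 1 / ((k : ℝ) + 1)) t) (hSint t t')
        have a2 := intervalIntegral.integral_add_adjacent_intervals
          (hSint (t - 1 / ((k : ℝ) + 1)) (t' - 1 / ((k : ℝ) + 1)))
          (hSint (t' - 1 / ((k : ℝ) + 1)) t')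
        linarith
      have hSi2 : IntervalIntegrable (fun x => S (x - 1 / ((k : ℝ) + 1))) volume t t' :=
        Monotone.intervalIntegrable fun x y hxy => hS (by linarith)
      -- The averaging interval is shorter than a period, over which `S` increases by `2π`.
      have h2 : (∫ x in t..t', S x) - ∫ x in t..t', S (x - 1 / ((k : ℝ) + 1))
          ≤ 2 * Real.pi * (t' - t) := by
        rw [← intervalIntegral.integral_sub (hSint t t') hSi2]
        have h3 : ∫ x in t..t', (S x - S (x - 1 / ((k : ℝ) + 1))) ≤ ∫ _ in t..t', 2 * Real.pi := by
          refine intervalIntegral.integral_mono_on h ((hSint t t').sub hSi2)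
            intervalIntegrable_const fun x _ => ?_
          have h4 : 1 / ((k : ℝ) + 1) ≤ 1 := by
            rw [div_le_one (hc k)]
            linarith [k.cast_nonneg (α := ℝ)]
          have h5 : S x ≤ S (x - 1 / ((k : ℝ) + 1) + 2 * Real.pi) :=
            hS (by linarith [Real.pi_gt_three])
          rw [hp] at h5
          linarith
        rw [intervalIntegral.integral_const, smul_eq_mul] at h3
        linarith
      rw [e, e, ← mul_sub, h1, mul_assoc]
      exact mul_le_mul_of_nonneg_left h2 (hc k).le
    have hC : 0 ≤ ((k : ℝ) + 1) * (2 * Real.pi) :=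
      mul_nonneg (hc k).le Real.two_pi_pos.le
    refine ⟨(((k : ℝ) + 1) * (2 * Real.pi)).toNNReal, LipschitzWith.of_dist_le_mul fun t t' => ?_⟩
    rw [Real.coe_toNNReal _ hC, Real.dist_eq, Real.dist_eq]
    rcases le_total t t' with h | h
    · rw [abs_sub_comm, abs_of_nonneg (sub_nonneg.mpr (hmono k h)), abs_sub_comm,
        abs_of_nonneg (sub_nonneg.mpr h)]
      exact hsub t t' h
    · rw [abs_of_nonneg (sub_nonneg.mpr (hmono k h)), abs_of_nonneg (sub_nonneg.mpr h)]
      exact hsub t' t h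
  · have e : ∀ x, S (t + 2 * Real.pi - x / ((k : ℝ) + 1))
        = S (t - x / ((k : ℝ) + 1)) + 2 * Real.pi := fun x => by
      rw [← hp]; congr 1; ring
    simp only [hα]
    simp_rw [e]
    rw [intervalIntegral.integral_add (hint k t) intervalIntegrable_const,
      intervalIntegral.integral_const]
    simp
  · have hlow : ∀ k : ℕ, S (t - 1 / ((k : ℝ) + 1)) ≤ α k t := fun k => by
      have h := intervalIntegral.integral_mono_on (μ := volume) zero_le_one
        (intervalIntegrable_const (c := S (t - 1 / ((k : ℝ) + 1)))) (hint k t)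
        fun x hx => hanti k t hx.2
      simpa using h
    have hup : ∀ k : ℕ, α k t ≤ S t := fun k => by
      have h := intervalIntegral.integral_mono_on (μ := volume) zero_le_one (hint k t)
        (intervalIntegrable_const (c := S t))
        fun x hx => hS (by have := div_nonneg hx.1 (hc k).le; linarith)
      simpa using h
    refine tendsto_of_tendsto_of_tendsto_of_le_of_le ((hl t).comp ?_) tendsto_const_nhds hlow hup
    refine tendsto_nhdsWithin_iff.mpr ⟨?_, Eventually.of_forall fun k => ?_⟩
    · simpa using tendsto_one_div_add_atTop_nhds_zero_nat.const_sub t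
    · have := one_div_pos.mpr (hc k)
      change t - 1 / ((k : ℝ) + 1) < t
      linarith

variable {γ : S1 → R2}

lemma measurable_leftTrace (hγ : MemBVCircle γ) : Measurable (leftTrace γ) := by
  obtain ⟨K, hK⟩ := exists_lipschitz_completedCurve hγ
  have e : leftTrace γ = fun t => completedCurve γ (circ (newParam γ t)) :=
    funext fun t => (completedCurve_newParam hγ t).symm
  rw [e]
  exact (hK.continuous.comp continuous_circ).measurable.comp
    (newParam_strictMono hγ).monotone.measurable

/-- The homogeneous extension of `γ` agrees almost everywhere with a measurable function of the
polar angle. -/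
lemma ae_eq_leftTrace_argR (hγ : MemBVCircle γ) {l : ℝ} {u : R2 → R2}
    (hu : u =ᵐ[volume.restrict (Metric.ball 0 l)] homExt γ) :
    u =ᵐ[volume.restrict (Metric.ball 0 l)] fun x => leftTrace γ (argR x) := by
  obtain ⟨h1, -, -, -, hp⟩ := traces_spec hγ
  have h2 : ∀ᵐ x : R2, γ (dirc x) = leftTrace γ (angle (dirc x)) := by
    refine ae_dirc (p := fun y => γ y = leftTrace γ (angle y)) ?_
    refine ae_restrict_of_ae ?_
    filter_upwards [h1] with t ht
    rw [periodic_angle hp, ht]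
  have h0 : ∀ᵐ x : R2, x ≠ 0 := by
    rw [ae_iff]; simp
  filter_upwards [hu, ae_restrict_of_ae h2, ae_restrict_of_ae h0] with x hx1 hx2 hx3
  rw [hx1, homExt_of_ne hx3, hx2, dirc, periodic_angle hp]

lemma exists_bound_of_lipschitz {φ : S1 → R2} {K : NNReal} (hφ : LipschitzWith K φ) :
    ∃ C : ℝ, 0 ≤ C ∧ ∀ y, ‖φ y‖ ≤ C := by
  obtain ⟨C, hC⟩ := (isCompact_univ (X := S1)).exists_bound_of_continuousOn
    hφ.continuous.continuousOn
  exact ⟨max C 0, le_max_right _ _, fun y => (hC y (mem_univ y)).trans (le_max_left _ _)⟩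

lemma exists_bound_leftTrace (hγ : MemBVCircle γ) : ∃ C : ℝ, 0 ≤ C ∧ ∀ t, ‖leftTrace γ t‖ ≤ C := by
  obtain ⟨K, hK⟩ := exists_lipschitz_completedCurve hγ
  obtain ⟨C, hC0, hC⟩ := exists_bound_of_lipschitz hK
  exact ⟨C, hC0, fun t => by rw [← completedCurve_newParam hγ]; exact hC _⟩

lemma integrableOn_homExt (hγ : MemBVCircle γ) {l : ℝ} {u : R2 → R2}
    (hu : u =ᵐ[volume.restrict (Metric.ball 0 l)] homExt γ) :
    IntegrableOn u (Metric.ball 0 l) := by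
  obtain ⟨C, -, hC⟩ := exists_bound_leftTrace hγ
  have h : IntegrableOn (fun x => leftTrace γ (argR x)) (Metric.ball 0 l) :=
    Measure.integrableOn_of_bounded (M := C) measure_ball_lt_top.ne
      ((measurable_leftTrace hγ).comp measurable_argR).aestronglyMeasurable
      (ae_of_all _ fun x => hC _)
  exact h.congr (ae_eq_leftTrace_argR hγ hu).symm

/-- The Plateau value of a Lipschitz curve is finite. -/
lemma plateau_lt_top {φ : S1 → R2} {K : NNReal} (hφ : LipschitzWith K φ) : plateau φ < ∞ := by
  obtain ⟨w, hw, hwφ⟩ := (lipschitzOn_comp_dirc hφ).extend_finite_dimension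
  have h1 : plateau φ ≤ tvJ w (Metric.ball 0 1) :=
    iInf₂_le w ⟨⟨_, hw.lipschitzOnWith⟩, fun y => by
      rw [← hwφ y.2]
      exact congrArg φ (dirc_coe y)⟩
  refine h1.trans_lt ?_
  set L : NNReal := lipschitzExtensionConstant R2 * K
  have h2 : tvJ w (Metric.ball 0 1) ≤ ∫⁻ _ in Metric.ball (0 : R2) 1, ENNReal.ofReal (L * L) := by
    refine lintegral_mono fun x => ENNReal.ofReal_le_ofReal ?_
    have h3 := abs_det_le (fderiv ℝ w x) 0
    have h4 := norm_fderiv_le_of_lipschitz ℝ hw (x₀ := x)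
    have h5 : ∀ p : R2, ‖p‖ = 1 → ‖fderiv ℝ w x p‖ ≤ L := fun p hp => by
      have := (fderiv ℝ w x).le_opNorm p
      rw [hp, mul_one] at this
      exact this.trans h4
    have h6 : ‖tang 0‖ = 1 := by
      rw [← sq_eq_sq₀ (norm_nonneg _) zero_le_one, norm_sq_R2]
      simp [tang]
    exact h3.trans (mul_le_mul (h5 _ (norm_circ 0)) (h5 _ h6) (norm_nonneg _) L.coe_nonneg)
  refine h2.trans_lt ?_
  rw [lintegral_const, Measure.restrict_apply_univ]
  exact ENNReal.mul_lt_top ENNReal.ofReal_lt_top measure_ball_lt_top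

/-- Reparametrizations of the completed curve by Lipschitz changes of parameter that converge to
the arc-length type parameter converge to `γ`, and their lengths are controlled. -/
lemma exists_curve_sequence (hγ : MemBVCircle γ) :
    ∃ φ : ℕ → S1 → R2, (∃ C : ℝ, 0 ≤ C ∧ ∀ k y, ‖φ k y‖ ≤ C) ∧
      (∀ k, Continuous fun θ => φ k (circ θ)) ∧
      (∀ k, plateau (φ k) ≤ plateau (completedCurve γ)) ∧
      (∀ k, ∫⁻ θ in Ioc 0 (2 * Real.pi), ‖deriv (fun θ => φ k (circ θ)) θ‖ₑ
        ≤ circleVariation γ) ∧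
      ∀ t, Tendsto (fun k => φ k (circ t)) atTop (𝓝 (leftTrace γ t)) := by
  have hpi := Real.two_pi_pos
  obtain ⟨K, hK⟩ := exists_lipschitz_completedCurve hγ
  obtain ⟨C, hC0, hC⟩ := exists_bound_of_lipschitz hK
  obtain ⟨α, hαL, hαm, hαp, hαlim⟩ := exists_lipschitz_param (newParam_strictMono hγ).monotone
    (newParam_add_period hγ) (tendsto_newParam_left hγ)
  set G : ℝ → R2 := fun s => completedCurve γ (circ s) with hG
  have hGp : Function.Periodic G (2 * Real.pi) := comp_circ_periodic _
  have hGL : LipschitzWith (K * 1) G := hK.comp (LipschitzWith.of_dist_le_mul fun s t =>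
    lipschitz_circ.dist_le_mul s t)
  set φ : ℕ → S1 → R2 := fun k y => G (α k (angle y)) with hφ
  have hper : ∀ k, Function.Periodic (fun θ => G (α k θ)) (2 * Real.pi) := fun k θ => by
    simp only
    rw [hαp, hGp]
  have hφc : ∀ k θ, φ k (circ θ) = G (α k θ) := fun k θ => periodic_angle (hper k) θ
  refine ⟨φ, ⟨C, hC0, fun k y => hC _⟩, fun k => ?_, fun k => ?_, fun k => ?_, fun t => ?_⟩
  · obtain ⟨L, hL⟩ := hαL k
    simp_rw [hφc]
    exact hGL.continuous.comp hL.continuous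
  · obtain ⟨L, hL⟩ := hαL k
    exact plateau_comp_le hL (hαm k) (hαp k) (hφc k)
  · obtain ⟨L, hL⟩ := hαL k
    have e : (fun θ => φ k (circ θ)) = G ∘ α k := funext (hφc k)
    rw [e]
    refine (lintegral_deriv_le_eVariationOn hpi (hper k) (hGL.comp hL)).trans ?_
    have h1 : eVariationOn (G ∘ α k) (Icc 0 (2 * Real.pi))
        ≤ eVariationOn G (Icc (α k 0) (α k 0 + 2 * Real.pi)) :=
      eVariationOn.comp_le_of_monotoneOn G (α k) ((hαm k).monotoneOn _) fun x hx =>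
        ⟨hαm k hx.1, by rw [← hαp, zero_add]; exact hαm k hx.2⟩
    rw [eVariationOn_period_eq hpi hGp (hGL.locallyBoundedVariationOn univ)] at h1
    exact h1.trans (eVariationOn_completedCurve_le hγ)
  · simp_rw [hφc]
    rw [← completedCurve_newParam hγ]
    exact (hGL.continuous.tendsto _).comp (hαlim t)

/-- Smooth maps converging strictly to the homogeneous extension of `γ`, whose Jacobians are
controlled by the Plateau value of the completed curve. -/
lemma exists_recovery_sequence (hγ : MemBVCircle γ) {l : ℝ} {u : R2 → R2}
    (hu : u =ᵐ[volume.restrict (Metric.ball 0 l)] homExt γ) :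
    ∃ w : ℕ → R2 → R2, (∀ k, ContDiff ℝ 1 (w k)) ∧
      (∀ k : ℕ, tvJ (w k) (Metric.ball 0 l) ≤ plateau (completedCurve γ)
        + (ENNReal.ofReal (1 / ((k : ℝ) + 1)) + ENNReal.ofReal (1 / ((k : ℝ) + 1)))) ∧
      (∀ k : ℕ, totalVariation (w k) (Metric.ball 0 l)
        ≤ ENNReal.ofReal l * circleVariation γ + ENNReal.ofReal (1 / ((k : ℝ) + 1))) ∧
      Tendsto (fun k => ∫⁻ x in Metric.ball 0 l, ‖w k x - u x‖ₑ) atTop (𝓝 0) := by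
  obtain ⟨φ, ⟨C, hC0, hφC⟩, hφc, hφP, hφV, hφlim⟩ := exists_curve_sequence hγ
  obtain ⟨K₀, hK₀⟩ := exists_lipschitz_completedCurve hγ
  have hfin := plateau_lt_top hK₀
  have hη : ∀ k : ℕ, (0 : ℝ) < 1 / ((k : ℝ) + 1) := fun k => by positivity
  have hex : ∀ k : ℕ, ∃ w : R2 → R2, ContDiff ℝ 1 w ∧
      tvJ w (Metric.ball 0 l) ≤ plateau (completedCurve γ)
        + (ENNReal.ofReal (1 / ((k : ℝ) + 1)) + ENNReal.ofReal (1 / ((k : ℝ) + 1))) ∧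
      totalVariation w (Metric.ball 0 l)
        ≤ ENNReal.ofReal l * circleVariation γ + ENNReal.ofReal (1 / ((k : ℝ) + 1)) ∧
      ∫⁻ x in Metric.ball 0 l, ‖w x - φ k (dirc x)‖ₑ ≤ ENNReal.ofReal (1 / ((k : ℝ) + 1)) := by
    intro k
    have hlt : plateau (φ k) < plateau (completedCurve γ) + ENNReal.ofReal (1 / ((k : ℝ) + 1)) :=
      (hφP k).trans_lt (ENNReal.lt_add_right hfin.ne (ENNReal.ofReal_pos.mpr (hη k)).ne')
    obtain ⟨v, hv⟩ := iInf_lt_iff.mp hlt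
    obtain ⟨⟨⟨K, hvK⟩, hvφ⟩, hvJ⟩ := iInf_lt_iff.mp hv
    obtain ⟨w, hw1, hw2, hw3, hw4⟩ := exists_smooth_recovery hvK hvφ (l := l) (hη k)
    refine ⟨w, hw1, hw2.trans ?_, hw3.trans ?_, hw4⟩
    · rw [← add_assoc]
      exact add_le_add hvJ.le le_rfl
    · exact add_le_add (mul_le_mul_right (hφV k) _) le_rfl
  choose w hw1 hw2 hw3 hw4 using hex
  refine ⟨w, hw1, hw2, hw3, ?_⟩
  have hUm : Measurable (fun x => leftTrace γ (argR x)) :=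
    (measurable_leftTrace hγ).comp measurable_argR
  have hφm : ∀ k, Measurable (fun x : R2 => φ k (dirc x)) := fun k =>
    (hφc k).measurable.comp measurable_argR
  obtain ⟨C', hC'0, hC'⟩ := exists_bound_leftTrace hγ
  have hDCT : Tendsto (fun k => ∫⁻ x in Metric.ball 0 l, ‖φ k (dirc x) - leftTrace γ (argR x)‖ₑ)
      atTop (𝓝 0) := by
    have h := tendsto_lintegral_of_dominated_convergence (μ := volume.restrict (Metric.ball 0 l))
      (F := fun k x => ‖φ k (dirc x) - leftTrace γ (argR x)‖ₑ) (f := fun _ => 0)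
      (fun _ => ENNReal.ofReal (C + C')) (fun k => ((hφm k).sub hUm).enorm)
      (fun k => ae_of_all _ fun x => by
        simp only
        rw [← ofReal_norm]
        exact ENNReal.ofReal_le_ofReal
          ((norm_sub_le _ _).trans (add_le_add (hφC _ _) (hC' _))))
      (by
        rw [lintegral_const, Measure.restrict_apply_univ]
        exact ENNReal.mul_ne_top ENNReal.ofReal_ne_top measure_ball_lt_top.ne)
      (ae_of_all _ fun x => by
        have h1 := ((hφlim (argR x)).sub_const (leftTrace γ (argR x))).enorm
        rw [sub_self, enorm_zero] at h1
        exact h1)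
    rwa [lintegral_zero] at h
  have h0 : Tendsto (fun k : ℕ => ENNReal.ofReal (1 / ((k : ℝ) + 1))) atTop (𝓝 0) := by
    have := ENNReal.tendsto_ofReal (tendsto_one_div_add_atTop_nhds_zero_nat (𝕜 := ℝ))
    rwa [ENNReal.ofReal_zero] at this
  have hsum := h0.add hDCT
  rw [add_zero] at hsum
  refine tendsto_of_tendsto_of_tendsto_of_le_of_le tendsto_const_nhds hsum (fun _ => zero_le)
    fun k => ?_
  calc ∫⁻ x in Metric.ball 0 l, ‖w k x - u x‖ₑ
      = ∫⁻ x in Metric.ball 0 l, ‖w k x - leftTrace γ (argR x)‖ₑ := by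
        refine lintegral_congr_ae ?_
        filter_upwards [ae_eq_leftTrace_argR hγ hu] with x hx
        rw [hx]
    _ ≤ ∫⁻ x in Metric.ball 0 l,
          (‖w k x - φ k (dirc x)‖ₑ + ‖φ k (dirc x) - leftTrace γ (argR x)‖ₑ) := by
        refine lintegral_mono fun x => ?_
        rw [← sub_add_sub_cancel (w k x) (φ k (dirc x)) (leftTrace γ (argR x))]
        exact enorm_add_le _ _
    _ = (∫⁻ x in Metric.ball 0 l, ‖w k x - φ k (dirc x)‖ₑ)
          + ∫⁻ x in Metric.ball 0 l, ‖φ k (dirc x) - leftTrace γ (argR x)‖ₑ :=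
        lintegral_add_left ((hw1 k).continuous.measurable.sub (hφm k)).enorm _
    _ ≤ _ := add_le_add (hw4 k) le_rfl

lemma integrableOn_ball_of_continuous {w : R2 → R2} (hw : Continuous w) (l : ℝ) :
    IntegrableOn w (Metric.ball 0 l) :=
  (hw.continuousOn.integrableOn_compact (isCompact_closedBall 0 l)).mono_set
    Metric.ball_subset_closedBall

/-- The total variation of the homogeneous extension on the disk of radius `l` is `l` times the
total variation of the curve. -/
lemma totalVariation_homExt (hγ : MemBVCircle γ) {l : ℝ} (hl : 0 < l) {u : R2 → R2}
    (hu : u =ᵐ[volume.restrict (Metric.ball 0 l)] homExt γ) :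
    totalVariation u (Metric.ball 0 l) = ENNReal.ofReal l * circleVariation γ := by
  refine le_antisymm ?_ (mul_circleVariation_le_totalVariation hl hu)
  obtain ⟨w, hw1, -, hw3, hw4⟩ := exists_recovery_sequence hγ hu
  refine (totalVariation_le_liminf (fun k => integrableOn_ball_of_continuous (hw1 k).continuous l)
    (integrableOn_homExt hγ hu) hw4).trans ?_
  have h0 : Tendsto (fun k : ℕ => ENNReal.ofReal l * circleVariation γ
      + ENNReal.ofReal (1 / ((k : ℝ) + 1))) atTop (𝓝 (ENNReal.ofReal l * circleVariation γ)) := by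
    have := (ENNReal.tendsto_ofReal (tendsto_one_div_add_atTop_nhds_zero_nat
      (𝕜 := ℝ))).const_add (ENNReal.ofReal l * circleVariation γ)
    rwa [ENNReal.ofReal_zero, add_zero] at this
  rw [← h0.liminf_eq]
  exact liminf_le_liminf (Eventually.of_forall hw3)

theorem relaxedTVJ_le_plateau_completedCurve (hγ : MemBVCircle γ) {l : ℝ} (hl : 0 < l)
    {u : R2 → R2} (hu : u =ᵐ[volume.restrict (Metric.ball 0 l)] homExt γ) :
    relaxedTVJ u (Metric.ball 0 l) ≤ plateau (completedCurve γ) := by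
  obtain ⟨w, hw1, hw2, hw3, hw4⟩ := exists_recovery_sequence hγ hu
  have hTV := totalVariation_homExt hγ hl hu
  have hfin : ENNReal.ofReal l * circleVariation γ < ∞ :=
    ENNReal.mul_lt_top ENNReal.ofReal_lt_top hγ.2
  have hmem : ∀ k, MemBV (w k) (Metric.ball 0 l) := fun k =>
    ⟨integrableOn_ball_of_continuous (hw1 k).continuous l,
      (hw3 k).trans_lt (ENNReal.add_lt_top.mpr ⟨hfin, ENNReal.ofReal_lt_top⟩)⟩
  have hη : Tendsto (fun k : ℕ => ENNReal.ofReal (1 / ((k : ℝ) + 1))) atTop (𝓝 0) := by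
    have := ENNReal.tendsto_ofReal (tendsto_one_div_add_atTop_nhds_zero_nat (𝕜 := ℝ))
    rwa [ENNReal.ofReal_zero] at this
  have hstrict : StrictBV w u (Metric.ball 0 l) := by
    refine ⟨hmem, ⟨integrableOn_homExt hγ hu, by rwa [hTV]⟩, hw4, ?_⟩
    refine tendsto_of_le_liminf_of_limsup_le
      (totalVariation_le_liminf (fun k => (hmem k).1) (integrableOn_homExt hγ hu) hw4) ?_
    have h0 := hη.const_add (ENNReal.ofReal l * circleVariation γ)
    rw [add_zero] at h0
    rw [hTV, ← h0.limsup_eq]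
    exact limsup_le_limsup (Eventually.of_forall hw3)
  refine (iInf₂_le w ⟨fun k => (hw1 k).contDiffOn, hstrict⟩).trans ?_
  have h0 := (hη.add hη).const_add (plateau (completedCurve γ))
  rw [add_zero, add_zero] at h0
  rw [← h0.liminf_eq]
  exact liminf_le_liminf (Eventually.of_forall hw2)

end UpperBound

/-! ### Lower bound for the relaxed total variation of the Jacobian -/

section Slicing

/-- The total variation on the circle is lower semicontinuous under convergence in `L¹`. -/
lemma circleVariation_le_liminf {φ : ℕ → S1 → R2} {γ : S1 → R2}
    (hφ : ∀ k, LocallyIntegrable fun θ => φ k (circ θ))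
    (hγ : LocallyIntegrable fun θ => γ (circ θ))
    (hlim : Tendsto (fun k => ∫⁻ θ in Ioc 0 (2 * Real.pi), ‖φ k (circ θ) - γ (circ θ)‖ₑ) atTop
      (𝓝 0)) :
    circleVariation γ ≤ liminf (fun k => circleVariation (φ k)) atTop := by
  refine iSup₂_le fun f hf => ?_
  have hf' : Continuous (deriv f) := hf.1.continuous_deriv le_rfl
  obtain ⟨C, hC⟩ := (isCompact_Icc (a := (0 : ℝ)) (b := 2 * Real.pi)).exists_bound_of_continuousOn
    hf'.continuousOn
  have hint : ∀ {g : S1 → R2}, (LocallyIntegrable fun θ => g (circ θ)) →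
      IntegrableOn (fun θ => inner ℝ (g (circ θ)) (deriv f θ)) (Ioc 0 (2 * Real.pi)) :=
    fun hg => integrableOn_inner_of_bounded hg hf' 0 (2 * Real.pi)
  have h0 : Tendsto (fun k => ENNReal.ofReal C
      * ∫⁻ θ in Ioc 0 (2 * Real.pi), ‖φ k (circ θ) - γ (circ θ)‖ₑ) atTop (𝓝 0) := by
    have := ENNReal.Tendsto.const_mul (a := ENNReal.ofReal C) hlim (Or.inr ENNReal.ofReal_ne_top)
    rwa [mul_zero] at this
  have hconv : Tendsto
      (fun k => ∫ θ in Ioc 0 (2 * Real.pi), inner ℝ (φ k (circ θ)) (deriv f θ)) atTop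
      (𝓝 (∫ θ in Ioc 0 (2 * Real.pi), inner ℝ (γ (circ θ)) (deriv f θ))) := by
    refine tendsto_integral_of_L1 _ (hint hγ).1 (Eventually.of_forall fun k => hint (hφ k)) ?_
    refine tendsto_of_tendsto_of_tendsto_of_le_of_le tendsto_const_nhds h0 (fun _ => zero_le)
      fun k => ?_
    simp only
    rw [← lintegral_const_mul' _ _ ENNReal.ofReal_ne_top]
    refine setLIntegral_mono' measurableSet_Ioc fun θ hθ => ?_
    have hCθ := hC θ (Ioc_subset_Icc_self hθ)
    rw [← inner_sub_left, ← ofReal_norm, ← ofReal_norm,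
      ← ENNReal.ofReal_mul ((norm_nonneg _).trans hCθ)]
    refine ENNReal.ofReal_le_ofReal ((norm_inner_le_norm _ _).trans ?_)
    rw [mul_comm]
    exact mul_le_mul_of_nonneg_right hCθ (norm_nonneg _)
  rw [← (ENNReal.tendsto_ofReal hconv).liminf_eq]
  exact liminf_le_liminf (Eventually.of_forall fun k => le_iSup₂_of_le f hf le_rfl)

lemma circleVariation_le_lintegral_deriv {φ : S1 → R2} {ψ : ℝ → R2} (hψ : Continuous ψ)
    (hd : ∀ θ, HasDerivAt (fun θ => φ (circ θ)) (ψ θ) θ) :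
    circleVariation φ ≤ ∫⁻ θ in Ioc 0 (2 * Real.pi), ‖ψ θ‖ₑ := by
  have hpi := Real.two_pi_pos
  have hc : Continuous (fun θ => φ (circ θ)) :=
    continuous_iff_continuousAt.mpr fun θ => (hd θ).continuousAt
  have hI : ∀ a b, IntervalIntegrable (fun θ => ‖ψ θ‖) volume a b := fun a b =>
    hψ.norm.intervalIntegrable a b
  have hdist : ∀ x y, x ≤ y → dist (φ (circ x)) (φ (circ y))
      ≤ (∫ θ in (0:ℝ)..y, ‖ψ θ‖) - ∫ θ in (0:ℝ)..x, ‖ψ θ‖ := by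
    intro x y hxy
    rw [intervalIntegral.integral_interval_sub_left (hI 0 y) (hI 0 x), dist_comm, dist_eq_norm,
      ← intervalIntegral.integral_eq_sub_of_hasDerivAt (fun θ _ => hd θ)
        (hψ.intervalIntegrable x y)]
    exact intervalIntegral.norm_integral_le_integral_norm hxy
  have hev : ∀ a b, a ≤ b → eVariationOn (fun θ => φ (circ θ)) (Icc a b)
      ≤ ENNReal.ofReal ((∫ θ in (0:ℝ)..b, ‖ψ θ‖) - ∫ θ in (0:ℝ)..a, ‖ψ θ‖) := fun a b hab =>
    eVariationOn_le_of_dist_le hab fun x _ y _ hxy => hdist x y hxy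
  have hbv : LocallyBoundedVariationOn (fun θ => φ (circ θ)) univ :=
    locallyBoundedVariationOn_of_periodic hpi fun a =>
      ((hev a _ (by linarith)).trans_lt ENNReal.ofReal_lt_top).ne
  have h1 := perVar_le_eVariationOn hpi (comp_circ_periodic φ) hc.locallyIntegrable
    (ae_of_all _ fun _ => rfl) (comp_circ_periodic φ) hbv
  refine h1.trans ((hev 0 _ hpi.le).trans_eq ?_)
  rw [intervalIntegral.integral_same, sub_zero, intervalIntegral.integral_of_le hpi.le,
    ofReal_integral_norm_eq_lintegral_enorm (hψ.integrableOn_Ioc)]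

section Circle

variable {v : R2 → R2} {l r : ℝ}

lemma smul_coe_mem_ball (hr : 0 < r) (hrl : r < l) {x : R2}
    (hx : x ∈ Metric.closedBall (0 : R2) 1) :
    r • x ∈ Metric.closedBall (0 : R2) r ∧ Metric.closedBall (0 : R2) r ⊆ Metric.ball 0 l := by
  refine ⟨?_, Metric.closedBall_subset_ball hrl⟩
  rw [mem_closedBall_zero_iff] at hx ⊢
  rw [norm_smul, Real.norm_of_nonneg hr.le]
  exact mul_le_of_le_one_right hr.le hx

lemma exists_lipschitzOnWith_comp_smul (hv : ContDiffOn ℝ 1 v (Metric.ball 0 l)) (hr : 0 < r)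
    (hrl : r < l) : ∃ K, LipschitzOnWith K (fun x => v (r • x)) (Metric.closedBall 0 1) := by
  obtain ⟨K, hK⟩ := (hv.mono (Metric.closedBall_subset_ball hrl)).exists_lipschitzOnWith
    one_ne_zero (convex_closedBall (0 : R2) r) (isCompact_closedBall 0 r)
  exact ⟨K * ‖r‖₊, hK.comp ((lipschitzWith_smul r).lipschitzOnWith)
    fun x hx => (smul_coe_mem_ball hr hrl hx).1⟩

/-- The restriction of a `C¹` map to a circle is a boundary datum whose Plateau value is at most
the total variation of the Jacobian. -/
lemma plateau_circle_le (hv : ContDiffOn ℝ 1 v (Metric.ball 0 l)) (hr : 0 < r) (hrl : r < l) :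
    plateau (fun y : S1 => v (r • (y : R2))) ≤ tvJ v (Metric.ball 0 l) := by
  refine (iInf₂_le (fun x => v (r • x))
    ⟨exists_lipschitzOnWith_comp_smul hv hr hrl, fun _ => rfl⟩).trans ?_
  rw [tvJ_comp_smul hr, mul_one]
  exact tvJ_mono v (Metric.ball_subset_ball hrl.le)

lemma exists_lipschitzWith_circle (hv : ContDiffOn ℝ 1 v (Metric.ball 0 l)) (hr : 0 < r)
    (hrl : r < l) : ∃ K, LipschitzWith K (fun y : S1 => v (r • (y : R2))) := by
  obtain ⟨K, hK⟩ := exists_lipschitzOnWith_comp_smul hv hr hrl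
  refine ⟨K, fun y z => ?_⟩
  exact hK (Metric.sphere_subset_closedBall y.2) (Metric.sphere_subset_closedBall z.2)

/-- The variation of a `C¹` map along a circle is bounded by the integral of its angular
derivative. -/
lemma circleVariation_circle_le (hv : ContDiffOn ℝ 1 v (Metric.ball 0 l)) (hr : 0 < r)
    (hrl : r < l) :
    circleVariation (fun y : S1 => v (r • (y : R2))) ≤ ENNReal.ofReal r *
      ∫⁻ θ in Ioc 0 (2 * Real.pi), ‖fderiv ℝ v (polar r θ) (angField (polar r θ))‖ₑ := by
  have hmem : ∀ θ, polar r θ ∈ Metric.ball (0 : R2) l := fun θ => by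
    rw [mem_ball_zero_iff, norm_polar, abs_of_pos hr]; exact hrl
  have hpc : Continuous (fun θ => polar r θ) :=
    continuous_polar.comp (by fun_prop : Continuous fun θ : ℝ => (r, θ))
  have htc : Continuous tang := continuous_iff_continuousAt.mpr fun θ =>
    (hasDerivAt_tang θ).continuousAt
  have hψ : Continuous (fun θ => fderiv ℝ v (polar r θ) (r • tang θ)) :=
    (((hv.continuousOn_fderiv_of_isOpen Metric.isOpen_ball le_rfl).comp_continuous hpc
      hmem).clm_apply (htc.const_smul r))
  have hd : ∀ θ, HasDerivAt (fun θ => v (r • (circ θ : R2)))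
      (fderiv ℝ v (polar r θ) (r • tang θ)) θ := by
    intro θ
    have h1 : DifferentiableAt ℝ v (polar r θ) :=
      (hv.contDiffAt (Metric.isOpen_ball.mem_nhds (hmem θ))).differentiableAt one_ne_zero
    have h2 := HasFDerivAt.comp_hasDerivAt (f := fun s => polar r s) θ h1.hasFDerivAt
      (hasDerivAt_polar r θ)
    simp_rw [← polar_eq_smul]
    exact h2
  refine (circleVariation_le_lintegral_deriv hψ hd).trans_eq ?_
  rw [← lintegral_const_mul' _ _ ENNReal.ofReal_ne_top]
  refine lintegral_congr fun θ => ?_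
  rw [angField_polar hr, map_smul, enorm_smul, ← ofReal_norm, Real.norm_of_nonneg hr.le]

end Circle

/-- A sequence of functions that converges to zero in `L¹` has a subsequence that converges to
zero almost everywhere. -/
lemma exists_subseq_ae_tendsto_zero {α : Type*} [MeasurableSpace α] {μ : Measure α}
    {G : ℕ → α → ℝ≥0∞} (hG : ∀ k, Measurable (G k))
    (h : Tendsto (fun k => ∫⁻ x, G k x ∂μ) atTop (𝓝 0)) :
    ∃ ms : ℕ → ℕ, StrictMono ms ∧ ∀ᵐ x ∂μ, Tendsto (fun k => G (ms k) x) atTop (𝓝 0) := by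
  obtain ⟨ms, hms, hsm⟩ := extraction_forall_of_eventually
    (P := fun n k => ∫⁻ x, G k x ∂μ ≤ (2⁻¹ : ℝ≥0∞) ^ n) fun n =>
      (h.eventually_lt_const (ENNReal.pow_pos (by simp) n)).mono fun _ hk => hk.le
  refine ⟨ms, hms, ?_⟩
  have hsum : ∫⁻ x, ∑' k, G (ms k) x ∂μ ≠ ∞ := by
    rw [lintegral_tsum fun k => (hG _).aemeasurable]
    refine ne_top_of_le_ne_top ?_ (ENNReal.tsum_le_tsum hsm)
    rw [ENNReal.tsum_geometric]
    simp
  filter_upwards [ae_lt_top (Measurable.tsum fun k => hG (ms k)) hsum] with x hx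
  exact ENNReal.tendsto_atTop_zero_of_tsum_ne_top hx.ne

lemma measurable_lintegral_polar {f : R2 → ℝ≥0∞} (hf : Measurable f) :
    Measurable (fun r => ENNReal.ofReal r * ∫⁻ θ in Ioc 0 (2 * Real.pi), f (polar r θ)) := by
  have h : Measurable (fun p : ℝ × ℝ => f (polar p.1 p.2)) := hf.comp continuous_polar.measurable
  exact ENNReal.measurable_ofReal.mul h.lintegral_prod_right'

/-- Almost every circle sees a subsequence converging strictly to `γ`: Fubini's theorem in polar
coordinates and Fatou's lemma select a radius at which the variations do not exceed that of `γ`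
in the limit. -/
theorem relaxedPlateau_le_relaxedTVJ {γ : S1 → R2} (hγ : MemBVCircle γ) {l : ℝ} (hl : 0 < l)
    {u : R2 → R2} (hu : u =ᵐ[volume.restrict (Metric.ball 0 l)] homExt γ) :
    relaxedPlateau γ ≤ relaxedTVJ u (Metric.ball 0 l) := by
  classical
  refine le_iInf₂ ?_
  rintro v₀ ⟨hv₀, -, -, hL1₀, hTV₀⟩
  by_contra! hcon
  obtain ⟨a, ha1, ha2⟩ := exists_between hcon
  have hfreq : ∃ᶠ n in atTop, tvJ (v₀ n) (Metric.ball 0 l) < a :=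
    frequently_lt_of_liminf_lt (by isBoundedDefault) ha1
  obtain ⟨ns, hns, hnsa⟩ := extraction_of_frequently_atTop hfreq
  rw [totalVariation_homExt hγ hl hu] at hTV₀
  set U : R2 → R2 := fun x => leftTrace γ (argR x) with hU
  have hUm : Measurable U := (measurable_leftTrace hγ).comp measurable_argR
  obtain ⟨htr, -, -, -, hgp⟩ := traces_spec hγ
  have hUpolar : ∀ r > 0, ∀ θ, U (polar r θ) = leftTrace γ θ := fun r hr θ =>
    periodic_argR_polar hgp hr θ
  -- The maps are changed outside the disk to be measurable.
  set Z : ℕ → R2 → R2 := fun k => (Metric.ball (0 : R2) l).piecewise (v₀ (ns k)) (fun _ => 0)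
    with hZ
  have hZm : ∀ k, Measurable (Z k) := fun k =>
    (hv₀ _).continuousOn.measurable_piecewise continuousOn_const measurableSet_ball
  have hZv : ∀ k, ∀ x ∈ Metric.ball (0 : R2) l, Z k x = v₀ (ns k) x := fun k x hx =>
    piecewise_eq_of_mem _ _ _ hx
  set G : ℕ → ℝ → ℝ≥0∞ := fun k r =>
    ENNReal.ofReal r * ∫⁻ θ in Ioc 0 (2 * Real.pi), ‖Z k (polar r θ) - U (polar r θ)‖ₑ with hG
  have hdm : ∀ k, Measurable (fun x => ‖Z k x - U x‖ₑ) := fun k => ((hZm k).sub hUm).enorm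
  have hGm : ∀ k, Measurable (G k) := fun k => measurable_lintegral_polar (hdm k)
  have hGlim : Tendsto (fun k => ∫⁻ r in Ioo 0 l, G k r) atTop (𝓝 0) := by
    have e : ∀ k, ∫⁻ r in Ioo 0 l, G k r = ∫⁻ x in Metric.ball 0 l, ‖v₀ (ns k) x - u x‖ₑ := by
      intro k
      rw [← lintegral_ball_polar (hdm k)]
      refine lintegral_congr_ae ?_
      filter_upwards [ae_restrict_mem measurableSet_ball, ae_eq_leftTrace_argR hγ hu] with x h1 h2
      rw [hZv k x h1, h2]
    simp_rw [e]
    exact hL1₀.comp hns.tendsto_atTop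
  obtain ⟨ms, hms, hGae⟩ := exists_subseq_ae_tendsto_zero hGm hGlim
  set v : ℕ → R2 → R2 := fun k => v₀ (ns (ms k)) with hv
  have hvC : ∀ k, ContDiffOn ℝ 1 (v k) (Metric.ball 0 l) := fun k => hv₀ _
  set F : ℕ → ℝ → ℝ≥0∞ := fun k r => ENNReal.ofReal r *
    ∫⁻ θ in Ioc 0 (2 * Real.pi), ‖fderiv ℝ (v k) (polar r θ) (angField (polar r θ))‖ₑ with hF
  have hFm : ∀ k, Measurable (F k) := fun k =>
    measurable_lintegral_polar (measurable_fderiv_angField (v k)).enorm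
  have hFint : ∀ k, ∫⁻ r in Ioo 0 l, F k r ≤ totalVariation (v k) (Metric.ball 0 l) := fun k => by
    rw [← lintegral_ball_polar (measurable_fderiv_angField (v k)).enorm]
    exact lintegral_angular_le_totalVariation hl (hvC k)
  have hTV : Tendsto (fun k => totalVariation (v k) (Metric.ball 0 l)) atTop
      (𝓝 (ENNReal.ofReal l * circleVariation γ)) :=
    hTV₀.comp (hns.tendsto_atTop.comp hms.tendsto_atTop)
  have hFatou : ∫⁻ r in Ioo 0 l, liminf (fun k => F k r) atTop
      ≤ ENNReal.ofReal l * circleVariation γ :=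
    (lintegral_liminf_le hFm).trans
      ((liminf_le_liminf (Eventually.of_forall hFint)).trans_eq hTV.liminf_eq)
  have hl0 : ENNReal.ofReal l ≠ 0 := (ENNReal.ofReal_pos.mpr hl).ne'
  obtain ⟨r, hrG, hr, hrF⟩ : ∃ r, Tendsto (fun k => G (ms k) r) atTop (𝓝 0) ∧ r ∈ Ioo 0 l ∧
      liminf (fun k => F k r) atTop ≤ circleVariation γ := by
    have hμ : volume.restrict (Ioo 0 l) ≠ 0 := by
      rw [Ne, Measure.restrict_eq_zero, Real.volume_Ioo, sub_zero]
      exact hl0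
    have hN := hGae.and (ae_restrict_mem (μ := volume) (measurableSet_Ioo (a := (0:ℝ)) (b := l)))
    obtain ⟨r, hrN, hr⟩ := exists_notMem_null_le_laverage hμ
      (Measurable.liminf hFm).aemeasurable (ae_iff.mp hN)
    have hrN' := not_not.mp hrN
    refine ⟨r, hrN'.1, hrN'.2, hr.trans ?_⟩
    rw [laverage_eq, Measure.restrict_apply_univ, Real.volume_Ioo, sub_zero]
    exact ENNReal.div_le_of_le_mul' hFatou
  have hη : ∀ j : ℕ, (0 : ℝ) < 1 / ((j : ℝ) + 1) := fun j => by positivity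
  obtain ⟨ks, hks, hksF⟩ := extraction_forall_of_frequently
    (P := fun j k => F k r < circleVariation γ + ENNReal.ofReal (1 / ((j : ℝ) + 1))) fun j =>
      frequently_lt_of_liminf_lt (by isBoundedDefault)
        (hrF.trans_lt (ENNReal.lt_add_right hγ.2.ne (ENNReal.ofReal_pos.mpr (hη j)).ne'))
  set φ : ℕ → S1 → R2 := fun j y => v (ks j) (r • (y : R2)) with hφ
  have hφL : ∀ j, ∃ K, LipschitzWith K (φ j) := fun j =>
    exists_lipschitzWith_circle (hvC _) hr.1 hr.2
  have hφc : ∀ j, Continuous fun θ => φ j (circ θ) := fun j => by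
    obtain ⟨K, hK⟩ := hφL j
    exact hK.continuous.comp continuous_circ
  have hφV : ∀ j : ℕ, circleVariation (φ j)
      ≤ circleVariation γ + ENNReal.ofReal (1 / ((j : ℝ) + 1)) := fun j =>
    (circleVariation_circle_le (hvC _) hr.1 hr.2).trans (hksF j).le
  have hφ1 : Tendsto (fun j => ∫⁻ θ in Ioc 0 (2 * Real.pi), ‖φ j (circ θ) - γ (circ θ)‖ₑ) atTop
      (𝓝 0) := by
    have hr0 : ENNReal.ofReal r ≠ 0 := (ENNReal.ofReal_pos.mpr hr.1).ne'
    have e : ∀ j, ∫⁻ θ in Ioc 0 (2 * Real.pi), ‖φ j (circ θ) - γ (circ θ)‖ₑ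
        = (ENNReal.ofReal r)⁻¹ * G (ms (ks j)) r := by
      intro j
      simp only [hG]
      rw [← mul_assoc, ENNReal.inv_mul_cancel hr0 ENNReal.ofReal_ne_top, one_mul]
      refine lintegral_congr_ae ?_
      filter_upwards [ae_restrict_of_ae htr] with θ hθ
      rw [hUpolar r hr.1, ← hθ, hZv _ _ (by
        rw [mem_ball_zero_iff, norm_polar, abs_of_pos hr.1]; exact hr.2), polar_eq_smul]
    simp_rw [e]
    have := ENNReal.Tendsto.const_mul (a := (ENNReal.ofReal r)⁻¹) (hrG.comp hks.tendsto_atTop)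
      (Or.inr (ENNReal.inv_ne_top.mpr hr0))
    rwa [mul_zero] at this
  have hη0 : Tendsto (fun j : ℕ => circleVariation γ + ENNReal.ofReal (1 / ((j : ℝ) + 1))) atTop
      (𝓝 (circleVariation γ)) := by
    have := (ENNReal.tendsto_ofReal (tendsto_one_div_add_atTop_nhds_zero_nat
      (𝕜 := ℝ))).const_add (circleVariation γ)
    rwa [ENNReal.ofReal_zero, add_zero] at this
  have hstrict : StrictBVCircle φ γ := by
    refine ⟨fun j => ⟨(hφc j).integrableOn_Ioc, (hφV j).trans_lt
      (ENNReal.add_lt_top.mpr ⟨hγ.2, ENNReal.ofReal_lt_top⟩)⟩, hγ, hφ1, ?_⟩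
    refine tendsto_of_le_liminf_of_limsup_le (circleVariation_le_liminf
      (fun j => (hφc j).locallyIntegrable) hγ.locallyIntegrable hφ1) ?_
    rw [← hη0.limsup_eq]
    exact limsup_le_limsup (Eventually.of_forall hφV)
  have hle : relaxedPlateau γ ≤ liminf (fun j => plateau (φ j)) atTop :=
    iInf₂_le φ ⟨hφL, hstrict⟩
  refine absurd (hle.trans ?_) (not_le.mpr ha2)
  exact liminf_le_of_le (by isBoundedDefault) fun b hb => by
    obtain ⟨j, hj⟩ := hb.exists
    exact hj.trans ((plateau_circle_le (hvC _) hr.1 hr.2).trans (hnsa _).le)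

end Slicing

end PlateauBV

end

theorem mainTheorem2 (l : ℝ) (hl : 0 < l) (γ : PlateauBV.S1 → PlateauBV.R2)
    (hγ : PlateauBV.MemBVCircle γ) (u : PlateauBV.R2 → PlateauBV.R2)
    (hu : u =ᵐ[volume.restrict (Metric.ball 0 l)] PlateauBV.homExt γ) :
    (∃ K, LipschitzWith K (PlateauBV.completedCurve γ)) ∧
      PlateauBV.relaxedTVJ u (Metric.ball 0 l) = PlateauBV.relaxedPlateau γ ∧
      PlateauBV.relaxedPlateau γ = PlateauBV.plateau (PlateauBV.completedCurve γ) := by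
  have h1 := PlateauBV.relaxedPlateau_le_relaxedTVJ hγ hl hu
  have h2 := PlateauBV.relaxedTVJ_le_plateau_completedCurve hγ hl hu
  have h3 := PlateauBV.plateau_completedCurve_le_relaxedPlateau hγ
  exact ⟨PlateauBV.exists_lipschitz_completedCurve hγ, le_antisymm (h2.trans h3) h1,
    le_antisymm (h1.trans h2) h3⟩
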